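/- **Theorem 1.1.** Let $\mathbb T=\mathbb R/2\pi\mathbb Z$. For $f\in L^2(\mathbb R\times\mathbb T)$ (complex valued) let $\widehat f(\xi,\eta)=\int_{\mathbb T}\int_{\mathbb R} f(x,y)e^{-ix\xi-iy\eta}\,dx\,dy$, $\xi\in\mathbb R$, $\eta\in\mathbb Z$, be its Fourier transform (in the $L^2$ sense). Put $\omega(\xi,\eta)=\operatorname{sign}(\xi)\xi^2+\operatorname{sign}(\xi)\eta^2$ and, for $t\in\mathbb R$, define $U(t)$ and the Hilbert transform $\mathcal H_x$ on $L^2(\mathbb R\times\mathbb T)$ by $\widehat{U(t)f}=e^{it\omega}\widehat f$ and $\widehat{\mathcal H_xf}(\xi,\eta)=-i\operatorname{sign}(\xi)\widehat f(\xi,\eta)$. Write $\langle a\rangle=(1+a^2)^{1/2}$, $\|\cdot\|_{L^2}$ for the norm of $L^2(\mathbb R\times\mathbb T)$, and $\|f\|_{H^{s_1,s_2}}=\|J_x^{s_1}f\|_{L^2}+\|J_y^{s_2}f\|_{L^2}$, where $\widehat{J_x^{s}f}=\langle\xi\rangle^{s}\widehat f$ and $\widehat{J_y^{s}f}=\langle\eta\rangle^{s}\widehat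 f$; $H^{s_1,s_2}=H^{s_1,s_2}(\mathbb R\times\mathbb T)$ is the space where this norm is finite. In (i)–(iv), the constant $C>0$ depends only on $\theta$ (and on $k$ in (iv)), and the estimates hold for all $t\in\mathbb R$ and all $f$ as described. Consider the estimate $$\|\langle x\rangle^{\theta}U(t)f\|_{L^2}\le C\langle t\rangle^{\theta}\big(\|\langle x\rangle^{\theta}f\|_{L^2}+\|f\|_{H^{\theta,0}}\big).\tag{1}$$ (i) Let $0<\theta<\frac12$. If $f\in H^{\theta,0}\cap L^2(|x|^{2\theta}\,dx\,dy)$, then (1) holds. (ii) If $f\in H^{\frac12,0}\cap L^2(|x|\,dx\,dy)$ and $\mathcal H_xf\in L^2(|x|\,dx\,dy)$, then $$\|\langle x\rangle^{\frac12}U(t)f\|_{L^2}\le C\langle t\rangle^{\frac12}\big(\|\langle x\rangle^{\frac12}f\|_{L^2}+\|\langle x\rangle^{\frac12}\mathcal H_xf\|_{L^2}+\|f\|_{H^{\frac12,0}}\big).$$ (iii) Let $\frac12<\theta<\frac32$. If $f\in H^{\theta,0}\cap L^2(|x|^{2\theta}\,dx\,dy)$ and $$\int_{\mathbb T}\int_{\mathbb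 R}e^{-i\eta y}f(x,y)\,dx\,dy=0\quad\text{for all }\eta\in\mathbb Z\setminus\{0\},$$ then (1) holds. (iv) Let $k\ge1$ be an integer, $k+\frac12\le\theta<k+\frac32$, and $f\in H^{\theta,0}\cap L^2(|x|^{2\theta}\,dx\,dy)$. Assume that $$\int_{\mathbb T}\int_{\mathbb R}e^{-i\eta y}x^{l}f(x,y)\,dx\,dy=0\quad\text{for all }\eta\in\mathbb Z\setminus\{0\},\ l=0,1,\dots,k-1,$$ and, if $k\ge2$, that $$\int_{\mathbb T}\int_{\mathbb R}x^{l}f(x,y)\,dx\,dy=0\quad\text{for all }l=0,1,\dots,k-2.$$ If $\theta=k+\frac12$ and, in addition, $\mathcal H_x(x^kf)\in L^2(|x|\,dx\,dy)$, then $$\|\langle x\rangle^{k+\frac12}U(t)f\|_{L^2}\le C\langle t\rangle^{k+\frac12}\big(\|\langle x\rangle^{k+\frac12}f\|_{L^2}+\|\langle x\rangle^{\frac12}\mathcal H_x(x^kf)\|_{L^2}+\|f\|_{H^{k+\frac12,0}}\big).$$ If $k+\frac12<\theta<k+\frac32$ and, in addition, $$\int_{\mathbb T}\int_{\mathbb R}e^{-i\eta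 y}x^{k}f(x,y)\,dx\,dy=0\quad\text{for all }\eta\in\mathbb Z\setminus\{0\},$$ then (1) holds. -/

import Mathlib

open MeasureTheory FourierTransform
open scoped ENNReal InnerProductSpace

noncomputable section

namespace Cylinder

instance instFactTwoPiPos : Fact (0 < 2 * Real.pi) := ⟨Real.two_pi_pos⟩

/-- The cylinder `ℝ × 𝕋`, with `𝕋 = ℝ / 2πℤ` carrying the measure `dy` of total mass `2π`. -/
abbrev Cyl : Type := ℝ × AddCircle (2 * Real.pi)

/-- `L²(ℝ × 𝕋)`, complex valued. -/
abbrev L2Cyl : Type := Lp ℂ 2 (volume : Measure Cyl)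

/-- `L²(ℝ)`, complex valued. -/
abbrev L2R : Type := Lp ℂ 2 (volume : Measure ℝ)

/-- The function `(x, y) ↦ (2π)^{-1/2} e^{i n y} g(x)`. -/
def modeFun (n : ℤ) (g : ℝ → ℂ) (p : Cyl) : ℂ :=
  ((Real.sqrt (2 * Real.pi))⁻¹ : ℝ) * fourier n p.2 * g p.1

lemma norm_fourier_apply (n : ℤ) (y : AddCircle (2 * Real.pi)) :
    ‖(fourier n y : ℂ)‖ = 1 := by
  rw [fourier_apply]; exact Circle.norm_coe _

lemma enorm_modeFun (n : ℤ) (g : ℝ → ℂ) (p : Cyl) :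
    ‖modeFun n g p‖ₑ = ENNReal.ofReal (Real.sqrt (2 * Real.pi))⁻¹ * ‖g p.1‖ₑ := by
  have h1 : ‖(fourier n p.2 : ℂ)‖ₑ = 1 := by
    rw [← ofReal_norm, norm_fourier_apply, ENNReal.ofReal_one]
  have h2 : ‖(((Real.sqrt (2 * Real.pi))⁻¹ : ℝ) : ℂ)‖ₑ
      = ENNReal.ofReal (Real.sqrt (2 * Real.pi))⁻¹ := by
    rw [← ofReal_norm, Complex.norm_real, Real.norm_of_nonneg (by positivity)]
  rw [modeFun, enorm_mul, enorm_mul, h1, h2, mul_one]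

lemma aestronglyMeasurable_modeFun (n : ℤ) {g : ℝ → ℂ} (hg : AEStronglyMeasurable g volume) :
    AEStronglyMeasurable (modeFun n g) (volume : Measure Cyl) := by
  have h : AEStronglyMeasurable (fun p : Cyl => g p.1) (volume : Measure Cyl) := hg.comp_fst
  have h' : AEStronglyMeasurable (fun p : Cyl => (fourier n p.2 : ℂ)) (volume : Measure Cyl) :=
    ((fourier n).continuous.comp continuous_snd).aestronglyMeasurable
  exact (aestronglyMeasurable_const.mul h').mul h

lemma eLpNorm_modeFun (n : ℤ) {g : ℝ → ℂ} (hg : AEStronglyMeasurable g volume) :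
    eLpNorm (modeFun n g) 2 (volume : Measure Cyl) = eLpNorm g 2 volume := by
  rw [eLpNorm_eq_lintegral_rpow_enorm_toReal (by simp) (by simp),
    eLpNorm_eq_lintegral_rpow_enorm_toReal (by simp) (by simp)]
  congr 1
  simp only [enorm_modeFun, ENNReal.toReal_ofNat, ENNReal.rpow_ofNat, mul_pow]
  rw [Measure.volume_eq_prod, lintegral_const_mul'', lintegral_prod]
  · simp only [lintegral_const, AddCircle.measure_univ]
    rw [lintegral_mul_const'' _ (hg.enorm.pow_const 2), mul_comm (∫⁻ _, _), ← mul_assoc,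
      ← ENNReal.ofReal_pow (by positivity), ← ENNReal.ofReal_mul (by positivity), inv_pow,
      Real.sq_sqrt (by positivity), inv_mul_cancel₀ (by positivity), ENNReal.ofReal_one, one_mul]
  · exact (hg.comp_fst (ν := (volume : Measure (AddCircle (2 * Real.pi))))).enorm.pow_const 2
  · exact (hg.comp_fst (ν := (volume : Measure (AddCircle (2 * Real.pi))))).enorm.pow_const 2

lemma memLp_modeFun (n : ℤ) {g : ℝ → ℂ} (hg : MemLp g 2 volume) :
    MemLp (modeFun n g) 2 (volume : Measure Cyl) :=
  ⟨aestronglyMeasurable_modeFun n hg.1, by rw [eLpNorm_modeFun n hg.1]; exact hg.2⟩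

lemma modeFun_congr (n : ℤ) {g h : ℝ → ℂ} (e : g =ᵐ[volume] h) :
    modeFun n g =ᵐ[(volume : Measure Cyl)] modeFun n h := by
  have h1 : ∀ᵐ p : Cyl, g p.1 = h p.1 := Measure.quasiMeasurePreserving_fst.ae e
  filter_upwards [h1] with p hp
  simp [modeFun, hp]

/-- The isometry `g ↦ (2π)^{-1/2} e^{i n y} g(x)` from `L²(ℝ)` into `L²(ℝ × 𝕋)`. -/
def mode (n : ℤ) : L2R →ₗᵢ[ℂ] L2Cyl where
  toFun g := (memLp_modeFun n (Lp.memLp g)).toLp _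
  map_add' g h := by
    rw [← MemLp.toLp_add]
    apply MemLp.toLp_congr
    refine (modeFun_congr n (Lp.coeFn_add g h)).trans (Filter.Eventually.of_forall fun p => ?_)
    simp [modeFun, mul_add]
  map_smul' c g := by
    rw [RingHom.id_apply, ← MemLp.toLp_const_smul]
    apply MemLp.toLp_congr
    refine (modeFun_congr n (Lp.coeFn_smul c g)).trans (Filter.Eventually.of_forall fun p => ?_)
    simp only [modeFun, Pi.smul_apply, smul_eq_mul]; ring
  norm_map' g := by
    simp only [LinearMap.coe_mk, AddHom.coe_mk]
    rw [Lp.norm_toLp, eLpNorm_modeFun n (Lp.aestronglyMeasurable g), Lp.norm_def]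

lemma coeFn_mode (n : ℤ) (g : L2R) : mode n g =ᵐ[volume] modeFun n g :=
  MemLp.coeFn_toLp (memLp_modeFun n (Lp.memLp g))

/-- The isometry `g ↦ (2π)^{-1/2} e^{i n y} (𝓕⁻¹ g)(x)` from `L²(ℝ)` into `L²(ℝ × 𝕋)`, where
`𝓕` is the unitary Fourier transform `𝓕 h(v) = ∫ e^{-2πi v x} h(x) dx` of `L²(ℝ)`. -/
def synthesis (n : ℤ) : L2R →ₗᵢ[ℂ] L2Cyl :=
  (mode n).comp (Lp.fourierTransformₗᵢ ℝ ℂ).symm.toLinearIsometry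

lemma inner_mode (n : ℤ) (g : L2R) (f : L2Cyl) :
    ⟪mode n g, f⟫_ℂ = ∫ x, ∫ y, starRingEnd ℂ (modeFun n g (x, y)) * f (x, y) := by
  have h : ⟪mode n g, f⟫_ℂ = ∫ p : Cyl, starRingEnd ℂ (modeFun n g p) * f p := by
    rw [L2.inner_def]
    apply integral_congr_ae
    filter_upwards [coeFn_mode n g] with p hp
    rw [hp, RCLike.inner_apply, mul_comm]
  rw [h]
  refine integral_prod (μ := (volume : Measure ℝ))
    (ν := (volume : Measure (AddCircle (2 * Real.pi)))) _ ?_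
  have := L2.integrable_inner (𝕜 := ℂ) (mode n g) f
  refine this.congr ?_
  filter_upwards [coeFn_mode n g] with p hp
  rw [hp, RCLike.inner_apply, mul_comm]

lemma integral_fourier_mul (m n : ℤ) (h : m ≠ n) :
    ∫ y : AddCircle (2 * Real.pi), starRingEnd ℂ (fourier m y) * fourier n y = 0 := by
  have h1 : ∀ y : AddCircle (2 * Real.pi),
      starRingEnd ℂ (fourier m y) * fourier n y = fourier (-m) y • (fourier n y : ℂ) := by
    intro y; rw [fourier_neg, smul_eq_mul]
  simp_rw [h1]
  rw [AddCircle.volume_eq_smul_haarAddCircle, integral_smul_measure]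
  have := fourierCoeff_fourier (T := 2 * Real.pi) n
  have h2 := congrFun this m
  rw [fourierCoeff, Pi.single_eq_of_ne h] at h2
  rw [h2, smul_zero]

lemma orthogonalFamily_mode : OrthogonalFamily ℂ (fun _ : ℤ => L2R) mode := by
  intro m n hmn g h
  have e : ∀ᵐ p : Cyl, mode n h p = modeFun n h p := coeFn_mode n h
  rw [inner_mode]
  have e' : ∀ᵐ x : ℝ, ∀ᵐ y : AddCircle (2 * Real.pi), mode n h (x, y) = modeFun n h (x, y) :=
    Measure.ae_ae_of_ae_prod e
  apply integral_eq_zero_of_ae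
  filter_upwards [e'] with x hx
  have h3 : ∫ y : AddCircle (2 * Real.pi), starRingEnd ℂ (modeFun m g (x, y)) * mode n h (x, y)
      = ∫ y : AddCircle (2 * Real.pi), (((Real.sqrt (2 * Real.pi))⁻¹ : ℝ) * ((Real.sqrt (2 * Real.pi))⁻¹ : ℝ) *
        starRingEnd ℂ (g x) * h x) *
        (starRingEnd ℂ (fourier m y) * fourier n y) := by
    apply integral_congr_ae
    filter_upwards [hx] with y hy
    rw [hy]
    simp only [modeFun, map_mul, Complex.conj_ofReal]
    ring
  rw [h3, integral_const_mul, integral_fourier_mul m n hmn, mul_zero, Pi.zero_apply]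

/-- A square integrable function on the circle with vanishing Fourier coefficients is null. -/
lemma circle_eq_zero {u : AddCircle (2 * Real.pi) → ℂ} (hu : MemLp u 2 volume)
    (h : ∀ n : ℤ, ∫ y, starRingEnd ℂ (fourier n y) * u y = 0) : u =ᵐ[volume] 0 := by
  have hu' : MemLp u 2 AddCircle.haarAddCircle := memLp_haarAddCircle_iff.2 hu
  have hz : fourierBasis.repr (hu'.toLp u) = 0 := by
    ext n
    rw [fourierBasis_repr, fourierCoeff_congr_ae (MemLp.coeFn_toLp hu'), fourierCoeff]
    have h1 := h n
    rw [AddCircle.volume_eq_smul_haarAddCircle, integral_smul_measure] at h1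
    have h2 := (smul_eq_zero.1 h1).resolve_left
      (by rw [ENNReal.toReal_ofReal Real.two_pi_pos.le]; exact Real.two_pi_pos.ne')
    simpa [fourier_neg] using h2
  have hz' : hu'.toLp u = 0 := by simpa using hz
  have h3 : u =ᵐ[AddCircle.haarAddCircle] 0 := by
    have := MemLp.coeFn_toLp hu'
    rw [hz'] at this
    exact this.symm.trans (Lp.coeFn_zero _ _ _)
  rw [AddCircle.volume_eq_smul_haarAddCircle]
  exact Measure.ae_smul_measure h3 _

lemma eq_zero_of_inner_mode (f : L2Cyl) (h : ∀ n g, ⟪mode n g, f⟫_ℂ = 0) : f = 0 := by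
  have hf : MemLp f 2 ((volume : Measure ℝ).prod
    (volume : Measure (AddCircle (2 * Real.pi)))) := Lp.memLp f
  -- almost every slice is square integrable
  have hs : ∀ᵐ x : ℝ, MemLp (fun y => f (x, y)) 2 volume := by
    have h1 : ∀ᵐ x : ℝ, AEStronglyMeasurable (fun y => f (x, y)) volume := hf.1.prodMk_left
    have h2 : ∫⁻ p : Cyl, ‖f p‖ₑ ^ 2 ∂((volume : Measure ℝ).prod volume) < ∞ := by
      have := lintegral_rpow_enorm_lt_top_of_eLpNorm_lt_top (by simp) (by simp) hf.2
      simpa using this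
    rw [lintegral_prod _ (hf.1.enorm.pow_const 2)] at h2
    have h3 := ae_lt_top' (hf.1.enorm.pow_const 2).lintegral_prod_right' h2.ne
    filter_upwards [h1, h3] with x hx1 hx3
    refine ⟨hx1, ?_⟩
    rw [eLpNorm_lt_top_iff_lintegral_rpow_enorm_lt_top (by simp) (by simp)]
    simpa using hx3
  -- the Fourier coefficients of almost every slice vanish
  have hc : ∀ n : ℤ, ∀ᵐ x : ℝ, ∫ y, starRingEnd ℂ (fourier n y) * f (x, y) = 0 := by
    intro n
    have hint : ∀ s : Set ℝ, MeasurableSet s → volume s < ∞ →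
        Integrable (fun p : Cyl => starRingEnd ℂ (fourier n p.2) * f p)
          ((volume.restrict s).prod volume) := by
      intro s hs hsf
      have : IsFiniteMeasure (volume.restrict s) := ⟨by simpa using hsf⟩
      have hle : (volume.restrict s).prod (volume : Measure (AddCircle (2 * Real.pi)))
          ≤ (volume : Measure ℝ).prod volume := by
        rw [show (volume.restrict s).prod (volume : Measure (AddCircle (2 * Real.pi)))
          = ((volume : Measure ℝ).prod volume).restrict (s ×ˢ Set.univ) by
            rw [← Measure.prod_restrict, Measure.restrict_univ]]
        exact Measure.restrict_le_self
      have hfi := (hf.mono_measure hle).integrable (by norm_num)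
      refine hfi.bdd_mul (c := 1) ?_ ?_
      · exact (Complex.continuous_conj.comp
          ((fourier n).continuous.comp continuous_snd)).aestronglyMeasurable
      · exact Filter.Eventually.of_forall fun p => by
          rw [RCLike.norm_conj, norm_fourier_apply]
    refine ae_eq_zero_of_forall_setIntegral_eq_of_sigmaFinite ?_ ?_
    · intro s hs hsf
      exact (hint s hs hsf).integral_prod_left
    · intro s hs hsf
      have h1 := h n (indicatorConstLp 2 hs hsf.ne (1 : ℂ))
      rw [inner_mode] at h1
      have h2 : ∫ x, ∫ y, starRingEnd ℂ
          (modeFun n (indicatorConstLp 2 hs hsf.ne (1 : ℂ)) (x, y)) * f (x, y)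
          = (((Real.sqrt (2 * Real.pi))⁻¹ : ℝ) : ℂ) *
            ∫ x in s, ∫ y, starRingEnd ℂ (fourier n y) * f (x, y) := by
        rw [← integral_const_mul, ← integral_indicator hs]
        apply integral_congr_ae
        filter_upwards [indicatorConstLp_coeFn (p := 2) (hs := hs) (hμs := hsf.ne) (c := (1 : ℂ))]
          with x hx
        simp only [modeFun, hx]
        by_cases hxs : x ∈ s
        · simp only [hxs, Set.indicator_of_mem, mul_one, map_mul, Complex.conj_ofReal]
          rw [← integral_const_mul]
          congr 1; ext y; ring
        · simp [hxs]
      rw [h2] at h1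
      refine (mul_eq_zero.1 h1).resolve_left ?_
      have : 0 < (Real.sqrt (2 * Real.pi))⁻¹ := by positivity
      exact_mod_cast this.ne'
  have hz : ∀ᵐ x : ℝ, ∀ᵐ y : AddCircle (2 * Real.pi), f (x, y) = 0 := by
    filter_upwards [hs, ae_all_iff.2 hc] with x h1 h2
    exact circle_eq_zero h1 h2
  have hzero : eLpNorm f 2 ((volume : Measure ℝ).prod
      (volume : Measure (AddCircle (2 * Real.pi)))) = 0 := by
    rw [eLpNorm_eq_lintegral_rpow_enorm_toReal (by simp) (by simp)]
    simp only [ENNReal.toReal_ofNat, ENNReal.rpow_ofNat]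
    rw [lintegral_prod _ (hf.1.enorm.pow_const 2)]
    have : ∫⁻ x : ℝ, ∫⁻ y : AddCircle (2 * Real.pi), ‖f (x, y)‖ₑ ^ 2 = 0 := by
      rw [← lintegral_zero (μ := (volume : Measure ℝ))]
      apply lintegral_congr_ae
      filter_upwards [hz] with x hx
      rw [← lintegral_zero (μ := (volume : Measure (AddCircle (2 * Real.pi))))]
      apply lintegral_congr_ae
      filter_upwards [hx] with y hy
      simp [hy]
    rw [this]; simp
  exact (Lp.eq_zero_iff_ae_eq_zero).2 ((eLpNorm_eq_zero_iff hf.1 (by simp)).1 hzero)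

lemma isHilbertSum_synthesis : IsHilbertSum ℂ (fun _ : ℤ => L2R) synthesis := by
  refine IsHilbertSum.mk (fun m n hmn g h => ?_) ?_
  · exact orthogonalFamily_mode hmn ((Lp.fourierTransformₗᵢ ℝ ℂ).symm g)
      ((Lp.fourierTransformₗᵢ ℝ ℂ).symm h)
  rw [top_le_iff, Submodule.topologicalClosure_eq_top_iff, Submodule.eq_bot_iff]
  intro f hf
  refine eq_zero_of_inner_mode f fun n g => ?_
  refine (Submodule.mem_orthogonal _ _).1 hf _ (Submodule.mem_iSup_of_mem n ?_)
  exact ⟨𝓕 g, by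
    change mode n ((Lp.fourierTransformₗᵢ ℝ ℂ).symm ((Lp.fourierTransformₗᵢ ℝ ℂ) g)) = _
    rw [LinearIsometryEquiv.symm_apply_apply]⟩

/-- The unitary Fourier transform `L²(ℝ × 𝕋) ≃ ℓ²(ℤ; L²(ℝ))`: it is the inverse of
`(g_n)_n ↦ ∑_n (2π)^{-1/2} e^{i n y} (𝓕⁻¹ g_n)(x)`. In terms of
`f̂(ξ, η) = ∫_𝕋 ∫_ℝ f(x, y) e^{-i x ξ - i y η} dx dy`, it is
`(fourierCyl f η)(v) = (2π)^{-1/2} f̂(2π v, η)`. -/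
def fourierCyl : L2Cyl ≃ₗᵢ[ℂ] lp (fun _ : ℤ => L2R) 2 :=
  isHilbertSum_synthesis.linearIsometryEquiv

/-- A bounded Fourier multiplier symbol on `ℝ × ℤ`, as a function of the angular
frequency `ξ ∈ ℝ` and of `η ∈ ℤ`. -/
structure IsSymbol (m : ℝ → ℤ → ℂ) : Prop where
  measurable : ∀ η, Measurable fun ξ => m ξ η
  norm_le_one : ∀ ξ η, ‖m ξ η‖ ≤ 1

lemma IsSymbol.norm_mul_le {m : ℝ → ℤ → ℂ} (hm : IsSymbol m) (g : L2R) (n : ℤ) (v : ℝ) :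
    ‖m (2 * Real.pi * v) n * g v‖ ≤ ‖g v‖ := by
  rw [norm_mul]
  exact mul_le_of_le_one_left (norm_nonneg _) (hm.norm_le_one _ _)

lemma IsSymbol.memLp {m : ℝ → ℤ → ℂ} (hm : IsSymbol m) (g : L2R) (n : ℤ) :
    MemLp (fun v => m (2 * Real.pi * v) n * g v) 2 volume := by
  refine (Lp.memLp g).mono ?_ (Filter.Eventually.of_forall (hm.norm_mul_le g n))
  have : Measurable fun v : ℝ => m (2 * Real.pi * v) n :=
    (hm.measurable n).comp (measurable_const_mul _)
  exact this.aestronglyMeasurable.mul (Lp.aestronglyMeasurable g)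

lemma IsSymbol.memℓp {m : ℝ → ℤ → ℂ} (hm : IsSymbol m) (F : lp (fun _ : ℤ => L2R) 2) :
    Memℓp (fun n : ℤ => (hm.memLp (F n) n).toLp) 2 := by
  refine memℓp_gen ?_
  refine Summable.of_nonneg_of_le (fun n => by positivity) (fun n => ?_)
    ((lp.memℓp F).summable (by norm_num))
  refine Real.rpow_le_rpow (norm_nonneg _) ?_ (by norm_num)
  refine Lp.norm_le_norm_of_ae_le ?_
  filter_upwards [MemLp.coeFn_toLp (hm.memLp (F n) n)] with v hv
  rw [hv]
  exact hm.norm_mul_le _ _ _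

/-- The Fourier multiplier operator on `L²(ℝ × 𝕋)` with symbol `m`:
the Fourier transform of its value at `f` is `m(ξ, η) f̂(ξ, η)`. -/
def multiplier {m : ℝ → ℤ → ℂ} (hm : IsSymbol m) (f : L2Cyl) : L2Cyl :=
  fourierCyl.symm ⟨fun n : ℤ => (hm.memLp (fourierCyl f n) n).toLp, hm.memℓp (fourierCyl f)⟩

/-- The dispersion relation `ω(ξ, η) = sign(ξ) ξ² + sign(ξ) η²`. -/
def dispersion (ξ : ℝ) (η : ℤ) : ℝ := Real.sign ξ * ξ ^ 2 + Real.sign ξ * (η : ℝ) ^ 2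

lemma measurable_sign : Measurable Real.sign := by
  unfold Real.sign
  exact Measurable.ite measurableSet_Iio measurable_const
    (Measurable.ite measurableSet_Ioi measurable_const measurable_const)

lemma isSymbol_group (t : ℝ) :
    IsSymbol fun ξ η => Complex.exp (((t * dispersion ξ η : ℝ) : ℂ) * Complex.I) where
  measurable η := by
    have : Measurable fun ξ : ℝ => t * dispersion ξ η := by
      unfold dispersion
      exact ((measurable_sign.mul (measurable_id.pow_const 2)).add
        (measurable_sign.mul measurable_const)).const_mul t
    exact Complex.measurable_exp.comp
      ((Complex.measurable_ofReal.comp this).mul measurable_const)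
  norm_le_one ξ η := (Complex.norm_exp_ofReal_mul_I _).le

lemma isSymbol_hilbert : IsSymbol fun ξ _ => -Complex.I * ((Real.sign ξ : ℝ) : ℂ) where
  measurable _ := (Complex.measurable_ofReal.comp measurable_sign).const_mul _
  norm_le_one ξ _ := by
    rcases Real.sign_apply_eq ξ with h | h | h <;> simp [h]

/-- The unitary group of `∂ₜ v - H_x ∂ₓ² v - H_x ∂ᵧ² v = 0`: the Fourier multiplier operator with
symbol `e^{i t ω(ξ, η)}`. -/
def U (t : ℝ) (f : L2Cyl) : L2Cyl := multiplier (isSymbol_group t) f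

/-- The Hilbert transform in `x`: the Fourier multiplier operator with symbol `-i sign(ξ)`. -/
def hilbertX (f : L2Cyl) : L2Cyl := multiplier isSymbol_hilbert f

/-- The Japanese bracket `⟨a⟩ = (1 + a²)^{1/2}`. -/
def bracket (a : ℝ) : ℝ := Real.sqrt (1 + a ^ 2)

/-- `‖⟨x⟩^θ f‖_{L²(ℝ × 𝕋)}`, possibly infinite. -/
def weightedNorm (θ : ℝ) (f : L2Cyl) : ℝ≥0∞ :=
  eLpNorm (fun p : Cyl => ((bracket p.1 ^ θ : ℝ) : ℂ) * f p) 2 volume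

/-- `f ∈ L²(|x|^{2θ} dx dy)`. -/
def InWeightedL2 (θ : ℝ) (f : L2Cyl) : Prop :=
  ∫⁻ p : Cyl, ENNReal.ofReal (|p.1| ^ (2 * θ)) * ‖f p‖ₑ ^ 2 < ∞

/-- `‖f‖_{H^{s₁,s₂}} = ‖J_x^{s₁} f‖_{L²} + ‖J_y^{s₂} f‖_{L²}` for `s₁, s₂ ≥ 0`, possibly infinite,
where `J_x^s` and `J_y^s` have the symbols `⟨ξ⟩^s` and `⟨η⟩^s`; the `L²` norms are computed on the
Fourier side by the Plancherel identity. -/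
def sobolevNorm (s₁ s₂ : ℝ) (f : L2Cyl) : ℝ≥0∞ :=
  (∑' η : ℤ, ∫⁻ v : ℝ,
    (ENNReal.ofReal (bracket (2 * Real.pi * v) ^ s₁) * ‖fourierCyl f η v‖ₑ) ^ 2) ^ (1 / 2 : ℝ) +
  (∑' η : ℤ, ∫⁻ v : ℝ,
    (ENNReal.ofReal (bracket (η : ℝ) ^ s₂) * ‖fourierCyl f η v‖ₑ) ^ 2) ^ (1 / 2 : ℝ)

/-- `f ∈ H^{s₁,s₂}(ℝ × 𝕋)`, for `s₁, s₂ ≥ 0`. -/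
def InSobolev (s₁ s₂ : ℝ) (f : L2Cyl) : Prop := sobolevNorm s₁ s₂ f < ∞

/-- `∫_𝕋 ∫_ℝ e^{-i η y} x^l f(x, y) dx dy`. -/
def moment (l : ℕ) (η : ℤ) (f : L2Cyl) : ℂ :=
  ∫ p : Cyl, fourier (-η) p.2 * (p.1 : ℂ) ^ l * f p

end Cylinder

end

open Cylinder

noncomputable section

namespace Cylinder

open Filter Topology
open scoped SchwartzMap NNReal

/-! ### The Fourier transform of `L²(ℝ)` -/

/-! A Fourier series in y reduces everything to one dimension. With ξ = 2πv, the propagator acts on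
the η-th mode by the symbol e^{i sign(v)(a v² + b)}, where a = 4π²t and b = tη² (`ymode_U`), and by
Parseval the squared weighted norm is the sum of those of the modes (`weightedNorm_sq`). What is
needed are bounds on the line with constants independent of η. Since b contributes only a unimodular
constant on each frequency half-line, the multiplier is a combination of the Schrödinger groups
e^{±iav²} applied to h ± Sh, with S the sign multiplier (`FM_psym_eq`). This leaves two questions.

The Schrödinger group on weighted L² (`exists_wsq_chirp_le`): take a windowed transform whose
Gaussian window carries the same chirp as the group. The group then acts on the modulus exactly as a
shear of the (x, ξ) plane (`norm_stft_chirp`), and the sheared weight is at most a constant times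
⟨a⟩^{2θ}(⟨x⟩^{2θ} + ⟨ξ⟩^{2θ}). Passing between the windowed transform and the function costs
constants independent of a, for every θ ≥ 0.

The sign multiplier on weighted L² (`exists_wsq_sign_le`): for 0 < α < 1 the weight |x|^{2α} is an
average over s of |e^{2πisx} - 1|², a difference operator on the Fourier side. Its commutator with S
only sees frequencies |v| ≤ |s|, and the resulting error is a Hardy integral of the Fourier
transform at the origin. It is controlled when α < 1/2, or when 1/2 < α < 3/2 and the mean vanishes.
Higher weights follow because x^n commutes with S on functions whose moments below n vanish
(`pow_mul_sign_multiplier`). At a critical exponent k + 1/2 Hardy's inequality is unavailable, and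
the weighted norm of S(x^k h) stays in the estimate.

For η = 0 one has b = 0, and S only acts on the part with symbol 2i sin(av²), which vanishes to
second order at the origin. That part has two more vanishing moments than h, so two conditions fewer
are imposed (`exists_wsq_psym_zero_le`). At a critical exponent the one missing moment is removed by
subtracting a multiple of a fixed Schwartz function, whose own evolution is estimated by
interpolating between two noncritical exponents (`exists_wsq_psym_zero_le_critical`). -/

lemma integral_coe_fourier_mul (h : L2R) (ψ : 𝓢(ℝ, ℂ)) :
    ∫ v, ψ v * (𝓕 h : L2R) v = ∫ x, (𝓕 ψ) x * h x := by
  have := congrArg (fun T : 𝓢'(ℝ, ℂ) => T ψ) (Lp.fourier_toTemperedDistribution_eq h)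
  simp only [TemperedDistribution.fourier_apply, Lp.toTemperedDistribution_apply,
    smul_eq_mul] at this
  exact this.symm

lemma locallyIntegrable_coe (h : L2R) : LocallyIntegrable (h : ℝ → ℂ) volume :=
  (Lp.memLp h).locallyIntegrable (by norm_num)

/-- The `L²` Fourier transform of `h` is characterised by testing on Schwartz functions. -/
lemma coe_fourier_ae_eq_of_forall (h : L2R) {u : ℝ → ℂ} (hu : LocallyIntegrable u volume)
    (H : ∀ ψ : 𝓢(ℝ, ℂ), ∫ v, ψ v * u v = ∫ x, (𝓕 ψ) x * h x) :
    (𝓕 h : L2R) =ᵐ[volume] u := by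
  refine ae_eq_of_integral_contDiff_smul_eq (locallyIntegrable_coe _) hu fun g hg hs => ?_
  have h2 : HasCompactSupport (fun x => (g x : ℂ)) := hs.comp_left (g := Complex.ofReal) rfl
  have hs' : ContDiff ℝ ((⊤ : ℕ∞) : WithTop ℕ∞) (fun x => (g x : ℂ)) :=
    Complex.ofRealCLM.contDiff.comp hg
  let ψ : 𝓢(ℝ, ℂ) := h2.toSchwartzMap hs'
  have e : ∀ x, ψ x = (g x : ℂ) := fun x => rfl
  have h1 := (integral_coe_fourier_mul h ψ).trans (H ψ).symm
  simpa [e] using h1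

lemma integral_fourier_mul_eq_flip {f g : ℝ → ℂ} (hf : Integrable f) (hg : Integrable g) :
    ∫ v, 𝓕 f v * g v = ∫ x, f x * 𝓕 g x := by
  simpa using! (VectorFourier.integral_fourierIntegral_smul_eq_flip (L := innerₗ ℝ)
      Real.continuous_fourierChar continuous_inner hf hg)

lemma continuous_fourier_of_integrable {f : ℝ → ℂ} (hf : Integrable f) : Continuous (𝓕 f) :=
  VectorFourier.fourierIntegral_continuous Real.continuous_fourierChar continuous_inner hf

lemma coe_fourier_ae_eq_integral (h : L2R) (hi : Integrable (h : ℝ → ℂ)) :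
    (𝓕 h : L2R) =ᵐ[volume] 𝓕 (h : ℝ → ℂ) := by
  refine coe_fourier_ae_eq_of_forall h (continuous_fourier_of_integrable hi).locallyIntegrable
    fun ψ => ?_
  rw [SchwartzMap.fourier_coe, integral_fourier_mul_eq_flip ψ.integrable hi]

lemma fourier_toLp_ae_eq {u : ℝ → ℂ} (hi : Integrable u) (hu : MemLp u 2 volume) :
    (𝓕 (hu.toLp u) : L2R) =ᵐ[volume] 𝓕 u := by
  have e := hu.coeFn_toLp
  have := coe_fourier_ae_eq_integral (hu.toLp u) (hi.congr e.symm)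
  refine this.trans (Eventually.of_forall fun v => ?_)
  rw [Real.fourier_real_eq, Real.fourier_real_eq]
  exact integral_congr_ae (by filter_upwards [e] with x hx; rw [hx])

lemma enorm_sq_eq_lintegral (h : L2R) : ‖h‖ₑ ^ 2 = ∫⁻ x, ‖h x‖ₑ ^ 2 := by
  rw [Lp.enorm_def, eLpNorm_eq_lintegral_rpow_enorm_toReal (by simp) (by simp)]
  simp only [ENNReal.toReal_ofNat, ENNReal.rpow_ofNat]
  rw [← ENNReal.rpow_ofNat, ← ENNReal.rpow_mul]
  norm_num

lemma lintegral_coe_fourier_sq (h : L2R) :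
    ∫⁻ v, ‖(𝓕 h : L2R) v‖ₑ ^ 2 = ∫⁻ x, ‖h x‖ₑ ^ 2 := by
  rw [← enorm_sq_eq_lintegral, ← enorm_sq_eq_lintegral, ← ofReal_norm, ← ofReal_norm,
    Lp.norm_fourier_eq]

lemma lintegral_fourier_sq {u : ℝ → ℂ} (hi : Integrable u) (hu : MemLp u 2 volume) :
    ∫⁻ v, ‖𝓕 u v‖ₑ ^ 2 = ∫⁻ x, ‖u x‖ₑ ^ 2 := by
  have h1 := lintegral_coe_fourier_sq (hu.toLp u)
  have e1 : ∫⁻ v, ‖(𝓕 (hu.toLp u) : L2R) v‖ₑ ^ 2 = ∫⁻ v, ‖𝓕 u v‖ₑ ^ 2 :=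
    lintegral_congr_ae (by filter_upwards [fourier_toLp_ae_eq hi hu] with x hx; rw [hx])
  have e2 : ∫⁻ v, ‖hu.toLp u v‖ₑ ^ 2 = ∫⁻ v, ‖u v‖ₑ ^ 2 :=
    lintegral_congr_ae (by filter_upwards [hu.coeFn_toLp] with x hx; rw [hx])
  rw [← e1, h1, e2]

lemma lintegral_fourierInv_sq {u : ℝ → ℂ} (hi : Integrable u) (hu : MemLp u 2 volume) :
    ∫⁻ v, ‖𝓕⁻ u v‖ₑ ^ 2 = ∫⁻ x, ‖u x‖ₑ ^ 2 := by
  simp_rw [Real.fourierInv_eq_fourier_neg]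
  rw [← lintegral_fourier_sq hi hu]
  exact lintegral_neg_eq_self (fun v => ‖𝓕 u v‖ₑ ^ 2)

/-! ### Multiplication operators and Fourier multipliers on `L²(ℝ)` -/

open Classical in
/-- The product `m h`, as an element of `L²(ℝ)` (zero if it is not square integrable). -/
def mulL (m : ℝ → ℂ) (h : L2R) : L2R :=
  if H : MemLp (fun x => m x * h x) 2 volume then H.toLp _ else 0

lemma coeFn_mulL {m : ℝ → ℂ} {h : L2R} (H : MemLp (fun x => m x * h x) 2 volume) :
    mulL m h =ᵐ[volume] fun x => m x * h x := by
  rw [mulL, dif_pos H]; exact H.coeFn_toLp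

/-- A bounded measurable function on `ℝ`. -/
structure BddMeas (m : ℝ → ℂ) : Prop where
  meas : Measurable m
  bdd : ∃ C, ∀ x, ‖m x‖ ≤ C

lemma BddMeas.memLp {m : ℝ → ℂ} (hm : BddMeas m) (h : L2R) :
    MemLp (fun x => m x * h x) 2 volume := by
  obtain ⟨C, hC⟩ := hm.bdd
  refine MemLp.of_le_mul (c := C) (Lp.memLp h)
    (hm.meas.aestronglyMeasurable.mul (Lp.aestronglyMeasurable h)) (Eventually.of_forall fun x => ?_)
  rw [norm_mul]
  exact mul_le_mul_of_nonneg_right (hC x) (norm_nonneg _)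

lemma BddMeas.coeFn {m : ℝ → ℂ} (hm : BddMeas m) (h : L2R) :
    mulL m h =ᵐ[volume] fun x => m x * h x := coeFn_mulL (hm.memLp h)

/-- The Fourier multiplier operator with symbol `m`. -/
def FM (m : ℝ → ℂ) (h : L2R) : L2R := 𝓕⁻ (mulL m (𝓕 h))

lemma fourier_FM (m : ℝ → ℂ) (h : L2R) : 𝓕 (FM m h) = mulL m (𝓕 h) :=
  fourier_fourierInv_eq _

lemma BddMeas.coeFn_fourier_FM {m : ℝ → ℂ} (hm : BddMeas m) (h : L2R) :
    (𝓕 (FM m h) : L2R) =ᵐ[volume] fun v => m v * (𝓕 h : L2R) v := by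
  rw [fourier_FM]; exact hm.coeFn _

lemma eq_of_fourier_ae_eq {h k : L2R} (e : (𝓕 h : L2R) =ᵐ[volume] (𝓕 k : L2R)) : h = k :=
  (Lp.fourierTransformₗᵢ ℝ ℂ).injective (Lp.ext e)

/-- Modulation becomes translation. -/
lemma fourier_mulL_char (s : ℝ) (h : L2R) :
    (𝓕 (mulL (fun x => Complex.exp (2 * Real.pi * s * x * Complex.I)) h) : L2R)
      =ᵐ[volume] fun v => (𝓕 h : L2R) (v - s) := by
  have hb : BddMeas (fun x : ℝ => Complex.exp (2 * Real.pi * s * x * Complex.I)) := by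
    refine ⟨by fun_prop, 1, fun x => ?_⟩
    have : (2 * Real.pi * s * x * Complex.I : ℂ) = ((2 * Real.pi * s * x : ℝ) : ℂ) * Complex.I := by
      push_cast; ring
    rw [this, Complex.norm_exp_ofReal_mul_I]
  have hmp : MemLp (fun v => (𝓕 h : L2R) (v - s)) 2 volume :=
    (Lp.memLp (𝓕 h : L2R)).comp_measurePreserving (measurePreserving_sub_right volume s)
  refine coe_fourier_ae_eq_of_forall _ (hmp.locallyIntegrable (by norm_num)) fun ψ => ?_
  let ψ' : 𝓢(ℝ, ℂ) := ψ.compSubConstCLM ℂ (-s)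
  have h1 := integral_coe_fourier_mul h ψ'
  have h2 : ∫ v, ψ v * (𝓕 h : L2R) (v - s) = ∫ v, ψ' v * (𝓕 h : L2R) v := by
    rw [← integral_add_right_eq_self _ s]
    simp [ψ', sub_neg_eq_add]
  rw [h2, h1]
  apply integral_congr_ae
  filter_upwards [hb.coeFn h] with x hx
  rw [hx, ← mul_assoc]
  congr 1
  rw [SchwartzMap.fourier_coe, SchwartzMap.fourier_coe, Real.fourier_real_eq_integral_exp_smul,
    Real.fourier_real_eq_integral_exp_smul, ← integral_add_right_eq_self _ (-s), ← integral_mul_const]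
  congr 1
  ext v
  simp only [smul_eq_mul]
  rw [show ψ' (v + -s) = ψ v by simp [ψ'], mul_right_comm (Complex.exp _) (ψ v),
    ← Complex.exp_add]
  congr 2
  push_cast; ring

/-! ### Weights -/

lemma bracket_rpow_two_mul (a θ : ℝ) : bracket a ^ (2 * θ) = (1 + a ^ 2) ^ θ := by
  rw [bracket, Real.sqrt_eq_rpow, ← Real.rpow_mul (by positivity)]
  congr 1; ring

lemma bracket_pos (a : ℝ) : 0 < bracket a := Real.sqrt_pos.2 (by positivity)

lemma one_le_bracket (a : ℝ) : 1 ≤ bracket a :=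
  Real.one_le_sqrt.2 (by nlinarith [sq_nonneg a])

lemma continuous_bracket : Continuous bracket := by unfold bracket; fun_prop

@[fun_prop]
lemma measurable_bracket : Measurable bracket := continuous_bracket.measurable

/-- The weight `⟨x⟩^{2θ}`. -/
def wt (θ x : ℝ) : ℝ≥0∞ := ENNReal.ofReal (bracket x ^ (2 * θ))

@[fun_prop]
lemma measurable_wt (θ : ℝ) : Measurable (wt θ) := by unfold wt; fun_prop

lemma wt_eq (θ x : ℝ) : wt θ x = ENNReal.ofReal ((1 + x ^ 2) ^ θ) := by
  rw [wt, bracket_rpow_two_mul]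

lemma wt_mono {θ : ℝ} (hθ : 0 ≤ θ) {x y : ℝ} (h : |x| ≤ |y|) : wt θ x ≤ wt θ y := by
  rw [wt_eq, wt_eq]
  have := sq_le_sq.2 h
  gcongr

/-- Peetre's inequality. -/
lemma wt_le_mul {θ : ℝ} (hθ : 0 ≤ θ) (x y : ℝ) :
    wt θ x ≤ ENNReal.ofReal (2 ^ θ) * wt θ y * wt θ (x - y) := by
  simp only [wt_eq]
  rw [← ENNReal.ofReal_mul (by positivity), ← ENNReal.ofReal_mul (by positivity),
    ← Real.mul_rpow (by positivity) (by positivity),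
    ← Real.mul_rpow (by positivity) (by positivity)]
  gcongr
  nlinarith [sq_nonneg (2 * y - x), sq_nonneg (y * (x - y)), sq_nonneg (x-y), sq_nonneg y]

/-- Controls the weight after the phase-space shear. If m is the larger of |x| and |ξ|, then 1 + (x
- bξ)² ≤ 4(1 + b²)(1 + m²). -/
lemma wt_sub_mul_le {θ : ℝ} (hθ : 0 ≤ θ) (x b ξ : ℝ) :
    wt θ (x - b * ξ) ≤ ENNReal.ofReal (4 ^ θ) * wt θ b * (wt θ x + wt θ ξ) := by
  have key : ∀ u v : ℝ, |u| ≤ |v| → (u = x ∧ v = ξ ∨ u = ξ ∧ v = x) →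
      wt θ (x - b * ξ) ≤ ENNReal.ofReal (4 ^ θ) * wt θ b * wt θ v := by
    intro u v huv h
    simp only [wt_eq]
    rw [← ENNReal.ofReal_mul (by positivity), ← ENNReal.ofReal_mul (by positivity),
      ← Real.mul_rpow (by positivity) (by positivity),
      ← Real.mul_rpow (by positivity) (by positivity)]
    gcongr
    have h2 := sq_le_sq.2 huv
    rcases h with ⟨rfl, rfl⟩ | ⟨rfl, rfl⟩ 
    · nlinarith [sq_nonneg (u + b * v), sq_nonneg (b * v), sq_nonneg b]
    · nlinarith [sq_nonneg (v + b * u), sq_nonneg (b * v), sq_nonneg b,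
        mul_le_mul_of_nonneg_left h2 (sq_nonneg b)]
  rcases le_total |x| |ξ| with h | h
  · refine (key x ξ h (Or.inl ⟨rfl, rfl⟩)).trans ?_
    gcongr
    exact le_add_self
  · refine (key ξ x h (Or.inr ⟨rfl, rfl⟩)).trans ?_
    gcongr
    exact le_self_add

/-- `∫ ⟨x⟩^{2θ} |h|²`. -/
def wsq (θ : ℝ) (h : ℝ → ℂ) : ℝ≥0∞ := ∫⁻ x, wt θ x * ‖h x‖ₑ ^ 2

lemma wsq_congr {θ : ℝ} {h k : ℝ → ℂ} (e : h =ᵐ[volume] k) : wsq θ h = wsq θ k :=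
  lintegral_congr_ae (by filter_upwards [e] with x hx; rw [hx])

/-! ### Gaussian windows -/

/-- The chirped Gaussian `e^{-(π + i a) ν²}`. -/
def win (a ν : ℝ) : ℂ := Complex.exp (-(Real.pi + a * Complex.I) * ν ^ 2)

lemma continuous_win (a : ℝ) : Continuous (win a) := by unfold win; fun_prop

lemma norm_win (a ν : ℝ) : ‖win a ν‖ = Real.exp (-Real.pi * ν ^ 2) := by
  rw [win, Complex.norm_exp]
  congr 1
  simp [← Complex.ofReal_pow]

lemma win_neg (a ν : ℝ) : win a (-ν) = win a ν := by simp [win]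

lemma integrable_win (a : ℝ) : Integrable (win a) := by
  have := integrable_cexp_neg_mul_sq (b := Real.pi + a * Complex.I) (by simp [Real.pi_pos])
  exact this

lemma norm_win_le_one (a ν : ℝ) : ‖win a ν‖ ≤ 1 := by
  rw [norm_win, Real.exp_le_one_iff]
  nlinarith [Real.pi_pos, sq_nonneg ν]

lemma memLp_of_integrable_of_bdd {u : ℝ → ℂ} (hu : Integrable u) {C : ℝ} (hb : ∀ x, ‖u x‖ ≤ C) :
    MemLp u 2 volume := by
  rw [memLp_two_iff_integrable_sq_norm hu.1]
  simp_rw [pow_two]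
  exact hu.norm.bdd_mul hu.norm.1 (Eventually.of_forall fun x => by simpa using hb x)

lemma memLp_win (a : ℝ) : MemLp (win a) 2 volume :=
  memLp_of_integrable_of_bdd (integrable_win a) (norm_win_le_one a)

/-- The Fourier transform of the window. -/
def dwin (a : ℝ) : ℝ → ℂ := 𝓕 (win a)

lemma continuous_dwin (a : ℝ) : Continuous (dwin a) :=
  continuous_fourier_of_integrable (integrable_win a)

/-- Evenness is the only pointwise information about the transform of a chirped window that the
lower bound needs; no explicit formula is used for a ≠ 0. -/
lemma dwin_neg (a y : ℝ) : dwin a (-y) = dwin a y := by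
  rw [dwin, Real.fourier_real_eq_integral_exp_smul, Real.fourier_real_eq_integral_exp_smul,
    ← integral_neg_eq_self]
  simp [win_neg]

lemma norm_fourier_le (u : ℝ → ℂ) (v : ℝ) : ‖𝓕 u v‖ ≤ ∫ x, ‖u x‖ :=
  VectorFourier.norm_fourierIntegral_le_integral_norm _ _ _ _ _

/-- The chirp does not change the modulus of the window, so Plancherel gives a mass independent of
`a`. Uniformity in `a` of the lower bound rests on this. -/
lemma lintegral_dwin_sq (a : ℝ) : ∫⁻ y, ‖dwin a y‖ₑ ^ 2 = ∫⁻ y, ‖win 0 y‖ₑ ^ 2 := by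
  rw [dwin, lintegral_fourier_sq (integrable_win a) (memLp_win a)]
  simp_rw [← ofReal_norm, norm_win]

lemma memLp_dwin (a : ℝ) : MemLp (dwin a) 2 volume := by
  have h := fourier_toLp_ae_eq (integrable_win a) (memLp_win a)
  exact (memLp_congr_ae h).1 (Lp.memLp _)

lemma dwin_zero : dwin 0 = win 0 := by
  have := fourier_gaussian_pi (b := 1) (by simp)
  simp only [dwin]
  have e : win 0 = fun x : ℝ => Complex.exp (-Real.pi * 1 * x ^ 2) := by
    ext x; simp [win]
  rw [e, this]
  ext x; simp

/-- Both sides are continuous in h for the L² norm and agree for Schwartz h, which are dense. The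
test function here is a modulated window and h is merely in L². -/
lemma integral_fourier_mul_of_memLp (h : L2R) {ψ : ℝ → ℂ} (hi : Integrable ψ)
    (hψ : MemLp ψ 2 volume) :
    ∫ v, (𝓕 h : L2R) v * ψ v = ∫ x, h x * 𝓕 ψ x := by
  have hc : ∀ {k : ℝ → ℂ}, MemLp k 2 volume → Continuous fun h : L2R => ∫ v, h v * k v := by
    intro k hk
    have hk' : MemLp (fun x => starRingEnd ℂ (k x)) 2 volume := hk.star
    have : (fun h : L2R => ∫ v, h v * k v) = fun h => ⟪hk'.toLp _, h⟫_ℂ := by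
      ext h
      rw [L2.inner_def]
      apply integral_congr_ae
      filter_upwards [hk'.coeFn_toLp] with x hx
      rw [hx, RCLike.inner_apply, Complex.conj_conj]
    rw [this]
    fun_prop
  have hF : MemLp (𝓕 ψ) 2 volume := (memLp_congr_ae (fourier_toLp_ae_eq hi hψ)).1 (Lp.memLp _)
  refine DenseRange.induction_on (p := fun h : L2R => ∫ v, (𝓕 h : L2R) v * ψ v = ∫ x, h x * 𝓕 ψ x)
    (SchwartzMap.denseRange_toLpCLM (F := ℂ) (E := ℝ) (p := 2) (μ := volume) ENNReal.ofNat_ne_top) h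
    (isClosed_eq ((hc hψ).comp (Lp.fourierTransformₗᵢ ℝ ℂ).continuous) (hc hF)) fun f => ?_
  have h1 : (𝓕 (SchwartzMap.toLpCLM ℝ ℂ 2 volume f) : L2R) =ᵐ[volume] 𝓕 (f : ℝ → ℂ) := by
    rw [SchwartzMap.toLpCLM_apply, SchwartzMap.toLp_fourier_eq]
    exact SchwartzMap.coeFn_toLp _ _ _
  have h2 := f.coeFn_toLp 2 volume
  calc _ = ∫ v, 𝓕 (f : ℝ → ℂ) v * ψ v :=
        integral_congr_ae (by filter_upwards [h1] with x hx; rw [hx])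
    _ = ∫ x, f x * 𝓕 ψ x := integral_fourier_mul_eq_flip f.integrable hi
    _ = _ := integral_congr_ae (by
        filter_upwards [h2] with x hx; rw [SchwartzMap.toLpCLM_apply, hx])

/-- The windowed transform `∫ φ(ν) γ_a(ν - ξ) e^{2π i ν x} dν`. -/
def stft (a : ℝ) (φ : ℝ → ℂ) (x ξ : ℝ) : ℂ :=
  ∫ ν, φ ν * (win a (ν - ξ) * Complex.exp ((2 * Real.pi * ν * x : ℝ) * Complex.I))

lemma stft_congr (a : ℝ) {φ ψ : ℝ → ℂ} (e : φ =ᵐ[volume] ψ) (x ξ : ℝ) :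
    stft a φ x ξ = stft a ψ x ξ :=
  integral_congr_ae (by filter_upwards [e] with ν hν; rw [hν])

/-- Since aν² - a(ν - ξ)² = 2aνξ - aξ², the chirp of the function cancels that of the window up to a
linear phase in ν, which shifts x by aξ/π, and a unimodular constant. The modulus of the windowed
transform is thus exactly sheared. -/
lemma norm_stft_chirp (a : ℝ) (φ : ℝ → ℂ) (x ξ : ℝ) :
    ‖stft a (fun ν => Complex.exp ((a * ν ^ 2 : ℝ) * Complex.I) * φ ν) x ξ‖
      = ‖stft 0 φ (x + a / Real.pi * ξ) ξ‖ := by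
  have h : stft a (fun ν => Complex.exp ((a * ν ^ 2 : ℝ) * Complex.I) * φ ν) x ξ
      = Complex.exp ((-(a * ξ ^ 2) : ℝ) * Complex.I) * stft 0 φ (x + a / Real.pi * ξ) ξ := by
    rw [stft, stft, ← integral_const_mul]
    congr 1; ext ν
    have hpi : (Real.pi : ℂ) ≠ 0 := by exact_mod_cast Real.pi_ne_zero
    have : Complex.exp ((a * ν ^ 2 : ℝ) * Complex.I) * (win a (ν - ξ) *
          Complex.exp ((2 * Real.pi * ν * x : ℝ) * Complex.I))
        = Complex.exp ((-(a * ξ ^ 2) : ℝ) * Complex.I) * (win 0 (ν - ξ) *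
          Complex.exp ((2 * Real.pi * ν * (x + a / Real.pi * ξ) : ℝ) * Complex.I)) := by
      simp only [win, ← Complex.exp_add]
      congr 1
      push_cast
      field_simp
      ring
    linear_combination φ ν * this
  rw [h, norm_mul, Complex.norm_exp_ofReal_mul_I, one_mul]

lemma measurable_stft (a : ℝ) (φ : L2R) :
    StronglyMeasurable fun p : ℝ × ℝ => stft a φ p.1 p.2 := by
  unfold stft
  have hφ : StronglyMeasurable (φ : ℝ → ℂ) := Lp.stronglyMeasurable φ
  have h1 : StronglyMeasurable fun q : (ℝ × ℝ) × ℝ => φ q.2 * (win a (q.2 - q.1.2) *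
      Complex.exp ((2 * Real.pi * q.2 * q.1.1 : ℝ) * Complex.I)) := by
    refine (hφ.comp_measurable measurable_snd).mul (Continuous.stronglyMeasurable ?_)
    have := continuous_win a
    fun_prop
  exact h1.integral_prod_right'

lemma integrable_mul_of_memLp {u v : ℝ → ℂ} (hu : MemLp u 2 volume) (hv : MemLp v 2 volume) :
    Integrable (fun x => u x * v x) := hu.integrable_mul hv

lemma memLp_mul_of_bdd {u v : ℝ → ℂ} (hu : MemLp u 2 volume) (hv : Continuous v) {C : ℝ}
    (hb : ∀ x, ‖v x‖ ≤ C) : MemLp (fun x => u x * v x) 2 volume := by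
  refine MemLp.of_le_mul (c := C) hu (hu.1.mul hv.aestronglyMeasurable)
    (Eventually.of_forall fun x => ?_)
  rw [norm_mul, mul_comm]
  exact mul_le_mul_of_nonneg_right (hb x) (norm_nonneg _)

/-- For fixed ξ the windowed transform is an inverse Fourier transform in x, so this is Plancherel.
-/
lemma lintegral_stft_left (φ : L2R) (ξ : ℝ) :
    ∫⁻ x, ‖stft 0 φ x ξ‖ₑ ^ 2 = ∫⁻ ν, ‖φ ν‖ₑ ^ 2 * ‖win 0 (ν - ξ)‖ₑ ^ 2 := by
  have hw : MemLp (fun ν => win 0 (ν - ξ)) 2 volume :=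
    (memLp_win 0).comp_measurePreserving (measurePreserving_sub_right volume ξ)
  have hc : Continuous fun ν => win 0 (ν - ξ) := by have := continuous_win 0; fun_prop
  have hi := integrable_mul_of_memLp (Lp.memLp φ) hw
  have h2 := memLp_mul_of_bdd (Lp.memLp φ) hc (fun x => norm_win_le_one 0 _)
  have := lintegral_fourierInv_sq hi h2
  simp_rw [enorm_mul, mul_pow] at this
  rw [← this]
  congr 1; ext x
  rw [Real.fourierInv_eq_fourier_neg, Real.fourier_real_eq_integral_exp_smul, stft]
  congr 3; ext ν
  rw [smul_eq_mul, show (-2 * Real.pi * ν * -x) = 2 * Real.pi * ν * x by ring]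
  ring

/-- For fixed x the multiplication formula moves the transform onto the window. Up to a unimodular
factor the result is the Fourier transform, in ξ, of h times a translate of `dwin a`, and Plancherel
applies again. -/
lemma lintegral_stft_right (a : ℝ) (h : L2R) (x : ℝ) :
    ∫⁻ ξ, ‖stft a (𝓕 h : L2R) x ξ‖ₑ ^ 2 = ∫⁻ y, ‖h y‖ₑ ^ 2 * ‖dwin a (y - x)‖ₑ ^ 2 := by
  have hw : MemLp (fun ν => dwin a (ν - x)) 2 volume :=
    (memLp_dwin a).comp_measurePreserving (measurePreserving_sub_right volume x)
  have hc : Continuous fun ν => dwin a (ν - x) := by have := continuous_dwin a; fun_prop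
  have hi := integrable_mul_of_memLp (Lp.memLp h) hw
  have h2 := memLp_mul_of_bdd (Lp.memLp h) hc (fun y => norm_fourier_le _ _)
  have := lintegral_fourier_sq hi h2
  simp_rw [enorm_mul, mul_pow] at this
  rw [← this]
  congr 1; ext ξ
  have hψ1 : Integrable (fun ν => win a (ν - ξ) *
      Complex.exp ((2 * Real.pi * ν * x : ℝ) * Complex.I)) := by
    refine ((integrable_win a).comp_sub_right ξ).mul_bdd (c := 1) (by fun_prop)
      (Eventually.of_forall fun ν => ?_)
    rw [Complex.norm_exp_ofReal_mul_I]
  have hψ2 := memLp_of_integrable_of_bdd hψ1 (C := 1) (fun ν => by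
    rw [norm_mul, Complex.norm_exp_ofReal_mul_I, mul_one]; exact norm_win_le_one _ _)
  rw [stft, integral_fourier_mul_of_memLp h hψ1 hψ2]
  have e : ∀ y, 𝓕 (fun ν => win a (ν - ξ) *
      Complex.exp ((2 * Real.pi * ν * x : ℝ) * Complex.I)) y
      = Complex.exp ((2 * Real.pi * ξ * (x - y) : ℝ) * Complex.I) * dwin a (y - x) := by
    intro y
    rw [dwin, Real.fourier_real_eq_integral_exp_smul, Real.fourier_real_eq_integral_exp_smul,
      ← integral_const_mul, ← integral_add_right_eq_self _ ξ]
    congr 1; ext ν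
    simp only [smul_eq_mul, add_sub_cancel_right]
    have : Complex.exp ((-2 * Real.pi * (ν + ξ) * y : ℝ) * Complex.I) *
        Complex.exp ((2 * Real.pi * (ν + ξ) * x : ℝ) * Complex.I)
        = Complex.exp ((2 * Real.pi * ξ * (x - y) : ℝ) * Complex.I) *
        Complex.exp ((-2 * Real.pi * ν * (y - x) : ℝ) * Complex.I) := by
      rw [← Complex.exp_add, ← Complex.exp_add]
      congr 1; push_cast; ring
    linear_combination win a ν * this
  simp_rw [e]
  have e2 : ∫ y, h y * (Complex.exp ((2 * Real.pi * ξ * (x - y) : ℝ) * Complex.I) * dwin a (y - x))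
      = Complex.exp ((2 * Real.pi * ξ * x : ℝ) * Complex.I) *
        𝓕 (fun y => h y * dwin a (y - x)) ξ := by
    rw [Real.fourier_real_eq_integral_exp_smul, ← integral_const_mul]
    congr 1; ext y
    have : Complex.exp ((2 * Real.pi * ξ * (x - y) : ℝ) * Complex.I)
        = Complex.exp ((2 * Real.pi * ξ * x : ℝ) * Complex.I) *
        Complex.exp ((-2 * Real.pi * y * ξ : ℝ) * Complex.I) := by
      rw [← Complex.exp_add]
      congr 1; push_cast; ring
    rw [this, smul_eq_mul]; ring
  rw [e2, ← ofReal_norm, norm_mul, Complex.norm_exp_ofReal_mul_I, one_mul, ofReal_norm]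

/-! ### The weighted estimate for the Schrödinger group -/

/-- As `dwin a` is even, the integrals with weights at y - z and y + z coincide. At least one of |y
- z|, |y + z| is at least |y|, so the two weights together dominate the weight at y, whatever the
decay of `dwin a`. -/
lemma wt_mul_half_le_lintegral {θ : ℝ} (hθ : 0 ≤ θ) (a y : ℝ) :
    wt θ y * ∫⁻ z, ‖win 0 z‖ₑ ^ 2 ≤ 2 * ∫⁻ x, wt θ x * ‖dwin a (y - x)‖ₑ ^ 2 := by
  have hm : Measurable fun z => ‖dwin a z‖ₑ ^ 2 := by
    have := (continuous_dwin a).measurable; fun_prop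
  have e1 : ∫⁻ x, wt θ x * ‖dwin a (y - x)‖ₑ ^ 2 = ∫⁻ z, wt θ (y - z) * ‖dwin a z‖ₑ ^ 2 := by
    rw [← lintegral_sub_left_eq_self _ y]
    simp
  have e2 : ∫⁻ z, wt θ (y - z) * ‖dwin a z‖ₑ ^ 2 = ∫⁻ z, wt θ (y + z) * ‖dwin a z‖ₑ ^ 2 := by
    rw [← lintegral_neg_eq_self]
    simp [dwin_neg]
  rw [two_mul, e1]
  nth_rewrite 2 [e2]
  rw [← lintegral_add_left (by fun_prop), ← lintegral_dwin_sq a, ← lintegral_const_mul _ hm]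
  refine lintegral_mono fun z => ?_
  rw [← add_mul]
  gcongr
  rcases le_total |y| |y - z| with h | h
  · exact (wt_mono hθ h).trans le_self_add
  · refine (wt_mono hθ ?_).trans le_add_self
    by_contra! h'
    have h2 := abs_add_le (y - z) (y + z)
    have h3 : |y - z + (y + z)| = 2 * |y| := by
      rw [show y - z + (y + z) = 2 * y by ring, abs_mul]; simp
    linarith

lemma lintegral_wt_mul_win_lt_top (θ : ℝ) :
    ∫⁻ z, wt θ z * ‖win 0 z‖ₑ ^ 2 < ∞ := by
  have h1 : ∀ z : ℝ, wt θ z * ‖win 0 z‖ₑ ^ 2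
      = ENNReal.ofReal ((1 + z ^ 2) ^ θ * Real.exp (-(2 * Real.pi) * z ^ 2)) := by
    intro z
    rw [wt_eq, ← ofReal_norm, norm_win, ← ENNReal.ofReal_pow (by positivity),
      ← ENNReal.ofReal_mul (by positivity), ← Real.exp_nat_mul]
    congr 3; push_cast; ring
  simp_rw [h1]
  obtain ⟨n, hn⟩ := exists_nat_ge θ
  have hi : Integrable fun z : ℝ => (1 + z ^ 2) ^ n * Real.exp (-(2 * Real.pi) * z ^ 2) := by
    have : ∀ m : ℕ, Integrable fun z : ℝ => z ^ m * Real.exp (-(2 * Real.pi) * z ^ 2) := by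
      intro m
      have := integrable_rpow_mul_exp_neg_mul_sq (b := 2 * Real.pi) (by positivity) (s := m)
        (by have : (0:ℝ) ≤ m := m.cast_nonneg; linarith)
      simpa using this
    simp_rw [add_comm (1 : ℝ), add_pow, Finset.sum_mul]
    refine integrable_finsetSum _ fun i _ => ?_
    convert! (this (2 * i)).mul_const (n.choose i : ℝ) using 2 with z
    rw [pow_mul]; ring
  refine lt_of_le_of_lt (lintegral_mono fun z => ?_) hi.lintegral_lt_top
  have hz : (1 : ℝ) ≤ 1 + z ^ 2 := by nlinarith [sq_nonneg z]
  have h2 := Real.rpow_le_rpow_of_exponent_le hz hn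
  rw [Real.rpow_natCast] at h2
  gcongr

lemma lintegral_win_sq_pos : 0 < ∫⁻ z, ‖win 0 z‖ₑ ^ 2 := by
  rw [lintegral_pos_iff_support]
  · have : (Function.support fun z => ‖win 0 z‖ₑ ^ 2) = Set.univ := by
      ext z; simp [win]
    simp [this]
  · have := (continuous_win 0).measurable; fun_prop

lemma lintegral_win_sq_lt_top : ∫⁻ z, ‖win 0 z‖ₑ ^ 2 < ∞ := by
  simpa [wt] using lintegral_wt_mul_win_lt_top 0

/-- Peetre's inequality transfers the weight to y, and the Gaussian absorbs the remaining factor.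
The upper bounds are only required for the unchirped window. -/
lemma lintegral_wt_win_sub_le {θ : ℝ} (hθ : 0 ≤ θ) (y : ℝ) :
    ∫⁻ x, wt θ x * ‖win 0 (y - x)‖ₑ ^ 2
      ≤ ENNReal.ofReal (2 ^ θ) * (∫⁻ z, wt θ z * ‖win 0 z‖ₑ ^ 2) * wt θ y := by
  have hm := (continuous_win 0).measurable
  have e1 : ∫⁻ z, wt θ z * ‖win 0 z‖ₑ ^ 2 = ∫⁻ x, wt θ (x - y) * ‖win 0 (y - x)‖ₑ ^ 2 := by
    rw [← lintegral_sub_right_eq_self _ y]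
    congr 1; ext x
    rw [← win_neg, neg_sub]
  rw [e1, mul_right_comm, ← lintegral_const_mul _ (by fun_prop)]
  refine lintegral_mono fun x => ?_
  rw [← mul_assoc]
  gcongr
  exact wt_le_mul hθ x y

/-- The Schrödinger group `e^{i a ν²}` on the Fourier side. -/
def chirp (a ν : ℝ) : ℂ := Complex.exp ((a * ν ^ 2 : ℝ) * Complex.I)

lemma norm_chirp (a ν : ℝ) : ‖chirp a ν‖ = 1 := Complex.norm_exp_ofReal_mul_I _

lemma bddMeas_chirp (a : ℝ) : BddMeas (chirp a) :=
  ⟨by unfold chirp; fun_prop, 1, fun ν => (norm_chirp a ν).le⟩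

/-- `∫∫ ⟨x⟩^{2θ} |stft|²`. -/
def stftX (θ a : ℝ) (φ : ℝ → ℂ) : ℝ≥0∞ := ∫⁻ x, ∫⁻ ξ, wt θ x * ‖stft a φ x ξ‖ₑ ^ 2

/-- Tonelli and `lintegral_stft_right`: the weighted phase-space mass is an integral of |h|² against
a smoothed weight, to be compared with the weight itself from below (any `a`) and from above (`a =
0`). -/
lemma stftX_eq (θ a : ℝ) (h : L2R) :
    stftX θ a (𝓕 h : L2R)
      = ∫⁻ y, ‖h y‖ₑ ^ 2 * ∫⁻ x, wt θ x * ‖dwin a (y - x)‖ₑ ^ 2 := by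
  have hm := (continuous_dwin a).measurable
  have hh : Measurable (h : ℝ → ℂ) := (Lp.stronglyMeasurable h).measurable
  have hs := (measurable_stft a (𝓕 h)).measurable
  have e1 : ∀ x, ∫⁻ ξ, wt θ x * ‖stft a (𝓕 h : L2R) x ξ‖ₑ ^ 2
      = ∫⁻ y, ‖h y‖ₑ ^ 2 * (wt θ x * ‖dwin a (y - x)‖ₑ ^ 2) := by
    intro x
    rw [lintegral_const_mul _ (by
      have := hs.comp (measurable_prodMk_left (x := x)); simp only [Function.comp_def] at this
      fun_prop), lintegral_stft_right, ← lintegral_const_mul _ (by fun_prop)]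
    congr 1; ext y; ring
  unfold stftX
  simp_rw [e1]
  rw [lintegral_lintegral_swap (by fun_prop)]
  congr 1; ext y
  rw [lintegral_const_mul _ (by fun_prop)]

/-- **Weighted estimate for the Schrödinger group.** -/
theorem exists_wsq_chirp_le {θ : ℝ} (hθ : 0 ≤ θ) :
    ∃ C : ℝ≥0, ∀ (a : ℝ) (h : L2R),
      wsq θ (FM (chirp a) h) ≤ C * wt θ a * (wsq θ h + wsq θ (𝓕 h : L2R)) := by
  set c0 := ∫⁻ z, ‖win 0 z‖ₑ ^ 2 with hc0
  have hc0' : c0 ≠ 0 := lintegral_win_sq_pos.ne'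
  have hc0t : c0 ≠ ∞ := lintegral_win_sq_lt_top.ne
  set c1 := ENNReal.ofReal (2 ^ θ) * (∫⁻ z, wt θ z * ‖win 0 z‖ₑ ^ 2) with hc1
  have hc1t : c1 ≠ ∞ := ENNReal.mul_ne_top ENNReal.ofReal_ne_top (lintegral_wt_mul_win_lt_top θ).ne
  set D := c0⁻¹ * 2 * (ENNReal.ofReal (4 ^ θ) * c1) with hD
  have hDt : D ≠ ∞ := by
    rw [hD]
    exact ENNReal.mul_ne_top (ENNReal.mul_ne_top (ENNReal.inv_ne_top.2 hc0') (by simp))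
      (ENNReal.mul_ne_top ENNReal.ofReal_ne_top hc1t)
  refine ⟨D.toNNReal, fun a h => ?_⟩
  rw [ENNReal.coe_toNNReal hDt]
  set k : L2R := FM (chirp a) h with hk
  set φ : L2R := 𝓕 h with hφ
  have hs := (measurable_stft 0 φ).measurable
  have hkm : Measurable (k : ℝ → ℂ) := (Lp.stronglyMeasurable k).measurable
  have hhm : Measurable (h : ℝ → ℂ) := (Lp.stronglyMeasurable h).measurable
  have hφm : Measurable (φ : ℝ → ℂ) := (Lp.stronglyMeasurable φ).measurable
  have hwm := (continuous_win 0).measurable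
  -- The evolved function is measured with the window of chirp `a`, the initial one with chirp `0`;
  -- the constant `c0` does not depend on `a`.
  have lower : wsq θ k * c0 ≤ 2 * stftX θ a (𝓕 k : L2R) := by
    rw [stftX_eq, wsq, ← lintegral_mul_const _ (by fun_prop),
      ← lintegral_const_mul' _ _ (by simp)]
    refine lintegral_mono fun y => ?_
    calc wt θ y * ‖k y‖ₑ ^ 2 * c0 = ‖k y‖ₑ ^ 2 * (wt θ y * c0) := by ring
      _ ≤ ‖k y‖ₑ ^ 2 * (2 * ∫⁻ x, wt θ x * ‖dwin a (y - x)‖ₑ ^ 2) := 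
          mul_le_mul_right (wt_mul_half_le_lintegral hθ a y) _
      _ = _ := by ring
  have upX : stftX θ 0 φ ≤ c1 * wsq θ h := by
    rw [hφ, stftX_eq, wsq, ← lintegral_const_mul _ (by fun_prop)]
    refine lintegral_mono fun y => ?_
    rw [dwin_zero]
    calc _ ≤ ‖h y‖ₑ ^ 2 * (c1 * wt θ y) := by gcongr; exact lintegral_wt_win_sub_le hθ y
      _ = _ := by ring
  have upΞ : ∫⁻ ξ, ∫⁻ x, wt θ ξ * ‖stft 0 φ x ξ‖ₑ ^ 2 ≤ c1 * wsq θ φ := by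
    have e1 : ∀ ξ, ∫⁻ x, wt θ ξ * ‖stft 0 φ x ξ‖ₑ ^ 2
        = ∫⁻ ν, ‖φ ν‖ₑ ^ 2 * (wt θ ξ * ‖win 0 (ν - ξ)‖ₑ ^ 2) := by
      intro ξ
      rw [lintegral_const_mul _ (by
        have := hs.comp (measurable_prodMk_right (y := ξ)); simp only [Function.comp_def] at this
        fun_prop), lintegral_stft_left, ← lintegral_const_mul _ (by fun_prop)]
      congr 1; ext y; ring
    simp_rw [e1]
    rw [lintegral_lintegral_swap (by fun_prop), wsq, ← lintegral_const_mul _ (by fun_prop)]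
    refine lintegral_mono fun ν => ?_
    rw [lintegral_const_mul _ (by fun_prop)]
    calc _ ≤ ‖φ ν‖ₑ ^ 2 * (c1 * wt θ ν) := by gcongr; exact lintegral_wt_win_sub_le hθ ν
      _ = _ := by ring
  -- Translating x for each fixed ξ undoes the shear in the transform and moves it onto the weight.
  have mid : stftX θ a (𝓕 k : L2R)
      = ∫⁻ ξ, ∫⁻ x, wt θ (x - a / Real.pi * ξ) * ‖stft 0 φ x ξ‖ₑ ^ 2 := by
    have e : ∀ x ξ, ‖stft a (𝓕 k : L2R) x ξ‖ₑ = ‖stft 0 φ (x + a / Real.pi * ξ) ξ‖ₑ := by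
      intro x ξ
      rw [stft_congr a ((bddMeas_chirp a).coeFn_fourier_FM h)]
      rw [← ofReal_norm, ← ofReal_norm, ← norm_stft_chirp a φ x ξ]
      rfl
    unfold stftX
    simp_rw [e]
    rw [lintegral_lintegral_swap]
    · congr 1; ext ξ
      rw [← lintegral_add_right_eq_self (fun x => wt θ (x - a / Real.pi * ξ) * _)
        (a / Real.pi * ξ)]
      simp
    · have : Measurable fun p : ℝ × ℝ => (p.1 + a / Real.pi * p.2, p.2) := by fun_prop
      have h2 := hs.comp this
      simp only [Function.comp_def] at h2
      have : Measurable fun p : ℝ × ℝ => wt θ p.1 * ‖stft 0 φ (p.1 + a / Real.pi * p.2) p.2‖ₑ ^ 2 :=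
        by fun_prop
      exact this.aemeasurable
  have hb : wt θ (a / Real.pi) ≤ wt θ a := by
    refine wt_mono hθ ?_
    rw [abs_div, abs_of_pos Real.pi_pos]
    exact div_le_self (abs_nonneg a) (by linarith [Real.pi_gt_three])
  have upper : stftX θ a (𝓕 k : L2R)
      ≤ ENNReal.ofReal (4 ^ θ) * wt θ a * (c1 * wsq θ h + c1 * wsq θ φ) := by
    rw [mid]
    have hsw : stftX θ 0 φ = ∫⁻ ξ, ∫⁻ x, wt θ x * ‖stft 0 φ x ξ‖ₑ ^ 2 := by
      unfold stftX
      rw [lintegral_lintegral_swap]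
      have : Measurable fun p : ℝ × ℝ => wt θ p.1 * ‖stft 0 φ p.1 p.2‖ₑ ^ 2 := by fun_prop
      exact this.aemeasurable
    have hsξ : ∀ ξ, Measurable fun x => ‖stft 0 φ x ξ‖ₑ ^ 2 := by
      intro ξ
      have := hs.comp (measurable_prodMk_right (y := ξ)); simp only [Function.comp_def] at this
      fun_prop
    calc ∫⁻ ξ, ∫⁻ x, wt θ (x - a / Real.pi * ξ) * ‖stft 0 φ x ξ‖ₑ ^ 2
        ≤ ∫⁻ ξ, ∫⁻ x, ENNReal.ofReal (4 ^ θ) * wt θ a *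
          (wt θ x * ‖stft 0 φ x ξ‖ₑ ^ 2 + wt θ ξ * ‖stft 0 φ x ξ‖ₑ ^ 2) := by
          refine lintegral_mono fun ξ => lintegral_mono fun x => ?_
          rw [← add_mul, ← mul_assoc]
          gcongr
          refine (wt_sub_mul_le hθ x (a / Real.pi) ξ).trans ?_
          gcongr
      _ = ENNReal.ofReal (4 ^ θ) * wt θ a * (stftX θ 0 φ +
            ∫⁻ ξ, ∫⁻ x, wt θ ξ * ‖stft 0 φ x ξ‖ₑ ^ 2) := by
          have hfin : ENNReal.ofReal (4 ^ θ) * wt θ a ≠ ∞ :=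
            ENNReal.mul_ne_top ENNReal.ofReal_ne_top ENNReal.ofReal_ne_top
          simp_rw [lintegral_const_mul' _ _ hfin]
          congr 1
          rw [hsw, ← lintegral_add_left]
          · congr 1; ext ξ
            rw [lintegral_add_left]
            have := hsξ ξ
            fun_prop
          · have : Measurable fun p : ℝ × ℝ => wt θ p.2 * ‖stft 0 φ p.2 p.1‖ₑ ^ 2 := by
              have h2 := hs.comp (measurable_swap)
              simp only [Function.comp_def, Prod.fst_swap, Prod.snd_swap] at h2
              fun_prop
            exact this.lintegral_prod_right'
      _ ≤ _ := by gcongr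
  have : wsq θ k = c0⁻¹ * (wsq θ k * c0) := by
    rw [mul_comm (wsq θ k), ← mul_assoc, ENNReal.inv_mul_cancel hc0' hc0t, one_mul]
  rw [this]
  calc c0⁻¹ * (wsq θ k * c0) ≤ c0⁻¹ * (2 * (ENNReal.ofReal (4 ^ θ) * wt θ a *
        (c1 * wsq θ h + c1 * wsq θ φ))) :=
        mul_le_mul_right (lower.trans (mul_le_mul_right upper _)) _
    _ = _ := by rw [hD]; ring

/-! ### Homogeneous weights and Schur's test -/

/-- The homogeneous weight `|x|^p`. -/
def pw (p x : ℝ) : ℝ≥0∞ := ENNReal.ofReal (|x| ^ p)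

@[fun_prop]
lemma measurable_pw (p : ℝ) : Measurable (pw p) := by unfold pw; fun_prop

lemma pw_zero (x : ℝ) : pw 0 x = 1 := by simp [pw]

lemma pw_add (p q : ℝ) {x : ℝ} (hx : x ≠ 0) : pw (p + q) x = pw p x * pw q x := by
  rw [pw, pw, pw, ← ENNReal.ofReal_mul (by positivity), Real.rpow_add (abs_pos.2 hx)]

lemma pw_neg_mul_self (p : ℝ) {x : ℝ} (hx : x ≠ 0) : pw (-p) x * pw p x = 1 := by
  rw [← pw_add _ _ hx, neg_add_cancel, pw_zero]

lemma pw_mul (p x y : ℝ) : pw p (x * y) = pw p x * pw p y := by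
  rw [pw, pw, pw, ← ENNReal.ofReal_mul (by positivity), abs_mul,
    Real.mul_rpow (by positivity) (by positivity)]

lemma pw_sq (p x : ℝ) : pw p x ^ 2 = pw (2 * p) x := by
  rw [pw, pw, ← ENNReal.ofReal_pow (by positivity), ← Real.rpow_natCast,
    ← Real.rpow_mul (by positivity), mul_comm p]
  norm_num

lemma pw_neg_right (p x : ℝ) : pw p (-x) = pw p x := by simp [pw]

lemma pw_le_wt {θ : ℝ} (hθ : 0 ≤ θ) (x : ℝ) : pw (2 * θ) x ≤ wt θ x := by
  rw [← pw_sq, wt_eq, pw, ← ENNReal.ofReal_pow (by positivity), ← Real.rpow_natCast,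
    ← Real.rpow_mul (by positivity), mul_comm θ, Real.rpow_mul (by positivity)]
  gcongr
  simp

lemma wt_le_pw {θ : ℝ} (hθ : 0 ≤ θ) (x : ℝ) :
    wt θ x ≤ ENNReal.ofReal (2 ^ θ) * (1 + pw (2 * θ) x) := by
  have e : |x| ^ (2 * θ) = (x ^ 2) ^ θ := by
    rw [Real.rpow_mul (by positivity)]; simp
  rw [wt_eq, pw, e, ← ENNReal.ofReal_one, ← ENNReal.ofReal_add (by positivity) (by positivity),
    ← ENNReal.ofReal_mul (by positivity)]
  apply ENNReal.ofReal_le_ofReal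
  rcases le_total 1 (x ^ 2) with h | h
  · calc (1 + x ^ 2) ^ θ ≤ (2 * x ^ 2) ^ θ := by gcongr; linarith
      _ = 2 ^ θ * (x ^ 2) ^ θ := Real.mul_rpow (by positivity) (by positivity)
      _ ≤ _ := by gcongr; linarith
  · calc (1 + x ^ 2) ^ θ ≤ 2 ^ θ := by gcongr; linarith
      _ ≤ _ := le_mul_of_one_le_right (by positivity) (by linarith [Real.rpow_nonneg (sq_nonneg x) θ])

lemma ae_ne_zero : ∀ᵐ x : ℝ, x ≠ 0 := Measure.ae_ne volume 0

lemma lintegral_comp_mul_right (f : ℝ → ℝ≥0∞) (hf : Measurable f) {x : ℝ} (hx : x ≠ 0) :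
    ∫⁻ s, f (s * x) = ENNReal.ofReal |x|⁻¹ * ∫⁻ u, f u := by
  have h1 := Real.map_volume_mul_right hx
  have h2 : ∫⁻ s, f (s * x) = ∫⁻ u, f u ∂(Measure.map (· * x) volume) :=
    (lintegral_map hf (by fun_prop)).symm
  rw [h2, h1, lintegral_smul_measure, abs_inv]
  rfl

/-- Substitute u = s x; homogeneity of the power together with the Jacobian produces the exponent -p
- 1. -/
lemma lintegral_pw_mul_comp (p : ℝ) {f : ℝ → ℝ≥0∞} (hf : Measurable f) {x : ℝ} (hx : x ≠ 0) :
    ∫⁻ s, pw p s * f (s * x) = pw (-p - 1) x * ∫⁻ u, pw p u * f u := by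
  have h := lintegral_comp_mul_right (fun u => pw p u * f u) (by fun_prop) hx
  have e : ENNReal.ofReal |x|⁻¹ = pw (-1) x := by rw [pw, Real.rpow_neg_one]
  simp only [pw_mul] at h
  rw [sub_eq_add_neg, pw_add _ _ hx, mul_assoc, ← e, ← h, ← lintegral_const_mul _ (by fun_prop)]
  congr 1; ext s
  rw [show pw (-p) x * (pw p s * pw p x * f (s * x))
    = (pw (-p) x * pw p x) * (pw p s * f (s * x)) by ring, pw_neg_mul_self _ hx, one_mul]

/-- Weighted Cauchy–Schwarz. -/
lemma lintegral_mul_sq_le {w f g : ℝ → ℝ≥0∞} (hw : Measurable w)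
    (hf : AEMeasurable f) (hg : AEMeasurable g) :
    (∫⁻ x, w x * (f x * g x)) ^ 2 ≤ (∫⁻ x, w x * f x ^ 2) * ∫⁻ x, w x * g x ^ 2 := by
  have hh : ∀ x, (w x ^ (1 / 2 : ℝ)) ^ 2 = w x := by
    intro x
    rw [← ENNReal.rpow_natCast, ← ENNReal.rpow_mul]; norm_num
  have h := ENNReal.lintegral_mul_le_Lp_mul_Lq volume Real.HolderConjugate.two_two
    (f := fun x => w x ^ (1 / 2 : ℝ) * f x) (g := fun x => w x ^ (1 / 2 : ℝ) * g x)
    (by fun_prop) (by fun_prop)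
  simp only [Pi.mul_apply, ENNReal.rpow_ofNat, mul_pow, hh] at h
  have e : ∀ x, w x ^ (1 / 2 : ℝ) * f x * (w x ^ (1 / 2 : ℝ) * g x) = w x * (f x * g x) := by
    intro x
    nth_rewrite 3 [← hh x]
    ring
  simp only [e] at h
  calc _ ≤ _ := pow_le_pow_left₀ (by positivity) h 2
    _ = _ := by
      rw [mul_pow, ← ENNReal.rpow_natCast, ← ENNReal.rpow_natCast, ← ENNReal.rpow_mul,
        ← ENNReal.rpow_mul]
      norm_num

lemma lintegral_mul_sq_le' {f g : ℝ → ℝ≥0∞} (hf : AEMeasurable f) (hg : AEMeasurable g) :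
    (∫⁻ x, f x * g x) ^ 2 ≤ (∫⁻ x, f x ^ 2) * ∫⁻ x, g x ^ 2 := by
  simpa using lintegral_mul_sq_le (w := 1) measurable_one hf hg

/-- Schur's test for a homogeneous kernel `J(s x)`. -/
lemma schur_test {J g : ℝ → ℝ≥0∞} (hJ : Measurable J) (hg : Measurable g) :
    ∫⁻ s, (∫⁻ x, J (s * x) * g x) ^ 2 ≤ (∫⁻ u, pw (-1 / 2) u * J u) ^ 2 * ∫⁻ x, g x ^ 2 := by
  set A := ∫⁻ u, pw (-1 / 2) u * J u with hA
  have h1 : ∀ᵐ s : ℝ, (∫⁻ x, J (s * x) * g x) ^ 2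
      ≤ A * ∫⁻ x, pw (-1 / 2) s * (J (s * x) * (pw (1 / 2) x * g x ^ 2)) := by
    filter_upwards [ae_ne_zero] with s hs
    -- Schur test function |x|^{-1/4}: its square |x|^{-1/2} is the power which, integrated against
    -- J(s x), reproduces |s|^{-1/2}, so both halves of the test give the same constant A.
    have e1 : ∫⁻ x, J (s * x) * g x = ∫⁻ x, J (s * x) * (pw (-1 / 4) x * (pw (1 / 4) x * g x)) := by
      apply lintegral_congr_ae
      filter_upwards [ae_ne_zero] with x hx
      rw [← mul_assoc (pw _ _), show (-1 / 4 : ℝ) = -(1 / 4) by norm_num, pw_neg_mul_self _ hx,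
        one_mul]
    have e2 : ∫⁻ x, J (s * x) * pw (-1 / 4) x ^ 2 = pw (-1 / 2) s * A := by
      have := lintegral_pw_mul_comp (-1 / 2) hJ hs
      rw [← hA] at this
      rw [show (-1 / 2 : ℝ) = -(-1 / 2) - 1 by norm_num, ← this]
      congr 1; ext x
      rw [pw_sq, mul_comm, mul_comm x]; norm_num
    rw [e1]
    refine (lintegral_mul_sq_le (w := fun x => J (s * x)) (by fun_prop) (by fun_prop)
      (by fun_prop)).trans_eq ?_
    · rw [e2, lintegral_const_mul _ (by fun_prop), ← mul_assoc, mul_comm A]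
      congr 2; ext x
      rw [mul_pow, pw_sq]; norm_num
  calc _ ≤ ∫⁻ s, A * ∫⁻ x, pw (-1 / 2) s * (J (s * x) * (pw (1 / 2) x * g x ^ 2)) :=
        lintegral_mono_ae h1
    _ = A * ∫⁻ s, ∫⁻ x, pw (-1 / 2) s * (J (s * x) * (pw (1 / 2) x * g x ^ 2)) := by
        rw [lintegral_const_mul]
        have : Measurable fun p : ℝ × ℝ =>
          pw (-1 / 2) p.1 * (J (p.1 * p.2) * (pw (1 / 2) p.2 * g p.2 ^ 2)) := by fun_prop
        exact this.lintegral_prod_right'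
    _ = A * ∫⁻ x, A * g x ^ 2 := by
        rw [lintegral_lintegral_swap (by fun_prop)]
        congr 1
        apply lintegral_congr_ae
        filter_upwards [ae_ne_zero] with x hx
        have h2 := lintegral_pw_mul_comp (-1 / 2) hJ hx
        rw [← hA, show (-(-1 / 2) - 1 : ℝ) = -(1 / 2) by norm_num] at h2
        calc _ = ∫⁻ s, (pw (-1 / 2) s * J (s * x)) * (pw (1 / 2) x * g x ^ 2) := by
              congr 1; ext s; ring
          _ = _ := by
              rw [lintegral_mul_const _ (by fun_prop), h2]
              rw [show pw (-(1 / 2)) x * A * (pw (1 / 2) x * g x ^ 2)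
                = (pw (-(1 / 2)) x * pw (1 / 2) x) * (A * g x ^ 2) by ring,
                pw_neg_mul_self _ hx, one_mul]
    _ = _ := by rw [lintegral_const_mul _ (by fun_prop)]; ring

/-- The exponent p takes care of the origin and q of infinity. -/
lemma lintegral_min_pw_lt_top {p q : ℝ} (hp : -1 < p) (hq : q < -1) :
    ∫⁻ u, min (pw p u) (pw q u) < ∞ := by
  have hpos : ∫⁻ u in Set.Ioi (0 : ℝ), min (pw p u) (pw q u) < ∞ := by
    rw [← Set.Ioc_union_Ioi_eq_Ioi zero_le_one, lintegral_union measurableSet_Ioi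
      (Set.Ioc_disjoint_Ioi le_rfl)]
    refine ENNReal.add_lt_top.2 ⟨?_, ?_⟩
    · have h := ((intervalIntegral.intervalIntegrable_rpow' (a := 0) (b := 1) hp).1).lintegral_lt_top
      refine lt_of_le_of_lt (setLIntegral_mono' measurableSet_Ioc fun x hx => ?_) h
      refine (min_le_left _ _).trans ?_
      rw [pw, abs_of_pos hx.1]
    · have h := (integrableOn_Ioi_rpow_of_lt hq zero_lt_one).lintegral_lt_top
      refine lt_of_le_of_lt (setLIntegral_mono' measurableSet_Ioi fun x hx => ?_) h
      refine (min_le_right _ _).trans ?_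
      rw [pw, abs_of_pos (zero_lt_one.trans hx)]
  have hneg : ∫⁻ u in Set.Iio (0 : ℝ), min (pw p u) (pw q u) < ∞ := by
    have : ∫⁻ u in Set.Iio (0 : ℝ), min (pw p u) (pw q u)
        = ∫⁻ u in Set.Ioi (0 : ℝ), min (pw p u) (pw q u) := by
      rw [← lintegral_indicator measurableSet_Iio, ← lintegral_indicator measurableSet_Ioi,
        ← lintegral_neg_eq_self]
      congr 1; ext u
      simp [Set.indicator, pw_neg_right]
    rwa [this]
  rw [← lintegral_add_compl _ (measurableSet_Ioi (a := (0 : ℝ))), Set.compl_Ioi,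
    setLIntegral_congr Iio_ae_eq_Iic.symm]
  exact ENNReal.add_lt_top.2 ⟨hpos, hneg⟩

/-! ### Integrability from weights -/

lemma lintegral_wt_lt_top {θ : ℝ} (hθ : θ < -1 / 2) : ∫⁻ x, wt θ x < ∞ := by
  have h := integrable_rpow_neg_one_add_norm_sq (E := ℝ) (μ := volume) (r := -2 * θ)
    (by simp; linarith)
  have := h.lintegral_lt_top
  convert this using 3 with x
  rw [wt_eq]
  simp only [Real.norm_eq_abs, sq_abs]
  congr 2; ring

lemma wt_add (θ τ x : ℝ) : wt (θ + τ) x = wt θ x * wt τ x := by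
  rw [wt_eq, wt_eq, wt_eq, ← ENNReal.ofReal_mul (by positivity),
    ← Real.rpow_add (by positivity)]

lemma wt_zero (x : ℝ) : wt 0 x = 1 := by simp [wt]

lemma wt_ne_top (θ x : ℝ) : wt θ x ≠ ∞ := ENNReal.ofReal_ne_top

lemma wt_mono_left {θ τ : ℝ} (h : θ ≤ τ) (x : ℝ) : wt θ x ≤ wt τ x := by
  rw [wt, wt]
  have := one_le_bracket x
  gcongr

lemma wsq_mono {θ τ : ℝ} (h : θ ≤ τ) (f : ℝ → ℂ) : wsq θ f ≤ wsq τ f :=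
  lintegral_mono fun x => by gcongr; exact wt_mono_left h x

lemma wsq_zero (f : ℝ → ℂ) : wsq 0 f = ∫⁻ x, ‖f x‖ₑ ^ 2 := by simp [wsq, wt_zero]

lemma lintegral_le_wsq {θ : ℝ} (hθ : 0 ≤ θ) (f : ℝ → ℂ) : ∫⁻ x, ‖f x‖ₑ ^ 2 ≤ wsq θ f := by
  rw [← wsq_zero]; exact wsq_mono hθ f

lemma enorm_pow_sq_le_wt (l : ℕ) (x : ℝ) : ‖(x : ℂ) ^ l‖ₑ ^ 2 ≤ wt l x := by
  have := pw_le_wt (θ := l) l.cast_nonneg x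
  refine le_trans (le_of_eq ?_) this
  rw [← pw_sq, pw, ← ofReal_norm, norm_pow, Complex.norm_real, Real.rpow_natCast,
    Real.norm_eq_abs]

/-- Cauchy–Schwarz after inserting ⟨x⟩^{-θ}⟨x⟩^{θ}. The first factor is finite when l - θ < -1/2,
the source of the threshold l + 1/2 < θ for the l-th moment to make sense. -/
lemma lintegral_pow_mul_sq_le (l : ℕ) (θ : ℝ) {f : ℝ → ℂ}
    (hf : AEMeasurable f) :
    (∫⁻ x : ℝ, ‖(x : ℂ) ^ l * f x‖ₑ) ^ 2 ≤ (∫⁻ x, wt (l - θ) x) * wsq θ f := by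
  have e : ∀ x : ℝ, ‖(x : ℂ) ^ l * f x‖ₑ = ENNReal.ofReal (bracket x ^ (-θ)) * ‖(x : ℂ) ^ l‖ₑ *
      (ENNReal.ofReal (bracket x ^ θ) * ‖f x‖ₑ) := by
    intro x
    rw [mul_mul_mul_comm, ← ENNReal.ofReal_mul (Real.rpow_nonneg (bracket_pos x).le _),
      ← Real.rpow_add (bracket_pos x), neg_add_cancel, Real.rpow_zero, ENNReal.ofReal_one, one_mul,
      enorm_mul]
  have e2 : ∀ x τ : ℝ, ENNReal.ofReal (bracket x ^ τ) ^ 2 = wt τ x := by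
    intro x τ
    rw [wt, ← ENNReal.ofReal_pow (Real.rpow_nonneg (bracket_pos x).le _), ← Real.rpow_natCast,
      ← Real.rpow_mul (bracket_pos x).le]
    congr 2; push_cast; ring
  simp_rw [e]
  refine (lintegral_mul_sq_le' (by fun_prop) (by fun_prop)).trans ?_
  simp_rw [mul_pow, e2]
  gcongr with x
  · rw [sub_eq_neg_add, wt_add]
    gcongr
    exact enorm_pow_sq_le_wt l x
  · exact le_rfl

lemma integrable_pow_mul {l : ℕ} {θ : ℝ} (hl : l + 1 / 2 < θ) {f : ℝ → ℂ}
    (hf : AEStronglyMeasurable f) (hw : wsq θ f < ∞) : Integrable fun x : ℝ => (x : ℂ) ^ l * f x := by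
  refine ⟨(by fun_prop : Continuous fun x : ℝ => (x : ℂ) ^ l).aestronglyMeasurable.mul hf, ?_⟩
  have h := lintegral_pow_mul_sq_le l θ hf.aemeasurable
  have h2 : (∫⁻ x : ℝ, ‖(x : ℂ) ^ l * f x‖ₑ) ^ 2 < ∞ :=
    h.trans_lt (ENNReal.mul_lt_top (lintegral_wt_lt_top (by linarith)) hw)
  rw [HasFiniteIntegral]
  by_contra h3
  rw [not_lt, top_le_iff] at h3
  rw [h3] at h2
  simp at h2

/-! ### Bounded multipliers as continuous linear maps -/

/-- Multiplication by a bounded measurable function, as a continuous linear map of `L²(ℝ)`. -/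
def BddMeas.mulCLM {m : ℝ → ℂ} (hm : BddMeas m) : L2R →L[ℂ] L2R :=
  LinearMap.mkContinuous
    { toFun := mulL m
      map_add' := fun f g => by
        apply Lp.ext
        filter_upwards [hm.coeFn (f + g), hm.coeFn f, hm.coeFn g, Lp.coeFn_add f g,
          Lp.coeFn_add (mulL m f) (mulL m g)] with x h1 h2 h3 h4 h5
        rw [h1, h5, h4, Pi.add_apply, Pi.add_apply, h2, h3, mul_add]
      map_smul' := fun c f => by
        apply Lp.ext
        filter_upwards [hm.coeFn (c • f), hm.coeFn f, Lp.coeFn_smul c f,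
          Lp.coeFn_smul c (mulL m f)] with x h1 h2 h3 h4
        rw [h1, RingHom.id_apply, h4, h3, Pi.smul_apply, Pi.smul_apply, h2, smul_eq_mul,
          smul_eq_mul]
        ring }
    hm.bdd.choose fun f => by
      refine Lp.norm_le_mul_norm_of_ae_le_mul ?_
      filter_upwards [hm.coeFn f] with x h1
      simp only [LinearMap.coe_mk, AddHom.coe_mk]
      rw [h1, norm_mul]
      exact mul_le_mul_of_nonneg_right (hm.bdd.choose_spec x) (norm_nonneg _)

/-- A bounded Fourier multiplier, as a continuous linear map of `L²(ℝ)`. -/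
def BddMeas.fmCLM {m : ℝ → ℂ} (hm : BddMeas m) : L2R →L[ℂ] L2R :=
  ((Lp.fourierTransformₗᵢ ℝ ℂ).symm.toContinuousLinearEquiv : L2R →L[ℂ] L2R) ∘L hm.mulCLM ∘L
    ((Lp.fourierTransformₗᵢ ℝ ℂ).toContinuousLinearEquiv : L2R →L[ℂ] L2R)

lemma BddMeas.fmCLM_apply {m : ℝ → ℂ} (hm : BddMeas m) (h : L2R) : hm.fmCLM h = FM m h := rfl

lemma BddMeas.lintegral_FM_le {m : ℝ → ℂ} (hm : BddMeas m) (h1 : ∀ x, ‖m x‖ ≤ 1) (h : L2R) :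
    ∫⁻ x, ‖FM m h x‖ₑ ^ 2 ≤ ∫⁻ x, ‖h x‖ₑ ^ 2 := by
  rw [← lintegral_coe_fourier_sq, ← lintegral_coe_fourier_sq h]
  refine lintegral_mono_ae ?_
  filter_upwards [hm.coeFn_fourier_FM h] with v hv
  rw [hv, enorm_mul]
  gcongr
  refine mul_le_of_le_one_left (zero_le) ?_
  rw [← ofReal_norm]
  exact ENNReal.ofReal_le_one.2 (h1 v)

/-! ### The sign multiplier and difference operators -/

/-- The sign symbol. -/
def sg (v : ℝ) : ℂ := ((Real.sign v : ℝ) : ℂ)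

lemma norm_sg_le (v : ℝ) : ‖sg v‖ ≤ 1 := by
  rcases Real.sign_apply_eq v with h | h | h <;> simp [sg, h]

lemma bddMeas_sg : BddMeas sg :=
  ⟨Complex.measurable_ofReal.comp measurable_sign, 1, norm_sg_le⟩

/-- The symbol `e^{2π i s x} - 1` of a difference operator. -/
def dsym (s x : ℝ) : ℂ := Complex.exp (2 * Real.pi * s * x * Complex.I) - 1

lemma dsym_eq (s x : ℝ) : dsym s x = Complex.exp (Complex.I * ((2 * Real.pi * (s * x) : ℝ) : ℂ)) - 1 := by
  rw [dsym]; congr 2; push_cast; ring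

lemma dsym_one_mul (s x : ℝ) : dsym 1 (s * x) = dsym s x := by
  rw [dsym_eq, dsym_eq, one_mul]

lemma norm_dsym_le_two (s x : ℝ) : ‖dsym s x‖ ≤ 2 := by
  rw [dsym_eq]
  refine (norm_sub_le _ _).trans ?_
  rw [mul_comm, Complex.norm_exp_ofReal_mul_I]
  norm_num

lemma norm_dsym_le (s x : ℝ) : ‖dsym s x‖ ≤ 2 * Real.pi * (|s| * |x|) := by
  rw [dsym_eq]
  refine Real.norm_exp_I_mul_ofReal_sub_one_le.trans_eq ?_
  rw [Real.norm_eq_abs, abs_mul, abs_mul s, abs_of_pos Real.two_pi_pos]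

lemma bddMeas_char (s : ℝ) :
    BddMeas fun x : ℝ => Complex.exp (2 * Real.pi * s * x * Complex.I) := by
  refine ⟨by fun_prop, 1, fun x => ?_⟩
  have : (2 * Real.pi * s * x * Complex.I : ℂ) = ((2 * Real.pi * s * x : ℝ) : ℂ) * Complex.I := by
    push_cast; ring
  rw [this, Complex.norm_exp_ofReal_mul_I]

lemma bddMeas_dsym (s : ℝ) : BddMeas (dsym s) :=
  ⟨by unfold dsym; fun_prop, 2, norm_dsym_le_two s⟩

lemma fourier_mulL_dsym (s : ℝ) (h : L2R) :
    (𝓕 (mulL (dsym s) h) : L2R) =ᵐ[volume] fun v => (𝓕 h : L2R) (v - s) - (𝓕 h : L2R) v := by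
  have e : mulL (dsym s) h
      = mulL (fun x : ℝ => Complex.exp (2 * Real.pi * s * x * Complex.I)) h - h := by
    apply Lp.ext
    filter_upwards [(bddMeas_dsym s).coeFn h, (bddMeas_char s).coeFn h, Lp.coeFn_sub
      (mulL (fun x : ℝ => Complex.exp (2 * Real.pi * s * x * Complex.I)) h) h] with x h1 h2 h3
    rw [h1, h3, Pi.sub_apply, h2, dsym]
    ring
  rw [e, sub_eq_add_neg, FourierTransform.fourier_add]
  have en : 𝓕 (-h) = -(𝓕 h : L2R) := (Lp.fourierTransformₗᵢ ℝ ℂ).map_neg h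
  rw [en]
  filter_upwards [fourier_mulL_char s h, Lp.coeFn_add (𝓕 (mulL (fun x : ℝ =>
    Complex.exp (2 * Real.pi * s * x * Complex.I)) h)) (-(𝓕 h : L2R)),
    Lp.coeFn_neg (𝓕 h : L2R)] with v h1 h2 h3
  rw [h2, Pi.add_apply, h1, h3, Pi.neg_apply, ← sub_eq_add_neg]

/-- `∫_{|v| ≤ |s|} |φ|²`. -/
def low (s : ℝ) (φ : ℝ → ℂ) : ℝ≥0∞ := ∫⁻ v in {v | |v| ≤ |s|}, ‖φ v‖ₑ ^ 2

lemma measurableSet_abs_le (s : ℝ) : MeasurableSet {v : ℝ | |v| ≤ |s|} :=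
  measurableSet_le (by fun_prop) (by fun_prop)

lemma volume_abs_le (s : ℝ) : volume {v : ℝ | |v| ≤ |s|} = ENNReal.ofReal (2 * |s|) := by
  have : {v : ℝ | |v| ≤ |s|} = Set.Icc (-|s|) |s| := by ext v; simp [abs_le]
  rw [this, Real.volume_Icc]; congr 1; ring

lemma low_mono {s r : ℝ} (h : |s| ≤ |r|) (φ : ℝ → ℂ) : low s φ ≤ low r φ :=
  lintegral_mono_set fun _ hv => le_trans hv h

lemma norm_sg_sub_sg_le (v s : ℝ) : ‖sg (v - s) - sg v‖ ≤ 2 := by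
  refine (norm_sub_le _ _).trans ?_
  linarith [norm_sg_le (v - s), norm_sg_le v]

/-- A translation by s cannot cross the origin from a point farther than |s| away. This localises
the commutator at low frequencies. -/
lemma sg_sub_eq_of_lt {v s : ℝ} (h : |s| < |v - s|) : sg (v - s) = sg v := by
  unfold sg
  rcases lt_abs.1 h with h | h
  · have h2 := abs_lt.1 h
    rw [Real.sign_of_pos (by linarith [abs_nonneg s]), Real.sign_of_pos (by linarith)]
  · have h2 := abs_lt.1 h
    rw [Real.sign_of_neg (by linarith [abs_nonneg s]), Real.sign_of_neg (by linarith)]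

/-- Commutator of a difference operator and the sign multiplier. -/
lemma lintegral_commutator_le (s : ℝ) (h : L2R) :
    ∫⁻ x, ‖(mulL (dsym s) (FM sg h) - FM sg (mulL (dsym s) h) : L2R) x‖ₑ ^ 2
      ≤ 4 * low s (𝓕 h : L2R) := by
  set φ : L2R := 𝓕 h
  rw [← lintegral_coe_fourier_sq]
  -- The untranslated terms cancel; only the jump of the sign between v - s and v survives.
  have e : (𝓕 (mulL (dsym s) (FM sg h) - FM sg (mulL (dsym s) h)) : L2R)
      =ᵐ[volume] fun v => (sg (v - s) - sg v) * φ (v - s) := by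
    have es : 𝓕 (mulL (dsym s) (FM sg h) - FM sg (mulL (dsym s) h))
        = (𝓕 (mulL (dsym s) (FM sg h)) - 𝓕 (FM sg (mulL (dsym s) h)) : L2R) :=
      (Lp.fourierTransformₗᵢ ℝ ℂ).map_sub _ _
    rw [es]
    have hS := bddMeas_sg.coeFn_fourier_FM h
    have hS' : ∀ᵐ v, (𝓕 (FM sg h) : L2R) (v - s) = sg (v - s) * φ (v - s) :=
      (measurePreserving_sub_right volume s).quasiMeasurePreserving.ae hS
    filter_upwards [Lp.coeFn_sub (𝓕 (mulL (dsym s) (FM sg h))) (𝓕 (FM sg (mulL (dsym s) h)) : L2R),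
      hS, hS', fourier_mulL_dsym s (FM sg h), fourier_mulL_dsym s h,
      bddMeas_sg.coeFn_fourier_FM (mulL (dsym s) h)] with v h1 h2 h3 h4 h5 h6
    rw [h1, Pi.sub_apply, h4, h6, h5, h3, h2]
    ring
  have hφ : Measurable (φ : ℝ → ℂ) := (Lp.stronglyMeasurable φ).measurable
  calc _ = ∫⁻ v, ‖(sg (v - s) - sg v) * φ (v - s)‖ₑ ^ 2 :=
        lintegral_congr_ae (by filter_upwards [e] with v hv; rw [hv])
    _ ≤ ∫⁻ v, 4 * ({v | |v| ≤ |s|} : Set ℝ).indicator (fun v => ‖φ v‖ₑ ^ 2) (v - s) := by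
        refine lintegral_mono fun v => ?_
        by_cases hv : |v - s| ≤ |s|
        · rw [Set.indicator_of_mem (by exact hv), enorm_mul, mul_pow]
          gcongr
          rw [← ofReal_norm, ← ENNReal.ofReal_pow (norm_nonneg _)]
          refine (ENNReal.ofReal_le_ofReal (pow_le_pow_left₀ (norm_nonneg _)
            (norm_sg_sub_sg_le v s) 2)).trans_eq ?_
          norm_num
        · rw [sg_sub_eq_of_lt (not_le.1 hv)]; simp
    _ = _ := by
        rw [lintegral_const_mul' _ _ (by simp), lintegral_sub_right_eq_self
          (fun v => ({v | |v| ≤ |s|} : Set ℝ).indicator (fun v => ‖φ v‖ₑ ^ 2) v),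
          lintegral_indicator (measurableSet_abs_le s), low]

lemma enorm_add_sq_le (a b : ℂ) : ‖a + b‖ₑ ^ 2 ≤ 2 * ‖a‖ₑ ^ 2 + 2 * ‖b‖ₑ ^ 2 := by
  rw [← ofReal_norm, ← ofReal_norm, ← ofReal_norm, ← ENNReal.ofReal_pow (norm_nonneg _),
    ← ENNReal.ofReal_pow (norm_nonneg _), ← ENNReal.ofReal_pow (norm_nonneg _),
    show (2 : ℝ≥0∞) = ENNReal.ofReal 2 by simp, ← ENNReal.ofReal_mul (by norm_num),
    ← ENNReal.ofReal_mul (by norm_num), ← ENNReal.ofReal_add (by positivity) (by positivity)]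
  apply ENNReal.ofReal_le_ofReal
  nlinarith [norm_add_le a b, sq_nonneg (‖a‖ - ‖b‖), norm_nonneg (a + b)]

/-- `∫ |e^{2π i s x} - 1|² |h|²`. -/
def dif (s : ℝ) (h : ℝ → ℂ) : ℝ≥0∞ := ∫⁻ x, ‖dsym s x‖ₑ ^ 2 * ‖h x‖ₑ ^ 2

lemma lintegral_mulL_dsym (s : ℝ) (h : L2R) : ∫⁻ x, ‖mulL (dsym s) h x‖ₑ ^ 2 = dif s h := by
  refine lintegral_congr_ae ?_
  filter_upwards [(bddMeas_dsym s).coeFn h] with x hx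
  rw [hx, enorm_mul, mul_pow]

/-- Commute the difference operator past the sign multiplier, which is a contraction of L², and pay
for the commutator with the low-frequency mass. -/
lemma dif_sign_le (s : ℝ) (h : L2R) : dif s (FM sg h) ≤ 2 * dif s h + 8 * low s (𝓕 h : L2R) := by
  rw [← lintegral_mulL_dsym, ← lintegral_mulL_dsym]
  set k := mulL (dsym s) (FM sg h)
  set g := FM sg (mulL (dsym s) h) with hg
  have hgm : Measurable (g : ℝ → ℂ) := (Lp.stronglyMeasurable g).measurable
  calc ∫⁻ x, ‖k x‖ₑ ^ 2 ≤ ∫⁻ x, (2 * ‖g x‖ₑ ^ 2 + 2 * ‖(k - g : L2R) x‖ₑ ^ 2) := by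
        refine lintegral_mono_ae ?_
        filter_upwards [Lp.coeFn_sub k g] with x hx
        have : k x = g x + (k - g : L2R) x := by rw [hx, Pi.sub_apply]; ring
        rw [this]; exact enorm_add_sq_le _ _
    _ = 2 * (∫⁻ x, ‖g x‖ₑ ^ 2) + 2 * ∫⁻ x, ‖(k - g : L2R) x‖ₑ ^ 2 := by
        rw [lintegral_add_left (by fun_prop), lintegral_const_mul' _ _ (by simp),
          lintegral_const_mul' _ _ (by simp)]
    _ ≤ 2 * (∫⁻ x, ‖mulL (dsym s) h x‖ₑ ^ 2) + 2 * (4 * low s (𝓕 h : L2R)) := by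
        exact add_le_add (mul_le_mul_right (bddMeas_sg.lintegral_FM_le norm_sg_le _) _)
          (mul_le_mul_right (lintegral_commutator_le s h) _)
    _ = _ := by ring

/-- `∫ |x|^{2α} |h|²`. -/
def hsq (α : ℝ) (h : ℝ → ℂ) : ℝ≥0∞ := ∫⁻ x, pw (2 * α) x * ‖h x‖ₑ ^ 2

lemma hsq_congr {α : ℝ} {h k : ℝ → ℂ} (e : h =ᵐ[volume] k) : hsq α h = hsq α k :=
  lintegral_congr_ae (by filter_upwards [e] with x hx; rw [hx])

lemma hsq_le_wsq {α : ℝ} (hα : 0 ≤ α) (h : ℝ → ℂ) : hsq α h ≤ wsq α h :=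
  lintegral_mono fun x => by gcongr; exact pw_le_wt hα x

lemma wsq_le_hsq {θ : ℝ} (hθ : 0 ≤ θ) (h : L2R) :
    wsq θ h ≤ ENNReal.ofReal (2 ^ θ) * ((∫⁻ x, ‖h x‖ₑ ^ 2) + hsq θ h) := by
  have hm : Measurable (h : ℝ → ℂ) := (Lp.stronglyMeasurable h).measurable
  rw [hsq, ← lintegral_add_left (by fun_prop), ← lintegral_const_mul' _ _ ENNReal.ofReal_ne_top]
  refine lintegral_mono fun x => ?_
  calc _ ≤ ENNReal.ofReal (2 ^ θ) * (1 + pw (2 * θ) x) * ‖h x‖ₑ ^ 2 := by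
        gcongr; exact wt_le_pw hθ x
    _ = _ := by ring

/-- The constant `∫ |u|^{-1-2α} |e^{2π i u} - 1|² du`. -/
def difConst (α : ℝ) : ℝ≥0∞ := ∫⁻ u, pw (-1 - 2 * α) u * ‖dsym 1 u‖ₑ ^ 2

lemma measurable_dsym : Measurable fun p : ℝ × ℝ => dsym p.1 p.2 := by unfold dsym; fun_prop

/-- Tonelli and the scaling u = s x. On the Fourier side this is the Gagliardo form of the
homogeneous Sobolev norm of order α, and it lets a weight in x be studied through difference
operators. -/
lemma lintegral_pw_mul_dif (α : ℝ) (h : L2R) :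
    ∫⁻ s, pw (-1 - 2 * α) s * dif s h = difConst α * hsq α h := by
  have hm : Measurable (h : ℝ → ℂ) := (Lp.stronglyMeasurable h).measurable
  have hd := measurable_dsym
  have hd1 : ∀ s, Measurable (dsym s) := fun s => (bddMeas_dsym s).meas
  have hd2 : ∀ x, Measurable fun s => dsym s x := fun x => by unfold dsym; fun_prop
  have e : ∀ s, pw (-1 - 2 * α) s * dif s h
      = ∫⁻ x, pw (-1 - 2 * α) s * (‖dsym s x‖ₑ ^ 2 * ‖h x‖ₑ ^ 2) := by
    intro s
    have := hd1 s
    rw [dif, lintegral_const_mul _ (by fun_prop)]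
  simp_rw [e]
  rw [lintegral_lintegral_swap (by fun_prop), hsq, ← lintegral_const_mul _ (by fun_prop)]
  apply lintegral_congr_ae
  filter_upwards [ae_ne_zero] with x hx
  have h1 := lintegral_pw_mul_comp (-1 - 2 * α) (f := fun u => ‖dsym 1 u‖ₑ ^ 2)
    (by have := hd1 1; fun_prop) hx
  simp only [dsym_one_mul] at h1
  simp_rw [← mul_assoc]
  have := hd2 x
  rw [lintegral_mul_const _ (by fun_prop), h1, ← difConst,
    show -(-1 - 2 * α) - 1 = 2 * α by ring, mul_comm (pw _ _)]

/-! ### Hardy type inequalities -/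

/-- The difference symbol is O(|u|) at the origin, which needs α < 1, and bounded at infinity, which
needs α > 0. -/
lemma difConst_lt_top {α : ℝ} (h0 : 0 < α) (h1 : α < 1) : difConst α < ∞ := by
  have key : difConst α ≤ ENNReal.ofReal ((2 * Real.pi) ^ 2) *
      ∫⁻ u, min (pw (1 - 2 * α) u) (pw (-1 - 2 * α) u) := by
    rw [difConst, ← lintegral_const_mul' _ _ ENNReal.ofReal_ne_top]
    refine lintegral_mono_ae ?_
    filter_upwards [ae_ne_zero] with u hu
    rw [mul_min]
    refine le_min ?_ ?_
    · rw [show (1 - 2 * α) = (-1 - 2 * α) + 2 * 1 by ring, pw_add _ _ hu, ← pw_sq, mul_left_comm]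
      gcongr
      rw [← ofReal_norm, ← ENNReal.ofReal_pow (norm_nonneg _), pw, Real.rpow_one,
        ← ENNReal.ofReal_pow (abs_nonneg _), ← ENNReal.ofReal_mul (by positivity), ← mul_pow]
      gcongr
      simpa using norm_dsym_le 1 u
    · rw [mul_comm]
      gcongr
      rw [← ofReal_norm, ← ENNReal.ofReal_pow (norm_nonneg _)]
      gcongr
      exact (norm_dsym_le_two 1 u).trans (by linarith [Real.pi_gt_three])
  exact key.trans_lt (ENNReal.mul_lt_top ENNReal.ofReal_lt_top
    (lintegral_min_pw_lt_top (by linarith) (by linarith)))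

/-- Otherwise e^{2πiu} = 1 for almost every u in (0, 1), whereas equality holds only at integers.
Needed in order to divide by the constant. -/
lemma difConst_ne_zero (α : ℝ) : difConst α ≠ 0 := by
  intro h
  have hm := (bddMeas_dsym 1).meas
  rw [difConst, lintegral_eq_zero_iff (by fun_prop)] at h
  have h2 : ∀ᵐ u : ℝ, u ∉ Set.Ioo (0 : ℝ) 1 := by
    filter_upwards [h] with u hu hmem
    simp only [Pi.zero_apply, mul_eq_zero, pow_eq_zero_iff, ne_eq, OfNat.ofNat_ne_zero,
      not_false_eq_true, enorm_eq_zero] at hu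
    rcases hu with hu | hu
    · rw [pw, ENNReal.ofReal_eq_zero] at hu
      exact absurd hu (not_le.2 (Real.rpow_pos_of_pos (abs_pos.2 hmem.1.ne') _))
    · rw [dsym, sub_eq_zero, Complex.exp_eq_one_iff] at hu
      obtain ⟨n, hn⟩ := hu
      have hpi : (Real.pi : ℂ) ≠ 0 := by exact_mod_cast Real.pi_ne_zero
      have h3 : (u : ℂ) = n := by
        have h4 : (2 * Real.pi * Complex.I : ℂ) * u = (2 * Real.pi * Complex.I) * n := by
          push_cast at hn ⊢; linear_combination hn
        exact mul_left_cancel₀ (by simp [hpi]) h4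
      have h5 : u = (n : ℝ) := by exact_mod_cast h3
      have h6 : (0 : ℝ) < n ∧ (n : ℝ) < 1 := by rw [← h5]; exact hmem
      have h7 : (0 : ℤ) < n ∧ n < 1 := by exact_mod_cast h6
      omega
  rw [ae_iff] at h2
  simp only [not_not, Set.ofPred_mem_eq, Real.volume_Ioo] at h2
  norm_num at h2

/-- `∫ |s|^{-1-2α} ∫_{|v| ≤ |s|} |φ|² dv ds`. -/
def lowInt (α : ℝ) (φ : ℝ → ℂ) : ℝ≥0∞ := ∫⁻ s, pw (-1 - 2 * α) s * low s φ

lemma measurable_coe (h : L2R) : Measurable (h : ℝ → ℂ) := (Lp.stronglyMeasurable h).measurable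

/-- The kernel `min(1, |u|)`. -/
def cutoffMin (u : ℝ) : ℝ≥0∞ := min (pw 0 u) (pw 1 u)

@[fun_prop]
lemma measurable_cutoffMin : Measurable cutoffMin := by unfold cutoffMin; fun_prop

/-- A vanishing mean allows the kernel e^{-2πixv} to be replaced by e^{-2πixv} - 1, which is at most
2π min(1, |sx|) for |v| ≤ |s|. -/
lemma enorm_fourier_le_of_integral_eq_zero {h : ℝ → ℂ} (hi : Integrable h) (h0 : ∫ x, h x = 0)
    {v s : ℝ} (hv : |v| ≤ |s|) :
    ‖𝓕 h v‖ₑ ≤ ENNReal.ofReal (2 * Real.pi) * ∫⁻ x, cutoffMin (s * x) * ‖h x‖ₑ := by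
  have e : 𝓕 h v = ∫ x, dsym (-v) x * h x := by
    have h1 : Integrable fun x : ℝ => Complex.exp ((-2 * Real.pi * x * v : ℝ) * Complex.I) * h x :=
      hi.bdd_mul (c := 1) (by fun_prop) (Eventually.of_forall fun x => by
        rw [Complex.norm_exp_ofReal_mul_I])
    rw [Real.fourier_real_eq_integral_exp_smul, ← sub_zero (∫ x, _), ← h0]
    simp_rw [smul_eq_mul]
    rw [← integral_sub h1 hi]
    congr 1; ext x
    rw [dsym, sub_mul, one_mul]
    congr 3; push_cast; ring
  rw [e]
  refine (enorm_integral_le_lintegral_enorm _).trans ?_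
  rw [← lintegral_const_mul' _ _ ENNReal.ofReal_ne_top]
  refine lintegral_mono fun x => ?_
  rw [enorm_mul, ← mul_assoc]
  gcongr
  rw [cutoffMin, mul_min, pw_zero, mul_one, pw, Real.rpow_one,
    ← ENNReal.ofReal_mul Real.two_pi_pos.le, ← ofReal_norm]
  refine le_min ?_ ?_ <;> apply ENNReal.ofReal_le_ofReal
  · exact (norm_dsym_le_two _ _).trans (by linarith [Real.pi_gt_three])
  · refine (norm_dsym_le _ _).trans ?_
    rw [abs_neg, abs_mul]
    gcongr

/-- Schur's test for the kernel |u|^{-α} J(u) and the function |x|^α |h|: the factor |sx|^{-α}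
splits into the outer weight in s and the cancellation of |x|^α. -/
lemma lintegral_schur_pw {α : ℝ} {J : ℝ → ℝ≥0∞} (hJ : Measurable J) (h : L2R) :
    ∫⁻ s, pw (-2 * α) s * (∫⁻ x, J (s * x) * ‖h x‖ₑ) ^ 2
      ≤ (∫⁻ u, pw (-1 / 2) u * (pw (-α) u * J u)) ^ 2 * hsq α h := by
  have hm := measurable_coe h
  have h1 := schur_test (J := fun u => pw (-α) u * J u) (g := fun x => pw α x * ‖h x‖ₑ)
    (by fun_prop) (by fun_prop)
  simp only [mul_pow, pw_sq] at h1
  refine le_trans (le_of_eq ?_) h1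
  congr 1; ext s
  rw [show -2 * α = 2 * (-α) by ring, ← pw_sq, ← mul_pow, ← lintegral_const_mul _ (by fun_prop)]
  congr 1
  apply lintegral_congr_ae
  filter_upwards [ae_ne_zero] with x hx
  rw [pw_mul, show pw (-α) s * pw (-α) x * J (s * x) * (pw α x * ‖h x‖ₑ)
    = (pw (-α) x * pw α x) * (pw (-α) s * (J (s * x) * ‖h x‖ₑ)) by ring, pw_neg_mul_self _ hx,
    one_mul]

/-- Hardy's inequality for functions of mean zero. -/
lemma exists_lowInt_le_of_integral_eq_zero {α : ℝ} (h0 : 1 / 2 < α) (h1 : α < 3 / 2) :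
    ∃ C : ℝ≥0, ∀ h : L2R, Integrable (h : ℝ → ℂ) → ∫ x, h x = 0 →
      lowInt α (𝓕 h : L2R) ≤ C * hsq α h := by
  set A := ∫⁻ u, pw (-1 / 2) u * (pw (-α) u * cutoffMin u) with hA
  -- The exponent at the origin is 1/2 - α, above -1 because α < 3/2; at infinity it is -1/2 - α,
  -- below -1 because α > 1/2.
  have hAt : A < ∞ := by
    refine lt_of_le_of_lt (lintegral_mono_ae ?_) (lintegral_min_pw_lt_top
      (p := -1 / 2 + (-α + 1)) (q := -1 / 2 + (-α + 0)) (by linarith) (by linarith))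
    filter_upwards [ae_ne_zero] with u hu
    rw [pw_add _ _ hu, pw_add _ _ hu, pw_add _ _ hu, pw_add _ _ hu, cutoffMin, ← mul_assoc,
      ← mul_assoc, ← mul_assoc, ← mul_min, min_comm]
  set D := 2 * ENNReal.ofReal (2 * Real.pi) ^ 2 * A ^ 2 with hD
  have hDt : D ≠ ∞ := by
    have := hAt.ne
    finiteness
  refine ⟨D.toNNReal, fun h hi hz => ?_⟩
  rw [ENNReal.coe_toNNReal hDt]
  have hm := measurable_coe h
  set G : ℝ → ℝ≥0∞ := fun s => ∫⁻ x, cutoffMin (s * x) * ‖h x‖ₑ with hG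
  -- A uniform bound on |v| ≤ |s| times the length 2|s|, which later turns |s|^{-1-2α} into the
  -- |s|^{-2α} of the Schur estimate.
  have h2 : ∀ s, low s (𝓕 h : L2R)
      ≤ (ENNReal.ofReal (2 * Real.pi) * G s) ^ 2 * ENNReal.ofReal (2 * |s|) := by
    intro s
    rw [← volume_abs_le, ← setLIntegral_const, low]
    refine lintegral_mono_ae ?_
    filter_upwards [ae_restrict_mem (measurableSet_abs_le s),
      ae_restrict_of_ae (coe_fourier_ae_eq_integral h hi)] with v hv he
    rw [he]
    gcongr
    exact enorm_fourier_le_of_integral_eq_zero hi hz hv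
  have h3 : lowInt α (𝓕 h : L2R)
      ≤ ∫⁻ s, 2 * ENNReal.ofReal (2 * Real.pi) ^ 2 * (pw (-2 * α) s * G s ^ 2) := by
    refine lintegral_mono_ae ?_
    filter_upwards [ae_ne_zero] with s hs
    refine (mul_le_mul_right (h2 s) _).trans_eq ?_
    have e : ENNReal.ofReal (2 * |s|) = 2 * pw 1 s := by
      rw [pw, Real.rpow_one, ENNReal.ofReal_mul (by norm_num)]; simp
    rw [e, show (-2 * α) = (-1 - 2 * α) + 1 by ring, pw_add _ _ hs]
    ring
  refine h3.trans ?_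
  rw [lintegral_const_mul' _ _ (by finiteness)]
  refine (mul_le_mul_right (lintegral_schur_pw measurable_cutoffMin h) _).trans_eq ?_
  rw [hD, hA]; ring

/-- The kernel `1_{|u| ≤ 1}`. -/
def ind (u : ℝ) : ℝ≥0∞ := ({u : ℝ | |u| ≤ 1} : Set ℝ).indicator 1 u

lemma measurableSet_abs_le_one : MeasurableSet {u : ℝ | |u| ≤ 1} :=
  measurableSet_le (by fun_prop) (by fun_prop)

@[fun_prop]
lemma measurable_ind : Measurable ind :=
  measurable_one.indicator measurableSet_abs_le_one

/-- The kernel `1_{|u| > 1}`. -/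
def indc (u : ℝ) : ℝ≥0∞ := ({u : ℝ | |u| ≤ 1}ᶜ : Set ℝ).indicator 1 u

@[fun_prop]
lemma measurable_indc : Measurable indc :=
  measurable_one.indicator measurableSet_abs_le_one.compl

/-- Cut h at |x| = 1/|s|. The inner part is integrable, so its transform is bounded pointwise and
the frequency interval contributes its length; the outer part is handled by Plancherel. -/
lemma low_le_split (h : L2R) {s : ℝ} (hs : s ≠ 0) :
    low s (𝓕 h : L2R) ≤ 4 * pw 1 s * (∫⁻ x, ind (s * x) * ‖h x‖ₑ) ^ 2
      + 2 * ∫⁻ x, indc (s * x) * ‖h x‖ₑ ^ 2 := by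
  have hm := measurable_coe h
  let E : Set ℝ := {x | |s * x| ≤ 1}
  have hE : MeasurableSet E := measurableSet_le (by fun_prop) (by fun_prop)
  have hEv : volume E < ∞ := by
    have : E ⊆ Set.Icc (-|s|⁻¹) |s|⁻¹ := by
      intro x hx
      have hx' : |s| * |x| ≤ 1 := by rw [← abs_mul]; exact hx
      rw [Set.mem_Icc, ← abs_le, ← one_div, le_div_iff₀ (abs_pos.2 hs)]
      linarith
    exact (measure_mono this).trans_lt (by simp)
  have hb : MemLp (fun x => E.indicator (h : ℝ → ℂ) x) 2 volume := (Lp.memLp h).indicator hE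
  have hb' : MemLp (fun x => Eᶜ.indicator (h : ℝ → ℂ) x) 2 volume := (Lp.memLp h).indicator hE.compl
  set h1 := hb.toLp
  set h2 := hb'.toLp
  have hsum : h = h1 + h2 := by
    apply Lp.ext
    filter_upwards [Lp.coeFn_add h1 h2, hb.coeFn_toLp, hb'.coeFn_toLp] with x e1 e2 e3
    rw [e1, Pi.add_apply, e2, e3]
    by_cases hx : x ∈ E <;> simp [hx]
  have hi : Integrable (E.indicator (h : ℝ → ℂ)) := by
    rw [integrable_indicator_iff hE]
    have : IsFiniteMeasure (volume.restrict E) := ⟨by simpa using hEv⟩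
    exact ((Lp.memLp h).restrict E).integrable (by norm_num)
  have hF : (𝓕 h1 : L2R) =ᵐ[volume] 𝓕 (E.indicator (h : ℝ → ℂ)) := fourier_toLp_ae_eq hi hb
  set G := ∫⁻ x, ind (s * x) * ‖h x‖ₑ
  have hG : ∀ v, ‖𝓕 (E.indicator (h : ℝ → ℂ)) v‖ₑ ≤ G := by
    intro v
    rw [Real.fourier_real_eq]
    refine (enorm_integral_le_lintegral_enorm _).trans (lintegral_mono fun x => ?_)
    have : ‖Real.fourierChar (-(x * v)) • E.indicator (h : ℝ → ℂ) x‖ₑ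
      = ‖E.indicator (h : ℝ → ℂ) x‖ₑ := by
      rw [← ofReal_norm, ← ofReal_norm, Circle.norm_smul]
    rw [this]
    by_cases hx : x ∈ E
    · have : ind (s * x) = 1 := Set.indicator_of_mem (show s * x ∈ {u : ℝ | |u| ≤ 1} from hx) _
      simp [hx, this]
    · simp [hx]
  have hadd : 𝓕 h = (𝓕 h1 + 𝓕 h2 : L2R) := by rw [hsum, FourierTransform.fourier_add]
  have hle : low s (𝓕 h : L2R) ≤ ∫⁻ v in {v | |v| ≤ |s|}, (2 * G ^ 2 + 2 * ‖(𝓕 h2 : L2R) v‖ₑ ^ 2) := by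
    refine lintegral_mono_ae (ae_restrict_of_ae ?_)
    rw [hadd]
    filter_upwards [Lp.coeFn_add (𝓕 h1) (𝓕 h2 : L2R), hF] with v e1 e2
    rw [e1, Pi.add_apply, e2]
    refine (enorm_add_sq_le _ _).trans ?_
    gcongr
    exact hG v
  refine hle.trans ?_
  rw [lintegral_add_left (by fun_prop), setLIntegral_const, volume_abs_le,
    lintegral_const_mul' _ _ (by simp)]
  have e3 : ENNReal.ofReal (2 * |s|) = 2 * pw 1 s := by
    rw [pw, Real.rpow_one, ENNReal.ofReal_mul (by norm_num)]; simp
  have e4 : ∫⁻ v in {v | |v| ≤ |s|}, ‖(𝓕 h2 : L2R) v‖ₑ ^ 2 ≤ ∫⁻ x, indc (s * x) * ‖h x‖ₑ ^ 2 := by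
    refine (setLIntegral_le_lintegral _ _).trans ?_
    rw [lintegral_coe_fourier_sq]
    refine lintegral_mono_ae ?_
    filter_upwards [hb'.coeFn_toLp] with x hx
    rw [hx]
    by_cases hxE : x ∈ E
    · simp [hxE]
    · have : indc (s * x) = 1 :=
        Set.indicator_of_mem (show s * x ∈ ({u : ℝ | |u| ≤ 1}ᶜ : Set ℝ) from hxE) _
      simp [hxE, this]
  refine add_le_add (le_of_eq ?_) (mul_le_mul_right e4 2)
  rw [e3]; ring

/-- Hardy's inequality below the critical exponent. -/
lemma exists_lowInt_le {α : ℝ} (h0 : 0 < α) (h1 : α < 1 / 2) :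
    ∃ C : ℝ≥0, ∀ h : L2R, lowInt α (𝓕 h : L2R) ≤ C * hsq α h := by
  set A := ∫⁻ u, pw (-1 / 2) u * (pw (-α) u * ind u) with hA
  set B := ∫⁻ u, pw (-1 - 2 * α) u * indc u with hB
  -- Here α < 1/2 is used: the exponent -1/2 - α must exceed -1 at the origin. The kernel vanishes
  -- for |u| > 1, and -2 is just some exponent below -1.
  have hAt : A < ∞ := by
    refine lt_of_le_of_lt (lintegral_mono_ae ?_) (lintegral_min_pw_lt_top
      (p := -1 / 2 + -α) (q := -2) (by linarith) (by norm_num))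
    filter_upwards [ae_ne_zero] with u hu
    by_cases hu1 : |u| ≤ 1
    · have : ind u = 1 := Set.indicator_of_mem (show u ∈ {u : ℝ | |u| ≤ 1} from hu1) _
      rw [this, mul_one, ← pw_add _ _ hu]
      refine le_min le_rfl ?_
      rw [pw, pw]
      exact ENNReal.ofReal_le_ofReal
        (Real.rpow_le_rpow_of_exponent_ge (abs_pos.2 hu) hu1 (by linarith))
    · have : ind u = 0 := Set.indicator_of_notMem (show u ∉ {u : ℝ | |u| ≤ 1} from hu1) _
      rw [this]; simp
  -- The kernel lives on |u| > 1, where integrability of |u|^{-1-2α} needs α > 0.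
  have hBt : B < ∞ := by
    refine lt_of_le_of_lt (lintegral_mono_ae ?_) (lintegral_min_pw_lt_top
      (p := 0) (q := -1 - 2 * α) (by linarith) (by linarith))
    filter_upwards [ae_ne_zero] with u hu
    by_cases hu1 : |u| ≤ 1
    · have : indc u = 0 := Set.indicator_of_notMem
        (show u ∉ ({u : ℝ | |u| ≤ 1}ᶜ : Set ℝ) from fun h => h hu1) _
      rw [this]; simp
    · have : indc u = 1 := Set.indicator_of_mem
        (show u ∈ ({u : ℝ | |u| ≤ 1}ᶜ : Set ℝ) from hu1) _
      rw [this, mul_one]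
      refine le_min ?_ le_rfl
      rw [pw, pw]
      exact ENNReal.ofReal_le_ofReal
        (Real.rpow_le_rpow_of_exponent_le (not_le.1 hu1).le (by linarith))
  have hDt : 4 * A ^ 2 + 2 * B ≠ ∞ := by
    have := hAt.ne
    have := hBt.ne
    finiteness
  refine ⟨(4 * A ^ 2 + 2 * B).toNNReal, fun h => ?_⟩
  rw [ENNReal.coe_toNNReal hDt]
  have hm := measurable_coe h
  have h2 : lowInt α (𝓕 h : L2R) ≤ ∫⁻ s, (4 * (pw (-2 * α) s * (∫⁻ x, ind (s * x) * ‖h x‖ₑ) ^ 2)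
      + 2 * (pw (-1 - 2 * α) s * ∫⁻ x, indc (s * x) * ‖h x‖ₑ ^ 2)) := by
    refine lintegral_mono_ae ?_
    filter_upwards [ae_ne_zero] with s hs
    refine (mul_le_mul_right (low_le_split h hs) _).trans_eq ?_
    rw [show (-2 * α) = (-1 - 2 * α) + 1 by ring, pw_add _ _ hs]
    ring
  have h3 : ∫⁻ s, pw (-1 - 2 * α) s * ∫⁻ x, indc (s * x) * ‖h x‖ₑ ^ 2 = B * hsq α h := by
    have e : ∀ s, pw (-1 - 2 * α) s * ∫⁻ x, indc (s * x) * ‖h x‖ₑ ^ 2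
        = ∫⁻ x, pw (-1 - 2 * α) s * (indc (s * x) * ‖h x‖ₑ ^ 2) := by
      intro s
      rw [lintegral_const_mul _ (by fun_prop)]
    simp_rw [e]
    rw [lintegral_lintegral_swap (by fun_prop), hsq, ← lintegral_const_mul _ (by fun_prop)]
    apply lintegral_congr_ae
    filter_upwards [ae_ne_zero] with x hx
    have h1 := lintegral_pw_mul_comp (-1 - 2 * α) (f := indc) (by fun_prop) hx
    simp_rw [← mul_assoc]
    rw [lintegral_mul_const _ (by fun_prop), h1, ← hB,
      show -(-1 - 2 * α) - 1 = 2 * α by ring, mul_comm (pw _ _)]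
  have hmeas : Measurable fun s => ∫⁻ x, ind (s * x) * ‖h x‖ₑ := by
    have : Measurable fun p : ℝ × ℝ => ind (p.1 * p.2) * ‖h p.2‖ₑ := by fun_prop
    exact this.lintegral_prod_right'
  refine h2.trans ?_
  rw [lintegral_add_left (by fun_prop), lintegral_const_mul' _ _ (by simp),
    lintegral_const_mul' _ _ (by simp), h3, add_mul, mul_assoc, mul_assoc]
  gcongr
  exact lintegral_schur_pw measurable_ind h

/-! ### The sign multiplier on weighted spaces -/

/-- Integrate `dif_sign_le` against |s|^{-1-2α} and divide by `difConst α`. The assumption on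
`lowInt` is the Hardy inequality, which alone depends on the side of 1/2 where α lies. -/
lemma hsq_sign_le_of_lowInt_le {α : ℝ} (h0 : 0 < α) (h1 : α < 1) {C : ℝ≥0} {h : L2R}
    (hC : lowInt α (𝓕 h : L2R) ≤ C * hsq α h) :
    hsq α (FM sg h) ≤ (2 + 8 * C * (difConst α)⁻¹) * hsq α h := by
  have hc0 := difConst_ne_zero α
  have hct := (difConst_lt_top h0 h1).ne
  have hm := measurable_coe h
  have hdm : Measurable fun s => dif s h := by
    have hd := measurable_dsym
    have h2 : Measurable fun p : ℝ × ℝ => ‖dsym p.1 p.2‖ₑ ^ 2 * ‖h p.2‖ₑ ^ 2 := by fun_prop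
    exact h2.lintegral_prod_right'
  have key : difConst α * hsq α (FM sg h) ≤ 2 * (difConst α * hsq α h) + 8 * (C * hsq α h) := by
    rw [← lintegral_pw_mul_dif, ← lintegral_pw_mul_dif]
    calc _ ≤ ∫⁻ s, (2 * (pw (-1 - 2 * α) s * dif s h) + 8 * (pw (-1 - 2 * α) s * low s (𝓕 h : L2R))) := by
          refine lintegral_mono fun s => ?_
          refine (mul_le_mul_right (dif_sign_le s h) _).trans_eq ?_
          ring
      _ = 2 * (∫⁻ s, pw (-1 - 2 * α) s * dif s h) + 8 * lowInt α (𝓕 h : L2R) := by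
          rw [lintegral_add_left (by fun_prop), lintegral_const_mul' _ _ (by simp),
            lintegral_const_mul' _ _ (by simp), lowInt]
      _ ≤ _ := by gcongr
  calc hsq α (FM sg h) = (difConst α)⁻¹ * (difConst α * hsq α (FM sg h)) := by
        rw [← mul_assoc, ENNReal.inv_mul_cancel hc0 hct, one_mul]
    _ ≤ (difConst α)⁻¹ * (2 * (difConst α * hsq α h) + 8 * (C * hsq α h)) := by gcongr
    _ = 2 * ((difConst α)⁻¹ * difConst α) * hsq α h + 8 * C * (difConst α)⁻¹ * hsq α h := by ring
    _ = _ := by rw [ENNReal.inv_mul_cancel hc0 hct]; ring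

/-! ### Commuting powers of `x` with the sign multiplier -/

lemma memLp_of_lintegral_sq_lt_top {u : ℝ → ℂ} (hu : AEStronglyMeasurable u)
    (h : ∫⁻ x, ‖u x‖ₑ ^ 2 < ∞) : MemLp u 2 volume := by
  refine ⟨hu, ?_⟩
  rw [eLpNorm_lt_top_iff_lintegral_rpow_enorm_lt_top (by simp) (by simp)]
  simpa using h

lemma memLp_pow_mul {n : ℕ} {h : L2R} (hw : wsq n h < ∞) :
    MemLp (fun x : ℝ => (x : ℂ) ^ n * h x) 2 volume := by
  refine memLp_of_lintegral_sq_lt_top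
    ((by fun_prop : Continuous fun x : ℝ => (x : ℂ) ^ n).aestronglyMeasurable.mul
      (Lp.aestronglyMeasurable h)) (lt_of_le_of_lt (lintegral_mono fun x => ?_) hw)
  rw [enorm_mul, mul_pow]
  gcongr
  exact enorm_pow_sq_le_wt n x

lemma tendsto_of_lintegral_sub_sq {f : ℕ → L2R} {g : L2R}
    (h : Tendsto (fun n => ∫⁻ x, ‖(f n - g : L2R) x‖ₑ ^ 2) atTop (𝓝 0)) :
    Tendsto f atTop (𝓝 g) := by
  rw [tendsto_iff_edist_tendsto_0]
  have h2 := (ENNReal.continuous_rpow_const (y := 1 / 2)).tendsto 0 |>.comp h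
  rw [ENNReal.zero_rpow_of_pos (by norm_num)] at h2
  refine h2.congr fun n => ?_
  rw [Function.comp_apply, ← enorm_sq_eq_lintegral, ← ENNReal.rpow_natCast, ← ENNReal.rpow_mul,
    edist_eq_enorm_sub]
  norm_num

/-- The low-frequency mass increases with s, so it is at most its average over (s, 2s], where r^{-3}
≥ (2s)^{-3}; the length s of the interval leaves 8s². When `lowInt 1` is finite this gives o(s²) as
s tends to 0. -/
lemma low_le_lintegral {s : ℝ} (hs : 0 < s) (φ : ℝ → ℂ) :
    low s φ ≤ ENNReal.ofReal (8 * s ^ 2) *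
      ∫⁻ r in Set.Ioc s (2 * s), pw (-1 - 2 * 1) r * low r φ := by
  have h1 : pw (-1 - 2 * 1) (2 * s) * low s φ * ENNReal.ofReal s
      ≤ ∫⁻ r in Set.Ioc s (2 * s), pw (-1 - 2 * 1) r * low r φ := by
    have hv : volume (Set.Ioc s (2 * s)) = ENNReal.ofReal s := by
      rw [Real.volume_Ioc]; congr 1; ring
    rw [← hv, ← setLIntegral_const]
    refine setLIntegral_mono' measurableSet_Ioc fun r hr => ?_
    have hr0 : 0 < r := hs.trans hr.1
    gcongr
    · rw [pw, pw]
      apply ENNReal.ofReal_le_ofReal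
      rw [abs_of_pos hr0, abs_of_pos (by linarith)]
      exact Real.rpow_le_rpow_of_nonpos hr0 hr.2 (by norm_num)
    · exact low_mono (by rw [abs_of_pos hs, abs_of_pos hr0]; exact hr.1.le) φ
  refine le_trans (le_of_eq ?_) (mul_le_mul_right h1 _)
  have : ENNReal.ofReal (8 * s ^ 2) * (pw (-1 - 2 * 1) (2 * s) * ENNReal.ofReal s) = 1 := by
    rw [pw, ← ENNReal.ofReal_mul (by positivity), ← ENNReal.ofReal_mul (by positivity),
      abs_of_pos (by linarith), show (-1 - 2 * 1 : ℝ) = ((-3 : ℤ) : ℝ) by norm_num,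
      Real.rpow_intCast, ← ENNReal.ofReal_one]
    congr 1
    rw [zpow_neg]
    norm_cast
    field_simp
    norm_num
  calc low s φ = (ENNReal.ofReal (8 * s ^ 2) * (pw (-1 - 2 * 1) (2 * s) * ENNReal.ofReal s)) *
        low s φ := by rw [this, one_mul]
    _ = _ := by ring

lemma tendsto_dsym_div (x : ℝ) :
    Tendsto (fun s : ℝ => (s : ℂ)⁻¹ * dsym s x) (𝓝[≠] 0) (𝓝 (2 * Real.pi * Complex.I * x)) := by
  have h : HasDerivAt (fun s : ℝ => Complex.exp (s * (2 * Real.pi * Complex.I * x)))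
      (2 * Real.pi * Complex.I * x) 0 := by
    have h1 : HasDerivAt (fun s : ℝ => (s : ℂ) * (2 * Real.pi * Complex.I * x))
        (2 * Real.pi * Complex.I * x) 0 := by
      simpa using (Complex.ofRealCLM.hasDerivAt (x := 0)).mul_const (2 * Real.pi * Complex.I * x)
    simpa using h1.cexp
  have h2 := hasDerivAt_iff_tendsto_slope_zero.1 h
  refine h2.congr fun s => ?_
  simp only [zero_add, Complex.ofReal_zero, zero_mul, Complex.exp_zero, dsym, Complex.real_smul,
    Complex.ofReal_inv]
  congr 3
  ring

/-- A sequence of positive reals tending to `0`. -/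
def sseq (n : ℕ) : ℝ := 1 / ((n : ℝ) + 1)

lemma sseq_pos (n : ℕ) : 0 < sseq n := Nat.one_div_pos_of_nat

lemma tendsto_sseq : Tendsto sseq atTop (𝓝 0) := tendsto_one_div_add_atTop_nhds_zero_nat

lemma tendsto_sseq' : Tendsto sseq atTop (𝓝[≠] 0) :=
  tendsto_nhdsWithin_iff.2 ⟨tendsto_sseq, Eventually.of_forall fun n => (sseq_pos n).ne'⟩

/-- Dominated convergence: the quotient symbols are bounded by 2π|x| and tend to 2πix. -/
lemma tendsto_difference_quotient {h : L2R} (hw : wsq 1 h < ∞) :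
    Tendsto (fun n => ((sseq n : ℂ)⁻¹) • mulL (dsym (sseq n)) h) atTop
      (𝓝 ((2 * Real.pi * Complex.I : ℂ) • mulL (fun x => (x : ℂ) ^ 1) h)) := by
  have hm := measurable_coe h
  have hX := coeFn_mulL (memLp_pow_mul (n := 1) (h := h) (by exact_mod_cast hw))
  refine tendsto_of_lintegral_sub_sq ?_
  set F : ℕ → ℝ → ℝ≥0∞ := fun n x =>
    ‖((sseq n : ℂ)⁻¹ * dsym (sseq n) x - 2 * Real.pi * Complex.I * x) * h x‖ₑ ^ 2 with hF
  have e : ∀ n, ∫⁻ x, ‖(((sseq n : ℂ)⁻¹) • mulL (dsym (sseq n)) h -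
      (2 * Real.pi * Complex.I : ℂ) • mulL (fun x => (x : ℂ) ^ 1) h : L2R) x‖ₑ ^ 2
      = ∫⁻ x, F n x := by
    intro n
    apply lintegral_congr_ae
    filter_upwards [Lp.coeFn_sub (((sseq n : ℂ)⁻¹) • mulL (dsym (sseq n)) h)
      ((2 * Real.pi * Complex.I : ℂ) • mulL (fun x => (x : ℂ) ^ 1) h), hX,
      Lp.coeFn_smul ((sseq n : ℂ)⁻¹) (mulL (dsym (sseq n)) h),
      Lp.coeFn_smul (2 * Real.pi * Complex.I : ℂ) (mulL (fun x => (x : ℂ) ^ 1) h),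
      (bddMeas_dsym (sseq n)).coeFn h] with x h1 h2 h3 h4 h5
    rw [h1, Pi.sub_apply, h3, h4, Pi.smul_apply, Pi.smul_apply, h2, h5, hF]
    simp only [smul_eq_mul, pow_one]
    congr 2; ring
  simp_rw [e]
  have h0 : ∫⁻ _ : ℝ, (0 : ℝ≥0∞) = 0 := lintegral_zero
  rw [← h0]
  refine tendsto_lintegral_of_dominated_convergence
    (fun x => ENNReal.ofReal ((4 * Real.pi) ^ 2) * (wt 1 x * ‖h x‖ₑ ^ 2)) (fun n => ?_)
    (fun n => Eventually.of_forall fun x => ?_) ?_ (Eventually.of_forall fun x => ?_)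
  · have := (bddMeas_dsym (sseq n)).meas
    fun_prop
  · simp only [hF]
    rw [enorm_mul, mul_pow, ← mul_assoc]
    gcongr
    refine le_trans ?_ (mul_le_mul_right (pw_le_wt zero_le_one x) _)
    rw [← pw_sq, pw, Real.rpow_one, ← ENNReal.ofReal_pow (abs_nonneg _),
      ← ENNReal.ofReal_mul (by positivity), ← mul_pow, ← ofReal_norm,
      ← ENNReal.ofReal_pow (norm_nonneg _)]
    gcongr
    refine (norm_sub_le _ _).trans ?_
    have h1 := norm_dsym_le (sseq n) x
    have hs := sseq_pos n
    have h2 : ‖(sseq n : ℂ)⁻¹ * dsym (sseq n) x‖ ≤ 2 * Real.pi * |x| := by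
      rw [norm_mul, norm_inv, Complex.norm_real, Real.norm_eq_abs, abs_of_pos hs,
        inv_mul_le_iff₀ hs]
      rw [abs_of_pos hs] at h1
      linarith
    have h3 : ‖(2 * Real.pi * Complex.I * x : ℂ)‖ = 2 * Real.pi * |x| := by
      simp [abs_of_pos Real.pi_pos]
    linarith
  · rw [lintegral_const_mul' _ _ ENNReal.ofReal_ne_top]
    exact ENNReal.mul_ne_top ENNReal.ofReal_ne_top hw.ne
  · have h1 := ((tendsto_dsym_div x).comp tendsto_sseq').sub_const (2 * Real.pi * Complex.I * x)
    rw [sub_self] at h1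
    have h3 := h1.mul_const (h x)
    rw [zero_mul] at h3
    have h2 := ((ENNReal.continuous_pow 2).comp (continuous_enorm (E := ℂ))).tendsto 0 |>.comp h3
    simpa only [Function.comp_def, hF, enorm_zero, ne_eq, OfNat.ofNat_ne_zero, not_false_eq_true,
      zero_pow] using h2

/-- Multiplication by x is a limit of difference quotients, whose commutators with S have squared
norm at most 4 s^{-2} times the mass below |s|. A vanishing mean makes `lowInt 1` finite by Hardy's
inequality, and the commutators tend to zero. On the Fourier side, no delta function appears at the
jump of the sign. -/
lemma mul_sign_multiplier {h : L2R} (hw : wsq 1 h < ∞) (hz : ∫ x, h x = 0) :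
    (fun x : ℝ => (x : ℂ) * FM sg h x) =ᵐ[volume] FM sg (mulL (fun x => (x : ℂ) ^ 1) h) := by
  have hi : Integrable (h : ℝ → ℂ) := by
    simpa using integrable_pow_mul (l := 0) (θ := 1) (by norm_num) (Lp.aestronglyMeasurable h) hw
  obtain ⟨C, hC⟩ := exists_lowInt_le_of_integral_eq_zero (α := 1) (by norm_num) (by norm_num)
  have hlow : lowInt 1 (𝓕 h : L2R) < ∞ := (hC h hi hz).trans_lt
    (ENNReal.mul_lt_top ENNReal.coe_lt_top ((hsq_le_wsq zero_le_one h).trans_lt hw))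
  set S := bddMeas_sg.fmCLM with hS
  set X := mulL (fun x : ℝ => (x : ℂ) ^ 1) h with hX
  set D : ℕ → L2R := fun n => ((sseq n : ℂ)⁻¹) • mulL (dsym (sseq n)) h with hD
  set W : ℕ → L2R := fun n => ((sseq n : ℂ)⁻¹) • mulL (dsym (sseq n)) (S h) with hW
  have hD' : Tendsto (fun n => S (D n)) atTop (𝓝 (S ((2 * Real.pi * Complex.I : ℂ) • X))) :=
    (S.continuous.tendsto _).comp (tendsto_difference_quotient hw)
  have hWD : Tendsto (fun n => W n - S (D n)) atTop (𝓝 0) := by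
    apply tendsto_of_lintegral_sub_sq
    have hset : Tendsto (volume ∘ fun n => Set.Ioc (sseq n) (2 * sseq n)) atTop (𝓝 0) := by
      have : (volume ∘ fun n => Set.Ioc (sseq n) (2 * sseq n)) = fun n => ENNReal.ofReal (sseq n) := by
        ext n
        rw [Function.comp_apply, Real.volume_Ioc]; congr 1; ring
      rw [this]
      simpa using ENNReal.tendsto_ofReal tendsto_sseq
    -- Absolute continuity of the finite integral `lowInt 1` along the shrinking intervals (s, 2s].
    have h1 := tendsto_setLIntegral_zero hlow.ne hset
    have h2 := ENNReal.Tendsto.const_mul (a := 32) h1 (Or.inr (by simp))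
    rw [mul_zero] at h2
    refine tendsto_of_tendsto_of_tendsto_of_le_of_le tendsto_const_nhds h2
      (fun n => zero_le) fun n => ?_
    have hs := sseq_pos n
    have e1 : W n - S (D n)
        = ((sseq n : ℂ)⁻¹) • (mulL (dsym (sseq n)) (S h) - S (mulL (dsym (sseq n)) h)) := by
      simp only [hW, hD, map_smul, smul_sub]
    have e2 : ∀ᵐ x, ‖(W n - S (D n) - 0 : L2R) x‖ₑ ^ 2 = ENNReal.ofReal ((sseq n)⁻¹ ^ 2) *
        ‖(mulL (dsym (sseq n)) (S h) - S (mulL (dsym (sseq n)) h) : L2R) x‖ₑ ^ 2 := by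
      rw [sub_zero, e1]
      filter_upwards [Lp.coeFn_smul ((sseq n : ℂ)⁻¹)
        (mulL (dsym (sseq n)) (S h) - S (mulL (dsym (sseq n)) h))] with x hx
      rw [hx, Pi.smul_apply, smul_eq_mul, enorm_mul, mul_pow, ENNReal.ofReal_pow (by positivity)]
      congr 2
      rw [← ofReal_norm, norm_inv, Complex.norm_real, Real.norm_of_nonneg hs.le]
    rw [lintegral_congr_ae e2, lintegral_const_mul' _ _ ENNReal.ofReal_ne_top]
    calc _ ≤ ENNReal.ofReal ((sseq n)⁻¹ ^ 2) * (4 * low (sseq n) (𝓕 h : L2R)) := by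
          refine mul_le_mul_right ?_ _
          exact lintegral_commutator_le (sseq n) h
      _ ≤ ENNReal.ofReal ((sseq n)⁻¹ ^ 2) * (4 * (ENNReal.ofReal (8 * sseq n ^ 2) *
          ∫⁻ r in Set.Ioc (sseq n) (2 * sseq n), pw (-1 - 2 * 1) r * low r (𝓕 h : L2R))) := by
          gcongr
          exact low_le_lintegral hs _
      _ = 4 * (ENNReal.ofReal ((sseq n)⁻¹ ^ 2) * ENNReal.ofReal (8 * sseq n ^ 2)) *
          ∫⁻ r in Set.Ioc (sseq n) (2 * sseq n), pw (-1 - 2 * 1) r * low r (𝓕 h : L2R) := by ring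
      _ = _ := by
          rw [← ENNReal.ofReal_mul (by positivity),
            show (sseq n)⁻¹ ^ 2 * (8 * sseq n ^ 2) = 8 by field_simp]
          congr 1
          norm_num
  have hWt : Tendsto W atTop (𝓝 (S ((2 * Real.pi * Complex.I : ℂ) • X))) := by
    have := hWD.add hD'
    simpa using this
  -- Almost everywhere convergence along a subsequence identifies the limit pointwise, so square
  -- integrability of x·Sh need not be known beforehand.
  obtain ⟨ns, hns, hae⟩ := (tendstoInMeasure_of_tendsto_Lp hWt).exists_seq_tendsto_ae
  have hWx : ∀ᵐ x, ∀ n, W n x = ((sseq n : ℂ)⁻¹ * dsym (sseq n) x) * (S h) x := by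
    rw [ae_all_iff]
    intro n
    filter_upwards [Lp.coeFn_smul ((sseq n : ℂ)⁻¹) (mulL (dsym (sseq n)) (S h)),
      (bddMeas_dsym (sseq n)).coeFn (S h)] with x h1 h2
    rw [hW]
    simp only
    rw [h1, Pi.smul_apply, h2, smul_eq_mul, mul_assoc]
  have e3 : S ((2 * Real.pi * Complex.I : ℂ) • X) = (2 * Real.pi * Complex.I : ℂ) • S X :=
    map_smul _ _ _
  rw [e3] at hae
  filter_upwards [hae, hWx, Lp.coeFn_smul (2 * Real.pi * Complex.I : ℂ) (S X)] with x h1 h2 h3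
  have h4 : Tendsto (fun i => W (ns i) x) atTop (𝓝 (2 * Real.pi * Complex.I * x * S h x)) := by
    simp_rw [h2]
    exact (((tendsto_dsym_div x).comp tendsto_sseq').comp hns.tendsto_atTop).mul_const _
  have h5 := tendsto_nhds_unique h4 h1
  rw [h3, Pi.smul_apply, smul_eq_mul, mul_assoc] at h5
  exact mul_left_cancel₀ (by simp [Real.pi_ne_zero]) h5

lemma wsq_pow_mul_le {n : ℕ} {θ : ℝ} {h : L2R} (hw : wsq n h < ∞) :
    wsq θ (mulL (fun x : ℝ => (x : ℂ) ^ n) h) ≤ wsq (θ + n) h := by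
  rw [wsq_congr (coeFn_mulL (memLp_pow_mul hw))]
  refine lintegral_mono fun x => ?_
  rw [enorm_mul, mul_pow, ← mul_assoc, wt_add]
  gcongr
  exact enorm_pow_sq_le_wt n x

/-- Powers of `x` commute with the sign multiplier on functions with vanishing moments. -/
lemma pow_mul_sign_multiplier (n : ℕ) {h : L2R} (hw : wsq n h < ∞)
    (hz : ∀ l < n, ∫ x : ℝ, (x : ℂ) ^ l * h x = 0) :
    (fun x : ℝ => (x : ℂ) ^ n * FM sg h x) =ᵐ[volume] FM sg (mulL (fun x => (x : ℂ) ^ n) h) := by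
  induction n with
  | zero =>
    have : mulL (fun x : ℝ => (x : ℂ) ^ 0) h = h := by
      apply Lp.ext
      filter_upwards [coeFn_mulL (memLp_pow_mul (n := 0) hw)] with x hx
      rw [hx]; simp
    rw [this]
    simp
  | succ n ih =>
    have hw' : wsq n h < ∞ := (wsq_mono (by push_cast; linarith) _).trans_lt hw
    have ih' := ih hw' fun l hl => hz l (hl.trans n.lt_succ_self)
    set k := mulL (fun x : ℝ => (x : ℂ) ^ n) h with hk
    have hkc := coeFn_mulL (memLp_pow_mul hw')
    have hk1 : wsq 1 k < ∞ := (wsq_pow_mul_le hw').trans_lt (by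
      rw [add_comm]; exact_mod_cast hw)
    have hk0 : ∫ x, k x = 0 := by
      rw [integral_congr_ae hkc]; exact hz n n.lt_succ_self
    have e : mulL (fun x : ℝ => (x : ℂ) ^ 1) k = mulL (fun x : ℝ => (x : ℂ) ^ (n + 1)) h := by
      apply Lp.ext
      filter_upwards [coeFn_mulL (memLp_pow_mul (n := 1) (h := k) (by exact_mod_cast hk1)),
        coeFn_mulL (memLp_pow_mul hw), hkc] with x h1 h2 h3
      rw [h1, h2, h3]; ring
    rw [← e]
    filter_upwards [mul_sign_multiplier hk1 hk0, ih'] with x h1 h2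
    rw [← h1, ← h2]; ring

/-! ### The sign multiplier on weighted spaces -/

/-- Plancherel at α = 0, and the two Hardy inequalities on either side of 1/2; the mean condition is
only called for above 1/2. -/
lemma exists_hsq_sign_le {α : ℝ} (h0 : 0 ≤ α) (h1 : α < 1) (h2 : α ≠ 1 / 2) :
    ∃ C : ℝ≥0, ∀ h : L2R, (1 / 2 < α → Integrable (h : ℝ → ℂ) ∧ ∫ x, h x = 0) →
      hsq α (FM sg h) ≤ C * hsq α h := by
  have fin : ∀ (C : ℝ≥0), 0 < α → ((2 + 8 * C * (difConst α)⁻¹ : ℝ≥0∞)) ≠ ∞ := by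
    intro C hα
    have := ENNReal.inv_ne_top.2 (difConst_ne_zero α)
    finiteness
  rcases h0.eq_or_lt with rfl | h0
  · refine ⟨1, fun h _ => ?_⟩
    simpa [hsq, pw_zero] using bddMeas_sg.lintegral_FM_le norm_sg_le h
  rcases lt_or_gt_of_ne h2 with h3 | h3
  · obtain ⟨C, hC⟩ := exists_lowInt_le h0 h3
    refine ⟨(2 + 8 * C * (difConst α)⁻¹ : ℝ≥0∞).toNNReal, fun h _ => ?_⟩
    rw [ENNReal.coe_toNNReal (fin C h0)]
    exact hsq_sign_le_of_lowInt_le h0 h1 (hC h)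
  · obtain ⟨C, hC⟩ := exists_lowInt_le_of_integral_eq_zero h3 (by linarith)
    refine ⟨(2 + 8 * C * (difConst α)⁻¹ : ℝ≥0∞).toNNReal, fun h hh => ?_⟩
    rw [ENNReal.coe_toNNReal (fin C h0)]
    exact hsq_sign_le_of_lowInt_le h0 h1 (hC h (hh h3).1 (hh h3).2)

lemma hsq_pow_mul (n : ℕ) (α : ℝ) (h : ℝ → ℂ) :
    hsq α (fun x : ℝ => (x : ℂ) ^ n * h x) = hsq (α + n) h := by
  apply lintegral_congr_ae
  filter_upwards [ae_ne_zero] with x hx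
  rw [mul_add, pw_add _ _ hx, enorm_mul, mul_pow, ← pw_sq n, mul_assoc]
  congr 3
  rw [pw, ← ofReal_norm, norm_pow, Complex.norm_real, Real.rpow_natCast, Real.norm_eq_abs]

/-- **Weighted estimate for the Hilbert transform** away from the critical exponents. -/
theorem exists_wsq_sign_le {θ : ℝ} (hθ : 0 ≤ θ) (hc : ∀ l : ℕ, θ ≠ l + 1 / 2) :
    ∃ C : ℝ≥0, ∀ h : L2R, wsq θ h < ∞ →
      (∀ l : ℕ, l + 1 / 2 < θ → ∫ x : ℝ, (x : ℂ) ^ l * h x = 0) →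
      wsq θ (FM sg h) ≤ C * wsq θ h := by
  -- Write θ = n + α with α in [0, 1) and α ≠ 1/2. Moments below n let x^n pass through S, and the
  -- n-th moment is the mean required of x^n h when α > 1/2.
  set n := ⌊θ⌋₊ with hn
  have hn1 : (n : ℝ) ≤ θ := Nat.floor_le hθ
  have hn2 : θ < n + 1 := Nat.lt_floor_add_one θ
  obtain ⟨C, hC⟩ := exists_hsq_sign_le (α := θ - n) (by linarith) (by linarith)
    (fun h => hc n (by linarith))
  refine ⟨(ENNReal.ofReal (2 ^ θ) * (1 + C)).toNNReal, fun h hw hz => ?_⟩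
  rw [ENNReal.coe_toNNReal (by finiteness)]
  have hwn : wsq n h < ∞ := (wsq_mono hn1 _).trans_lt hw
  have hk := coeFn_mulL (memLp_pow_mul hwn)
  have h1 : hsq θ (FM sg h) ≤ C * hsq θ h := by
    have e1 : hsq θ (FM sg h) = hsq (θ - n) (FM sg (mulL (fun x : ℝ => (x : ℂ) ^ n) h)) := by
      rw [← hsq_congr (pow_mul_sign_multiplier n hwn fun l hl => hz l ?_), hsq_pow_mul,
        sub_add_cancel]
      have : (l : ℝ) + 1 ≤ n := by exact_mod_cast hl
      linarith
    have e2 : hsq θ h = hsq (θ - n) (mulL (fun x : ℝ => (x : ℂ) ^ n) h) := by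
      rw [hsq_congr hk, hsq_pow_mul, sub_add_cancel]
    rw [e1, e2]
    refine hC _ fun hα => ⟨?_, ?_⟩
    · exact (integrable_pow_mul (by linarith) (Lp.aestronglyMeasurable h) hw).congr hk.symm
    · rw [integral_congr_ae hk]; exact hz n (by linarith)
  calc wsq θ (FM sg h) ≤ ENNReal.ofReal (2 ^ θ) * ((∫⁻ x, ‖FM sg h x‖ₑ ^ 2) + hsq θ (FM sg h)) :=
        wsq_le_hsq hθ _
    _ ≤ ENNReal.ofReal (2 ^ θ) * (wsq θ h + C * wsq θ h) := by
        gcongr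
        · exact (bddMeas_sg.lintegral_FM_le norm_sg_le h).trans (lintegral_le_wsq hθ _)
        · exact h1.trans (by gcongr; exact hsq_le_wsq hθ _)
    _ = _ := by ring

/-- Weighted estimate for the Hilbert transform at the critical exponents. -/
theorem exists_wsq_sign_le_critical (k : ℕ) :
    ∃ C : ℝ≥0, ∀ h : L2R, wsq (k + 1 / 2) h < ∞ →
      (∀ l < k, ∫ x : ℝ, (x : ℂ) ^ l * h x = 0) →
      wsq (k + 1 / 2) (FM sg h) ≤
        C * (wsq (k + 1 / 2) h + wsq (1 / 2) (FM sg (mulL (fun x : ℝ => (x : ℂ) ^ k) h))) := by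
  have hθ : (0 : ℝ) ≤ k + 1 / 2 := by positivity
  refine ⟨(ENNReal.ofReal (2 ^ (k + 1 / 2 : ℝ))).toNNReal, fun h hw hz => ?_⟩
  rw [ENNReal.coe_toNNReal (by finiteness)]
  have hwn : wsq k h < ∞ := (wsq_mono (by linarith) _).trans_lt hw
  refine (wsq_le_hsq hθ _).trans ?_
  gcongr
  · exact (bddMeas_sg.lintegral_FM_le norm_sg_le h).trans (lintegral_le_wsq hθ _)
  -- The fractional part is 1/2, out of reach of Hardy's inequality, so after commuting x^k the
  -- transform of x^k h is kept.
  · rw [add_comm, ← hsq_pow_mul, hsq_congr (pow_mul_sign_multiplier k hwn hz)]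
    exact hsq_le_wsq (by norm_num) _

/-! ### The propagator on a single mode -/

lemma wsq_add_le (θ : ℝ) (f g : L2R) : wsq θ (f + g : L2R) ≤ 2 * wsq θ f + 2 * wsq θ g := by
  have hf := measurable_coe f
  rw [wsq_congr (Lp.coeFn_add f g), wsq, wsq, wsq, ← lintegral_const_mul' _ _ (by simp),
    ← lintegral_const_mul' _ _ (by simp), ← lintegral_add_left (by fun_prop)]
  refine lintegral_mono fun x => ?_
  refine (mul_le_mul_right (enorm_add_sq_le (f x) (g x)) _).trans_eq ?_
  ring

lemma wsq_smul (θ : ℝ) (c : ℂ) (f : L2R) : wsq θ (c • f : L2R) = ‖c‖ₑ ^ 2 * wsq θ f := by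
  have hf := measurable_coe f
  rw [wsq_congr (Lp.coeFn_smul c f), wsq, wsq, ← lintegral_const_mul' _ _ (by simp)]
  congr 1; ext x
  rw [Pi.smul_apply, smul_eq_mul, enorm_mul]; ring

lemma wsq_sub_le (θ : ℝ) (f g : L2R) : wsq θ (f - g : L2R) ≤ 2 * wsq θ f + 2 * wsq θ g := by
  have h := wsq_add_le θ f ((-1 : ℂ) • g)
  rw [wsq_smul] at h
  simpa [sub_eq_add_neg] using h

lemma wsq_fourier_FM_le {m : ℝ → ℂ} (hm : BddMeas m) (h1 : ∀ x, ‖m x‖ ≤ 1) (θ : ℝ) (h : L2R) :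
    wsq θ (𝓕 (FM m h) : L2R) ≤ wsq θ (𝓕 h : L2R) := by
  rw [wsq_congr (hm.coeFn_fourier_FM h)]
  refine lintegral_mono fun v => ?_
  rw [enorm_mul]
  gcongr
  refine mul_le_of_le_one_left zero_le ?_
  rw [← ofReal_norm]
  exact ENNReal.ofReal_le_one.2 (h1 v)

lemma coe_fourier_add (f g : L2R) : 𝓕 (f + g) = (𝓕 f + 𝓕 g : L2R) :=
  (Lp.fourierTransformₗᵢ ℝ ℂ).map_add f g

lemma coe_fourier_sub (f g : L2R) : 𝓕 (f - g) = (𝓕 f - 𝓕 g : L2R) :=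
  (Lp.fourierTransformₗᵢ ℝ ℂ).map_sub f g

lemma coe_fourier_smul (c : ℂ) (f : L2R) : 𝓕 (c • f) = (c • 𝓕 f : L2R) :=
  (Lp.fourierTransformₗᵢ ℝ ℂ).map_smul c f

/-- The symbol `e^{i sign(v) (a v² + b)}` of the propagator on one mode. -/
def psym (a b v : ℝ) : ℂ := Complex.exp ((Real.sign v * (a * v ^ 2 + b) : ℝ) * Complex.I)

lemma norm_psym (a b v : ℝ) : ‖psym a b v‖ = 1 := Complex.norm_exp_ofReal_mul_I _

lemma bddMeas_psym (a b : ℝ) : BddMeas (psym a b) := by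
  refine ⟨?_, 1, fun v => (norm_psym a b v).le⟩
  have := measurable_sign
  unfold psym
  fun_prop

/-- (1 ± S)/2 are the projections onto positive and negative frequencies, and on each half-line the
symbol is a constant phase times a chirp. As b enters only through these phases, bounds derived from
here are uniform in it. -/
lemma FM_psym_eq (a b : ℝ) (h : L2R) :
    FM (psym a b) h = (Complex.exp (b * Complex.I) / 2) • FM (chirp a) (h + FM sg h) +
      (Complex.exp (-(b * Complex.I)) / 2) • FM (chirp (-a)) (h - FM sg h) := by
  apply eq_of_fourier_ae_eq
  rw [coe_fourier_add, coe_fourier_smul, coe_fourier_smul]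
  set A := FM (chirp a) (h + FM sg h)
  set B := FM (chirp (-a)) (h - FM sg h)
  have hA := (bddMeas_chirp a).coeFn_fourier_FM (h + FM sg h)
  have hB := (bddMeas_chirp (-a)).coeFn_fourier_FM (h - FM sg h)
  rw [coe_fourier_add] at hA
  rw [coe_fourier_sub] at hB
  filter_upwards [ae_ne_zero, (bddMeas_psym a b).coeFn_fourier_FM h, hA, hB,
    bddMeas_sg.coeFn_fourier_FM h, Lp.coeFn_add (𝓕 h) (𝓕 (FM sg h) : L2R),
    Lp.coeFn_sub (𝓕 h) (𝓕 (FM sg h) : L2R),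
    Lp.coeFn_add ((Complex.exp (b * Complex.I) / 2) • 𝓕 A)
      ((Complex.exp (-(b * Complex.I)) / 2) • 𝓕 B : L2R),
    Lp.coeFn_smul (Complex.exp (b * Complex.I) / 2) (𝓕 A : L2R),
    Lp.coeFn_smul (Complex.exp (-(b * Complex.I)) / 2) (𝓕 B : L2R)]
    with v hv h1 h2 h3 h4 h5 h6 h7 h8 h9
  rw [h1, h7, Pi.add_apply, h8, h9, Pi.smul_apply, Pi.smul_apply, h2, h3, h5, h6, Pi.add_apply,
    Pi.sub_apply, h4]
  simp only [smul_eq_mul, psym, chirp, sg]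
  rcases lt_or_gt_of_ne hv with hv | hv
  · rw [Real.sign_of_neg hv]
    have : Complex.exp (((-1 : ℝ) * (a * v ^ 2 + b) : ℝ) * Complex.I)
        = Complex.exp (-(b * Complex.I)) * Complex.exp ((-a * v ^ 2 : ℝ) * Complex.I) := by
      rw [← Complex.exp_add]; congr 1; push_cast; ring
    rw [this]; push_cast; ring
  · rw [Real.sign_of_pos hv]
    have : Complex.exp (((1 : ℝ) * (a * v ^ 2 + b) : ℝ) * Complex.I)
        = Complex.exp (b * Complex.I) * Complex.exp ((a * v ^ 2 : ℝ) * Complex.I) := by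
      rw [← Complex.exp_add]; congr 1; push_cast; ring
    rw [this]; push_cast; ring

lemma wt_neg (θ a : ℝ) : wt θ (-a) = wt θ a := by simp [wt_eq]

/-- The propagator on weighted spaces, in terms of the function and its Hilbert transform. -/
theorem exists_wsq_psym_le {θ : ℝ} (hθ : 0 ≤ θ) :
    ∃ C : ℝ≥0, ∀ (a b : ℝ) (h : L2R), wsq θ (FM (psym a b) h)
      ≤ C * wt θ a * (wsq θ h + wsq θ (FM sg h) + wsq θ (𝓕 h : L2R)) := by
  obtain ⟨C, hC⟩ := exists_wsq_chirp_le hθ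
  refine ⟨16 * C, fun a b h => ?_⟩
  have hn : ‖Complex.exp (b * Complex.I) / 2‖ₑ ^ 2 ≤ 1 := by
    rw [← ofReal_norm, norm_div, Complex.norm_exp_ofReal_mul_I, ← ENNReal.ofReal_pow (by positivity)]
    norm_num
  have hn' : ‖Complex.exp (-(b * Complex.I)) / 2‖ₑ ^ 2 ≤ 1 := by
    rw [← neg_mul, ← Complex.ofReal_neg, ← ofReal_norm, norm_div, Complex.norm_exp_ofReal_mul_I,
      ← ENNReal.ofReal_pow (by positivity)]
    norm_num
  have hF := wsq_fourier_FM_le bddMeas_sg norm_sg_le θ h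
  have h1 : wsq θ (FM (chirp a) (h + FM sg h))
      ≤ C * wt θ a * (4 * (wsq θ h + wsq θ (FM sg h) + wsq θ (𝓕 h : L2R))) := by
    refine (hC a _).trans (mul_le_mul_right ?_ _)
    rw [coe_fourier_add]
    calc _ ≤ (2 * wsq θ h + 2 * wsq θ (FM sg h)) +
          (2 * wsq θ (𝓕 h : L2R) + 2 * wsq θ (𝓕 h : L2R)) :=
          add_le_add (wsq_add_le _ _ _) ((wsq_add_le _ _ _).trans (by gcongr))
      _ = 2 * wsq θ h + 2 * wsq θ (FM sg h) + 4 * wsq θ (𝓕 h : L2R) := by ring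
      _ ≤ 4 * wsq θ h + 4 * wsq θ (FM sg h) + 4 * wsq θ (𝓕 h : L2R) := by
          gcongr <;> norm_num
      _ = _ := by ring
  have h2 : wsq θ (FM (chirp (-a)) (h - FM sg h))
      ≤ C * wt θ a * (4 * (wsq θ h + wsq θ (FM sg h) + wsq θ (𝓕 h : L2R))) := by
    refine (hC (-a) _).trans ?_
    rw [wt_neg]
    refine mul_le_mul_right ?_ _
    rw [coe_fourier_sub]
    calc _ ≤ (2 * wsq θ h + 2 * wsq θ (FM sg h)) +
          (2 * wsq θ (𝓕 h : L2R) + 2 * wsq θ (𝓕 h : L2R)) :=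
          add_le_add (wsq_sub_le _ _ _) ((wsq_sub_le _ _ _).trans (by gcongr))
      _ = 2 * wsq θ h + 2 * wsq θ (FM sg h) + 4 * wsq θ (𝓕 h : L2R) := by ring
      _ ≤ 4 * wsq θ h + 4 * wsq θ (FM sg h) + 4 * wsq θ (𝓕 h : L2R) := by
          gcongr <;> norm_num
      _ = _ := by ring
  rw [FM_psym_eq]
  refine (wsq_add_le _ _ _).trans ?_
  rw [wsq_smul, wsq_smul]
  calc _ ≤ 2 * (1 * (C * wt θ a * (4 * (wsq θ h + wsq θ (FM sg h) + wsq θ (𝓕 h : L2R))))) +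
        2 * (1 * (C * wt θ a * (4 * (wsq θ h + wsq θ (FM sg h) + wsq θ (𝓕 h : L2R))))) := by
        gcongr
    _ = _ := by push_cast; ring

/-! ### Moments and derivatives of the Fourier transform at the origin -/

/-- Moments are Taylor coefficients of the transform at the origin; this converts the order of
vanishing of a symbol into vanishing moments. -/
lemma iteratedDeriv_fourier_zero {k l : ℕ} (hl : l ≤ k) {f : ℝ → ℂ}
    (hf : ∀ n ≤ k, Integrable fun x : ℝ => (x : ℂ) ^ n * f x) :
    iteratedDeriv l (𝓕 f) 0 = (-2 * Real.pi * Complex.I) ^ l * ∫ x : ℝ, (x : ℂ) ^ l * f x := by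
  have hf' : ∀ n : ℕ, (n : ℕ∞) ≤ (k : ℕ∞) → Integrable (fun x : ℝ => x ^ n • f x) := by
    intro n hn
    refine (hf n (by exact_mod_cast hn)).congr (Eventually.of_forall fun x => ?_)
    simp
  rw [Real.iteratedDeriv_fourier hf' (by exact_mod_cast hl), Real.fourier_real_eq,
    ← integral_const_mul]
  congr 1; ext x
  simp only [mul_zero, neg_zero, AddChar.map_zero_eq_one, one_smul, smul_eq_mul]
  rw [mul_pow]; ring

lemma contDiff_fourier_of_integrable {k : ℕ} {f : ℝ → ℂ}
    (hf : ∀ n ≤ k, Integrable fun x : ℝ => (x : ℂ) ^ n * f x) : ContDiff ℝ k (𝓕 f) := by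
  refine Real.contDiff_fourier (N := k) fun n hn => ?_
  refine (hf n (by exact_mod_cast hn)).norm.congr (Eventually.of_forall fun x => ?_)
  simp

/-- If `𝓕 F = m 𝓕 h` with `m` vanishing to second order at `0`, then `F` has two more vanishing
moments than `h`. -/
lemma moments_eq_zero_of_fourier_eq_mul {k : ℕ} {θ : ℝ} (hθ : k + 1 / 2 < θ) {h F : L2R}
    (hh : wsq θ h < ∞) (hF : wsq θ F < ∞) {m : ℝ → ℂ} (hm : ContDiff ℝ k m) (hm0 : m 0 = 0)
    (hm1 : deriv m 0 = 0) (e : (𝓕 F : L2R) =ᵐ[volume] fun v => m v * (𝓕 h : L2R) v)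
    (hz : ∀ l : ℕ, l + 2 ≤ k → ∫ x : ℝ, (x : ℂ) ^ l * h x = 0) {l : ℕ} (hl : l ≤ k) :
    ∫ x : ℝ, (x : ℂ) ^ l * F x = 0 := by
  have hmom : ∀ {f : L2R}, wsq θ f < ∞ → ∀ n ≤ k, Integrable fun x : ℝ => (x : ℂ) ^ n * f x := by
    intro f hf n hn
    refine integrable_pow_mul (θ := θ) ?_ (Lp.aestronglyMeasurable f) hf
    have : (n : ℝ) ≤ k := by exact_mod_cast hn
    linarith
  have hint : ∀ {f : L2R}, wsq θ f < ∞ → Integrable (f : ℝ → ℂ) := by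
    intro f hf; simpa using hmom hf 0 (Nat.zero_le k)
  have hc1 := continuous_fourier_of_integrable (hint hh)
  have hc2 := continuous_fourier_of_integrable (hint hF)
  have e1 : 𝓕 (F : ℝ → ℂ) = m * 𝓕 (h : ℝ → ℂ) := by
    refine (hc2.ae_eq_iff_eq volume (hm.continuous.mul hc1)).1 ?_
    filter_upwards [e, coe_fourier_ae_eq_integral h (hint hh),
      coe_fourier_ae_eq_integral F (hint hF)] with v h1 h2 h3
    rw [← h3, h1, h2]; rfl
  have e2 : iteratedDeriv l (𝓕 (F : ℝ → ℂ)) 0 = 0 := by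
    have hl' : ((l : ℕ) : WithTop ℕ∞) ≤ (k : ℕ) := by exact_mod_cast hl
    rw [e1, iteratedDeriv_mul (hm.contDiffAt.of_le hl')
      ((contDiff_fourier_of_integrable (hmom hh)).contDiffAt.of_le hl')]
    -- Leibniz rule: the terms with at most one derivative on m vanish because m does to second
    -- order, and the others contain a moment of h of order at most k - 2.
    refine Finset.sum_eq_zero fun i hi => ?_
    have hi' : i ≤ l := Nat.lt_succ_iff.1 (Finset.mem_range.1 hi)
    match i, hi' with
    | 0, _ => simp [hm0]
    | 1, _ => simp [hm1]
    | i + 2, hi' =>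
      rw [iteratedDeriv_fourier_zero (k := k) (l := l - (i + 2)) (by omega) (hmom hh),
        hz _ (by omega)]
      simp
  rw [iteratedDeriv_fourier_zero hl (hmom hF)] at e2
  exact (mul_eq_zero.1 e2).resolve_left (pow_ne_zero _ (by simp [Real.pi_ne_zero]))

lemma contDiff_chirp (a : ℝ) (n : ℕ) : ContDiff ℝ n (chirp a) := by
  have h : ContDiff ℝ n fun ν : ℝ => ((a * ν ^ 2 : ℝ) : ℂ) :=
    Complex.ofRealCLM.contDiff.comp (contDiff_const.mul (contDiff_id.pow 2))
  exact (h.mul contDiff_const).cexp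

lemma hasDerivAt_chirp_zero (a : ℝ) : HasDerivAt (chirp a) 0 0 := by
  have h0 : HasDerivAt (fun ν : ℝ => a * ν ^ 2) 0 0 := by
    simpa using ((hasDerivAt_id (0 : ℝ)).pow 2).const_mul a
  have h1 := (h0.ofReal_comp.mul_const Complex.I).cexp
  have e : chirp a = fun x : ℝ => Complex.exp (((a * x ^ 2 : ℝ) : ℂ) * Complex.I) := rfl
  rw [e]
  simpa using h1

/-- Without the phases the pieces recombine so that S hits only the difference of the two groups,
whose symbol e^{iav²} - e^{-iav²} has a double zero at the origin. -/
lemma FM_psym_zero_eq (a : ℝ) (h : L2R) :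
    FM (psym a 0) h = (1 / 2 : ℂ) • (FM (chirp a) h + FM (chirp (-a)) h) +
      (1 / 2 : ℂ) • FM sg (FM (chirp a) h - FM (chirp (-a)) h) := by
  have h1 : FM (chirp a) (FM sg h) = FM sg (FM (chirp a) h) := by
    apply eq_of_fourier_ae_eq
    filter_upwards [(bddMeas_chirp a).coeFn_fourier_FM (FM sg h), bddMeas_sg.coeFn_fourier_FM h,
      bddMeas_sg.coeFn_fourier_FM (FM (chirp a) h), (bddMeas_chirp a).coeFn_fourier_FM h]
      with v h1 h2 h3 h4
    rw [h1, h2, h3, h4]; ring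
  have h2 : FM (chirp (-a)) (FM sg h) = FM sg (FM (chirp (-a)) h) := by
    apply eq_of_fourier_ae_eq
    filter_upwards [(bddMeas_chirp (-a)).coeFn_fourier_FM (FM sg h), bddMeas_sg.coeFn_fourier_FM h,
      bddMeas_sg.coeFn_fourier_FM (FM (chirp (-a)) h), (bddMeas_chirp (-a)).coeFn_fourier_FM h]
      with v h1 h2 h3 h4
    rw [h1, h2, h3, h4]; ring
  rw [FM_psym_eq, ← (bddMeas_chirp a).fmCLM_apply, ← (bddMeas_chirp (-a)).fmCLM_apply, map_add,
    map_sub, (bddMeas_chirp a).fmCLM_apply, (bddMeas_chirp (-a)).fmCLM_apply,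
    (bddMeas_chirp a).fmCLM_apply, (bddMeas_chirp (-a)).fmCLM_apply, h1, h2,
    ← bddMeas_sg.fmCLM_apply (_ - _), map_sub, bddMeas_sg.fmCLM_apply, bddMeas_sg.fmCLM_apply]
  simp only [Complex.ofReal_zero, zero_mul, neg_zero, Complex.exp_zero]
  module

/-- The zero mode away from the critical exponents: two moment conditions fewer are needed. -/
theorem exists_wsq_psym_zero_le {k : ℕ} {θ : ℝ} (h1 : k + 1 / 2 < θ) (h2 : θ < k + 3 / 2) :
    ∃ C : ℝ≥0, ∀ (a : ℝ) (h : L2R), wsq θ h < ∞ → wsq θ (𝓕 h : L2R) < ∞ →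
      (∀ l : ℕ, l + 2 ≤ k → ∫ x : ℝ, (x : ℂ) ^ l * h x = 0) →
      wsq θ (FM (psym a 0) h) ≤ C * wt θ a * (wsq θ h + wsq θ (𝓕 h : L2R)) := by
  have hk : (0 : ℝ) ≤ k := k.cast_nonneg
  have hθ : 0 ≤ θ := by linarith
  obtain ⟨C, hC⟩ := exists_wsq_chirp_le hθ
  obtain ⟨D, hD⟩ := exists_wsq_sign_le hθ (fun l hl => by
    have h3 : (k : ℝ) < l := by linarith
    have h4 : (l : ℝ) < k + 1 := by linarith
    have h5 : k < l := by exact_mod_cast h3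
    have h6 : l < k + 1 := by exact_mod_cast h4
    omega)
  refine ⟨2 * C + 2 * D * C, fun a h hw hw' hz => ?_⟩
  set T := C * wt θ a * (wsq θ h + wsq θ (𝓕 h : L2R)) with hT
  have hTt : T < ∞ := by
    have := wt_ne_top θ a
    have := hw.ne
    have := hw'.ne
    rw [hT, lt_top_iff_ne_top]
    finiteness
  have ha : wsq θ (FM (chirp a) h) ≤ T := hC a h
  have hb : wsq θ (FM (chirp (-a)) h) ≤ T := by
    have := hC (-a) h; rwa [wt_neg] at this
  set F := FM (chirp a) h - FM (chirp (-a)) h with hF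
  have hFw : wsq θ F ≤ 4 * T :=
    (wsq_sub_le _ _ _).trans ((add_le_add (mul_le_mul_right ha 2) (mul_le_mul_right hb 2)).trans_eq
      (by ring))
  have hFt : wsq θ F < ∞ := hFw.trans_lt (by finiteness)
  -- The sign estimate at θ asks for all moments up to k; F has them although h is only assumed to
  -- have those up to k - 2.
  have hmom : ∀ l : ℕ, l + 1 / 2 < θ → ∫ x : ℝ, (x : ℂ) ^ l * F x = 0 := by
    intro l hl
    have hlk : l ≤ k := by
      have h4 : (l : ℝ) < k + 1 := by linarith
      have h6 : l < k + 1 := by exact_mod_cast h4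
      omega
    refine moments_eq_zero_of_fourier_eq_mul h1 hw hFt (m := fun v => chirp a v - chirp (-a) v)
      ((contDiff_chirp a k).sub (contDiff_chirp (-a) k)) (by simp [chirp])
      (((hasDerivAt_chirp_zero a).sub (hasDerivAt_chirp_zero (-a))).deriv.trans (sub_zero 0)) ?_
      hz hlk
    rw [hF, coe_fourier_sub]
    filter_upwards [Lp.coeFn_sub (𝓕 (FM (chirp a) h)) (𝓕 (FM (chirp (-a)) h) : L2R),
      (bddMeas_chirp a).coeFn_fourier_FM h, (bddMeas_chirp (-a)).coeFn_fourier_FM h] with v e1 e2 e3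
    rw [e1, Pi.sub_apply, e2, e3, sub_mul]
  have hS := hD F hFt hmom
  have hhalf : ‖(1 / 2 : ℂ)‖ₑ ^ 2 = 4⁻¹ := by
    rw [← ofReal_norm, ← ENNReal.ofReal_pow (norm_nonneg _)]
    norm_num
    rw [one_div, ENNReal.ofReal_inv_of_pos (by norm_num)]
    norm_num
  rw [FM_psym_zero_eq]
  refine (wsq_add_le _ _ _).trans ?_
  rw [wsq_smul, wsq_smul, hhalf]
  have h4 : (4⁻¹ : ℝ≥0∞) * 4 = 1 := ENNReal.inv_mul_cancel (by simp) (by simp)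
  calc _ ≤ 2 * (4⁻¹ * (2 * T + 2 * T)) + 2 * (4⁻¹ * (D * (4 * T))) :=
        add_le_add (mul_le_mul_right (mul_le_mul_right ((wsq_add_le _ _ _).trans
          (add_le_add (mul_le_mul_right ha 2) (mul_le_mul_right hb 2))) _) _)
          (mul_le_mul_right (mul_le_mul_right (hS.trans (mul_le_mul_right hFw _)) _) _)
    _ = (4⁻¹ * 4) * (2 * T) + (4⁻¹ * 4) * (2 * D * T) := by ring
    _ = _ := by rw [h4, hT]; push_cast; ring

/-! ### A Schwartz function with prescribed moments -/

lemma bracket_le_one_add_abs (x : ℝ) : bracket x ≤ 1 + |x| := by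
  rw [bracket, Real.sqrt_le_left (by positivity)]
  nlinarith [abs_nonneg x, sq_abs x]

lemma wsq_schwartz_lt_top (s : 𝓢(ℝ, ℂ)) (τ : ℝ) : wsq τ s < ∞ := by
  obtain ⟨N, hN⟩ := exists_nat_gt (τ + 1 / 2)
  set B : ℝ := 2 ^ N * ((Finset.Iic (N, 0)).sup fun m => SchwartzMap.seminorm ℝ m.1 m.2) s
  have hB : ∀ x : ℝ, bracket x ^ (N : ℝ) * ‖s x‖ ≤ B := by
    intro x
    have h := SchwartzMap.one_add_le_sup_seminorm_apply (𝕜 := ℝ) (m := (N, 0)) (k := N) (n := 0)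
      le_rfl le_rfl s x
    rw [norm_iteratedFDeriv_zero] at h
    refine le_trans ?_ h
    rw [Real.rpow_natCast]
    have h1 := (bracket_pos x).le
    have h2 := bracket_le_one_add_abs x
    rw [Real.norm_eq_abs]
    gcongr
  have hb : ∀ x : ℝ, wt τ x * ‖s x‖ₑ ^ 2 ≤ ENNReal.ofReal (B ^ 2) * wt (τ - N) x := by
    intro x
    have h1 : wt N x * ‖s x‖ₑ ^ 2 ≤ ENNReal.ofReal (B ^ 2) := by
      rw [wt, ← ofReal_norm, ← ENNReal.ofReal_pow (norm_nonneg _), ← ENNReal.ofReal_mul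
        (Real.rpow_nonneg (bracket_pos x).le _)]
      refine ENNReal.ofReal_le_ofReal ?_
      have h2 := hB x
      have h3 : 0 ≤ bracket x ^ (N : ℝ) * ‖s x‖ :=
        mul_nonneg (Real.rpow_nonneg (bracket_pos x).le _) (norm_nonneg _)
      calc _ = (bracket x ^ (N : ℝ) * ‖s x‖) ^ 2 := by
            rw [mul_pow, mul_comm (2 : ℝ), Real.rpow_mul (bracket_pos x).le]; norm_num
        _ ≤ B ^ 2 := by gcongr
    calc wt τ x * ‖s x‖ₑ ^ 2 = wt (τ - N) x * (wt N x * ‖s x‖ₑ ^ 2) := by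
          rw [← mul_assoc, ← wt_add]; ring_nf
      _ ≤ wt (τ - N) x * ENNReal.ofReal (B ^ 2) := mul_le_mul_right h1 _
      _ = _ := mul_comm _ _
  refine (lintegral_mono hb).trans_lt ?_
  rw [lintegral_const_mul _ (measurable_wt _)]
  exact ENNReal.mul_lt_top ENNReal.ofReal_lt_top (lintegral_wt_lt_top (θ := τ - N) (by linarith))

lemma iteratedDeriv_ofReal_pow (n l : ℕ) :
    iteratedDeriv l (fun v : ℝ => (v : ℂ) ^ n) =
      fun v : ℝ => (n.descFactorial l : ℂ) * (v : ℂ) ^ (n - l) := by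
  induction l with
  | zero => simp
  | succ l ih =>
    rw [iteratedDeriv_succ, ih]
    ext v
    have h := (((hasDerivAt_pow (n - l) (v : ℂ)).comp_ofReal).const_mul
      (n.descFactorial l : ℂ)).deriv
    refine h.trans ?_
    rw [Nat.descFactorial_succ]
    push_cast
    rw [Nat.sub_sub]; ring

/-- There is a function with rapid decay whose Fourier transform has a zero of exact order `n` at
the origin and agrees there with a monomial. -/
lemma exists_moment_corrector (n : ℕ) : ∃ G : L2R, (∀ τ, wsq τ G < ∞) ∧
    (∀ τ, wsq τ (𝓕 G : L2R) < ∞) ∧ (∀ l : ℕ, l ≠ n → ∫ x : ℝ, (x : ℂ) ^ l * G x = 0) ∧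
    ∫ x : ℝ, (x : ℂ) ^ n * G x ≠ 0 := by
  let χ : ContDiffBump (0 : ℝ) := ⟨1, 2, by norm_num, by norm_num⟩
  have hc : HasCompactSupport fun v : ℝ => (v : ℂ) ^ n * ((χ v : ℝ) : ℂ) :=
    (χ.hasCompactSupport.comp_left (g := fun r : ℝ => (r : ℂ)) (by simp)).mul_left
  have hd : ContDiff ℝ ((⊤ : ℕ∞) : WithTop ℕ∞) fun v : ℝ => (v : ℂ) ^ n * ((χ v : ℝ) : ℂ) :=
    (Complex.ofRealCLM.contDiff.pow n).mul (Complex.ofRealCLM.contDiff.comp χ.contDiff)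
  -- v^n times a bump equal to 1 near the origin: its Taylor expansion there is the single monomial
  -- v^n, so its inverse transform has only the n-th moment.
  set Ψ : 𝓢(ℝ, ℂ) := hc.toSchwartzMap hd with hΨ
  have hF : 𝓕 ((𝓕⁻ Ψ : 𝓢(ℝ, ℂ)) : ℝ → ℂ) = Ψ := by
    rw [← SchwartzMap.fourier_coe, fourier_fourierInv_eq]
  have hG : ((𝓕⁻ Ψ : 𝓢(ℝ, ℂ)).toLp 2 volume : L2R) =ᵐ[volume] (𝓕⁻ Ψ : 𝓢(ℝ, ℂ)) :=
    SchwartzMap.coeFn_toLp _ 2 volume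
  have hint : ∀ l m : ℕ, m ≤ l → Integrable fun x : ℝ => (x : ℂ) ^ m * (𝓕⁻ Ψ : 𝓢(ℝ, ℂ)) x :=
    fun l m _ => integrable_pow_mul (θ := m + 1) (by linarith)
      (𝓕⁻ Ψ : 𝓢(ℝ, ℂ)).continuous.aestronglyMeasurable (wsq_schwartz_lt_top _ _)
  have hmom : ∀ l : ℕ, (-2 * Real.pi * Complex.I) ^ l *
      ∫ x : ℝ, (x : ℂ) ^ l * ((𝓕⁻ Ψ : 𝓢(ℝ, ℂ)).toLp 2 volume : L2R) x
        = (n.descFactorial l : ℂ) * 0 ^ (n - l) := by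
    intro l
    have h1 : ∫ x : ℝ, (x : ℂ) ^ l * ((𝓕⁻ Ψ : 𝓢(ℝ, ℂ)).toLp 2 volume : L2R) x
        = ∫ x : ℝ, (x : ℂ) ^ l * (𝓕⁻ Ψ : 𝓢(ℝ, ℂ)) x := by
      refine integral_congr_ae ?_
      filter_upwards [hG] with x hx
      rw [hx]
    rw [h1, ← iteratedDeriv_fourier_zero le_rfl (hint l), hF]
    have h2 : (Ψ : ℝ → ℂ) =ᶠ[𝓝 0] fun v : ℝ => (v : ℂ) ^ n := by
      filter_upwards [χ.eventuallyEq_one] with v hv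
      change (v : ℂ) ^ n * ((χ v : ℝ) : ℂ) = _
      rw [hv]; simp
    rw [h2.iteratedDeriv_eq, iteratedDeriv_ofReal_pow]
    simp
  have hne : ∀ l : ℕ, (-2 * Real.pi * Complex.I : ℂ) ^ l ≠ 0 := fun l =>
    pow_ne_zero _ (by simp [Real.pi_ne_zero])
  refine ⟨(𝓕⁻ Ψ : 𝓢(ℝ, ℂ)).toLp 2 volume, fun τ => ?_, fun τ => ?_, fun l hl => ?_, fun h0 => ?_⟩
  · rw [wsq_congr hG]; exact wsq_schwartz_lt_top _ _
  · rw [SchwartzMap.toLp_fourier_eq, wsq_congr (SchwartzMap.coeFn_toLp _ 2 volume)]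
    exact wsq_schwartz_lt_top _ _
  · have h := hmom l
    rcases lt_or_gt_of_ne hl with h' | h'
    · rw [zero_pow (by omega), mul_zero] at h
      exact (mul_eq_zero.1 h).resolve_left (hne l)
    · rw [Nat.descFactorial_of_lt h', Nat.cast_zero, zero_mul] at h
      exact (mul_eq_zero.1 h).resolve_left (hne l)
  · have h := hmom n
    rw [h0, mul_zero, Nat.sub_self, pow_zero, mul_one, Nat.descFactorial_self] at h
    exact n.factorial_ne_zero (by exact_mod_cast h.symm)

/-! ### The zero mode at the critical exponents -/

/-- Cauchy–Schwarz. This midpoint log-convexity reaches a critical exponent from noncritical ones on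
both sides. -/
lemma wsq_sq_le (τ σ : ℝ) (u : L2R) : wsq ((τ + σ) / 2) u ^ 2 ≤ wsq τ u * wsq σ u := by
  have hm : Measurable fun x => ‖u x‖ₑ := (measurable_coe u).enorm
  have h1 : ∀ ρ x, (wt (ρ / 2) x * ‖u x‖ₑ) ^ 2 = wt ρ x * ‖u x‖ₑ ^ 2 := by
    intro ρ x
    rw [mul_pow, sq (wt _ _), ← wt_add, add_halves]
  have h2 := lintegral_mul_sq_le' ((measurable_wt (τ / 2)).mul hm).aemeasurable
    ((measurable_wt (σ / 2)).mul hm).aemeasurable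
  simp only [Pi.mul_apply, h1] at h2
  refine le_trans (le_of_eq ?_) h2
  rw [wsq]
  congr 2; ext x
  rw [add_div, wt_add]; ring

/-- The zero mode at an exponent `k + 3/2`, for functions with rapid decay. -/
lemma exists_wsq_psym_zero_le_of_forall {k : ℕ} {G : L2R} (hG : ∀ τ, wsq τ G < ∞)
    (hG' : ∀ τ, wsq τ (𝓕 G : L2R) < ∞)
    (hz : ∀ l : ℕ, l < k → ∫ x : ℝ, (x : ℂ) ^ l * G x = 0) :
    ∃ K : ℝ≥0, ∀ a : ℝ, wsq (k + 3 / 2) (FM (psym a 0) G) ≤ K * wt (k + 3 / 2) a := by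
  -- k + 5/4 and k + 7/4 are noncritical with midpoint k + 3/2. The upper one belongs to the range
  -- of index k + 1, whose zero-mode conditions are exactly the moments below k.
  obtain ⟨C, hC⟩ := exists_wsq_psym_zero_le (k := k) (θ := k + 5 / 4) (by linarith) (by linarith)
  obtain ⟨D, hD⟩ := exists_wsq_psym_zero_le (k := k + 1) (θ := k + 7 / 4) (by push_cast; linarith)
    (by push_cast; linarith)
  have hC' := fun a => hC a G (hG _) (hG' _) fun l hl => hz l (by omega)
  have hD' := fun a => hD a G (hG _) (hG' _) fun l hl => hz l (by omega)
  set M := wsq (k + 7 / 4) G + wsq (k + 7 / 4) (𝓕 G : L2R) with hM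
  have hMt : (C + D) * M ≠ ∞ := by
    have := (hG (k + 7 / 4)).ne
    have := (hG' (k + 7 / 4)).ne
    finiteness
  refine ⟨((C + D) * M).toNNReal, fun a => ?_⟩
  rw [ENNReal.coe_toNNReal hMt]
  have hle : wsq (k + 5 / 4) G + wsq (k + 5 / 4) (𝓕 G : L2R) ≤ M :=
    add_le_add (wsq_mono (by linarith) _) (wsq_mono (by linarith) _)
  have h1 : wsq (k + 5 / 4) (FM (psym a 0) G) ≤ (C + D) * M * wt (k + 5 / 4) a := by
    refine (hC' a).trans ?_
    calc _ ≤ (C + D) * wt (k + 5 / 4) a * M := by gcongr; exact le_self_add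
      _ = _ := by ring
  have h2 : wsq (k + 7 / 4) (FM (psym a 0) G) ≤ (C + D) * M * wt (k + 7 / 4) a := by
    refine (hD' a).trans ?_
    calc _ ≤ (C + D) * wt (k + 7 / 4) a * M := by gcongr; exact le_add_self
      _ = _ := by ring
  have h3 := (wsq_sq_le (k + 5 / 4) (k + 7 / 4) (FM (psym a 0) G)).trans (mul_le_mul' h1 h2)
  rw [show ((k : ℝ) + 5 / 4 + (k + 7 / 4)) / 2 = k + 3 / 2 by ring] at h3
  have h4 : (C + D) * M * wt (k + 5 / 4) a * ((C + D) * M * wt (k + 7 / 4) a)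
      = ((C + D) * M * wt (k + 3 / 2) a) ^ 2 := by
    have : wt (k + 5 / 4) a * wt (k + 7 / 4) a = wt (k + 3 / 2) a ^ 2 := by
      rw [sq, ← wt_add, ← wt_add]; ring_nf
    rw [mul_pow, ← this]; ring
  rw [h4] at h3
  exact (ENNReal.pow_le_pow_left_iff two_ne_zero).1 h3

lemma wsq_sign_pow_mul_sub_smul_le {n : ℕ} {h G : L2R} (hh : wsq n h < ∞) (hG : wsq n G < ∞)
    (θ : ℝ) (c : ℂ) :
    wsq θ (FM sg (mulL (fun x : ℝ => (x : ℂ) ^ n) (h - c • G))) ≤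
      2 * wsq θ (FM sg (mulL (fun x : ℝ => (x : ℂ) ^ n) h)) +
        2 * (‖c‖ₑ ^ 2 * wsq θ (FM sg (mulL (fun x : ℝ => (x : ℂ) ^ n) G))) := by
  have hw : wsq n (h - c • G : L2R) < ∞ := by
    refine (wsq_sub_le _ _ _).trans_lt ?_
    rw [wsq_smul]
    have := hh.ne
    have := hG.ne
    rw [lt_top_iff_ne_top]
    finiteness
  have e : mulL (fun x : ℝ => (x : ℂ) ^ n) (h - c • G) =
      mulL (fun x : ℝ => (x : ℂ) ^ n) h - c • mulL (fun x : ℝ => (x : ℂ) ^ n) G := by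
    apply Lp.ext
    filter_upwards [coeFn_mulL (memLp_pow_mul hw), coeFn_mulL (memLp_pow_mul hh),
      coeFn_mulL (memLp_pow_mul hG), Lp.coeFn_sub h (c • G), Lp.coeFn_smul c G,
      Lp.coeFn_sub (mulL (fun x : ℝ => (x : ℂ) ^ n) h)
        (c • mulL (fun x : ℝ => (x : ℂ) ^ n) G),
      Lp.coeFn_smul c (mulL (fun x : ℝ => (x : ℂ) ^ n) G)] with x h1 h2 h3 h4 h5 h6 h7
    simp only [h1, h4, h5, h6, h7, h2, h3, Pi.sub_apply, Pi.smul_apply, smul_eq_mul]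
    ring
  rw [e, ← bddMeas_sg.fmCLM_apply, map_sub, map_smul, bddMeas_sg.fmCLM_apply,
    bddMeas_sg.fmCLM_apply]
  refine (wsq_sub_le _ _ _).trans ?_
  rw [wsq_smul]

/-- The zero mode at the critical exponents. -/
theorem exists_wsq_psym_zero_le_critical (k : ℕ) :
    ∃ C : ℝ≥0, ∀ (a : ℝ) (h : L2R), wsq (k + 3 / 2) h < ∞ →
      (∀ l : ℕ, l < k → ∫ x : ℝ, (x : ℂ) ^ l * h x = 0) →
      wsq (k + 3 / 2) (FM (psym a 0) h) ≤ C * wt (k + 3 / 2) a *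
        (wsq (k + 3 / 2) h +
          wsq (1 / 2) (FM sg (mulL (fun x : ℝ => (x : ℂ) ^ (k + 1)) h)) +
          wsq (k + 3 / 2) (𝓕 h : L2R)) := by
  have hk : (0 : ℝ) ≤ k := k.cast_nonneg
  obtain ⟨G, hG, hG', hz, hnz⟩ := exists_moment_corrector k
  set μ := ∫ x : ℝ, (x : ℂ) ^ k * G x with hμ
  obtain ⟨A, hA⟩ := exists_wsq_psym_le (θ := (k : ℝ) + 3 / 2) (by linarith)
  obtain ⟨D, hD⟩ := exists_wsq_sign_le_critical (k + 1)
  obtain ⟨K, hK⟩ := exists_wsq_psym_zero_le_of_forall (k := k) hG hG' fun l hl => hz l hl.ne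
  have eθ : ((k + 1 : ℕ) : ℝ) + 1 / 2 = k + 3 / 2 := by push_cast; ring
  rw [eθ] at hD
  set S := wsq (1 / 2) (FM sg (mulL (fun x : ℝ => (x : ℂ) ^ (k + 1)) G)) with hS
  -- Raise the critical weight 1/2 to the noncritical weight 1; the mean it requires of x^{k+1}G is
  -- the moment of order k + 1 of G, which vanishes.
  have hSt : S ≠ ∞ := by
    obtain ⟨B, hB⟩ := exists_wsq_sign_le (θ := 1) zero_le_one (fun l hl => by
      have h1 : (l : ℝ) = 1 / 2 := by linarith
      have h2 : (0 : ℝ) < l := by rw [h1]; norm_num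
      have h3 : (l : ℝ) < 1 := by rw [h1]; norm_num
      have h4 : 0 < l := by exact_mod_cast h2
      have h5 : l < 1 := by exact_mod_cast h3
      omega)
    have hw : wsq 1 (mulL (fun x : ℝ => (x : ℂ) ^ (k + 1)) G) < ∞ :=
      (wsq_pow_mul_le (hG _)).trans_lt (hG _)
    refine ((wsq_mono (by norm_num) _).trans_lt ((hB _ hw fun l hl => ?_).trans_lt
      (ENNReal.mul_lt_top (by simp) hw))).ne
    have hl0 : l = 0 := by
      have h3 : (l : ℝ) < 1 := by linarith
      have h5 : l < 1 := by exact_mod_cast h3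
      omega
    rw [← hz (k + 1) (by omega), hl0]
    refine integral_congr_ae ?_
    filter_upwards [coeFn_mulL (memLp_pow_mul (hG ((k + 1 : ℕ) : ℝ)))] with x hx
    rw [hx]; simp
  -- N bounds |c|² by the weighted norm of h through Cauchy–Schwarz on the k-th moment.
  set N := ‖μ⁻¹‖ₑ ^ 2 * ∫⁻ x : ℝ, wt (k - (k + 3 / 2)) x with hN
  have hNt : N ≠ ∞ := by
    have := (lintegral_wt_lt_top (θ := (k : ℝ) - (k + 3 / 2)) (by linarith)).ne
    finiteness
  set W := wsq (k + 3 / 2) G with hW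
  set W' := wsq (k + 3 / 2) (𝓕 G : L2R) with hW'
  have hWt : W ≠ ∞ := (hG _).ne
  have hWt' : W' ≠ ∞ := (hG' _).ne
  set Q := 2 * A * (2 + 2 * D + 2 * N * (W + D * W + D * S + W')) + 2 * N * K with hQ
  have hQt : Q ≠ ∞ := by rw [hQ]; finiteness
  refine ⟨Q.toNNReal, fun a h hw hm => ?_⟩
  rw [ENNReal.coe_toNNReal hQt]
  -- Chosen so that h - cG also loses its k-th moment. All moments up to k then vanish, as commuting
  -- x^{k+1} with S demands, while the lower ones are undisturbed by G.
  set c := (∫ x : ℝ, (x : ℂ) ^ k * h x) * μ⁻¹ with hc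
  set X := wsq (k + 3 / 2) h with hX
  set Y := wsq (1 / 2) (FM sg (mulL (fun x : ℝ => (x : ℂ) ^ (k + 1)) h)) with hY
  set Z := wsq (k + 3 / 2) (𝓕 h : L2R) with hZ
  have hcN : ‖c‖ₑ ^ 2 ≤ N * X := by
    rw [hc, enorm_mul, mul_pow, hN]
    have h1 : ‖∫ x : ℝ, (x : ℂ) ^ k * h x‖ₑ ^ 2 ≤ (∫⁻ x : ℝ, wt (k - (k + 3 / 2)) x) * X :=
      (pow_le_pow_left' (enorm_integral_le_lintegral_enorm _) 2).trans
        (lintegral_pow_mul_sq_le k _ (measurable_coe h).aemeasurable)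
    calc _ ≤ (∫⁻ x : ℝ, wt (k - (k + 3 / 2)) x) * X * ‖μ⁻¹‖ₑ ^ 2 := mul_le_mul_left h1 _
      _ = _ := by ring
  have hint : ∀ (u : L2R), wsq (k + 3 / 2) u < ∞ → ∀ l ≤ k,
      Integrable fun x : ℝ => (x : ℂ) ^ l * u x := by
    intro u hu l hl
    refine integrable_pow_mul (θ := k + 3 / 2) ?_ (Lp.aestronglyMeasurable u) hu
    have : (l : ℝ) ≤ k := by exact_mod_cast hl
    linarith
  set u := h - c • G with hu
  have hX1 : wsq (k + 3 / 2) u ≤ 2 * X + 2 * (N * X * W) := by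
    refine (wsq_sub_le _ _ _).trans ?_
    rw [wsq_smul]
    exact add_le_add le_rfl (mul_le_mul_right (mul_le_mul_left hcN _) _)
  have hZ1 : wsq (k + 3 / 2) (𝓕 u : L2R) ≤ 2 * Z + 2 * (N * X * W') := by
    rw [hu, coe_fourier_sub, coe_fourier_smul]
    refine (wsq_sub_le _ _ _).trans ?_
    rw [wsq_smul]
    exact add_le_add le_rfl (mul_le_mul_right (mul_le_mul_left hcN _) _)
  have hut : wsq (k + 3 / 2) u < ∞ := by
    refine hX1.trans_lt ?_
    have := hw.ne
    rw [lt_top_iff_ne_top]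
    finiteness
  have hum : ∀ l < k + 1, ∫ x : ℝ, (x : ℂ) ^ l * u x = 0 := by
    intro l hl
    have h1 : ∫ x : ℝ, (x : ℂ) ^ l * u x
        = (∫ x : ℝ, (x : ℂ) ^ l * h x) - c * ∫ x : ℝ, (x : ℂ) ^ l * G x := by
      rw [← integral_const_mul, ← integral_sub (hint h hw l (by omega))
        ((hint G (hG _) l (by omega)).const_mul c)]
      refine integral_congr_ae ?_
      filter_upwards [Lp.coeFn_sub h (c • G), Lp.coeFn_smul c G] with x h1 h2
      rw [hu, h1, Pi.sub_apply, h2, Pi.smul_apply, smul_eq_mul]; ring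
    rw [h1]
    rcases (Nat.lt_succ_iff.1 hl).lt_or_eq with h2 | rfl
    · rw [hm l h2, hz l h2.ne]; simp
    · rw [← hμ, hc, mul_assoc, inv_mul_cancel₀ hnz, mul_one, sub_self]
  have hY1 : wsq (1 / 2) (FM sg (mulL (fun x : ℝ => (x : ℂ) ^ (k + 1)) u)) ≤
      2 * Y + 2 * (N * X * S) := by
    refine (wsq_sign_pow_mul_sub_smul_le ((wsq_mono ?_ _).trans_lt hw) (hG _) _ c).trans
      (add_le_add le_rfl (mul_le_mul_right (mul_le_mul_left hcN _) _))
    push_cast; linarith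
  have hSu : wsq (k + 3 / 2) (FM sg u) ≤
      D * ((2 * X + 2 * (N * X * W)) + (2 * Y + 2 * (N * X * S))) :=
    (hD u hut hum).trans (mul_le_mul_right (add_le_add hX1 hY1) _)
  have hAu := (hA a 0 u).trans (mul_le_mul_right (add_le_add (add_le_add hX1 hSu) hZ1) _)
  have e : FM (psym a 0) h = FM (psym a 0) u + c • FM (psym a 0) G := by
    rw [← (bddMeas_psym a 0).fmCLM_apply, ← (bddMeas_psym a 0).fmCLM_apply,
      ← (bddMeas_psym a 0).fmCLM_apply, hu, map_sub, map_smul]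
    abel
  rw [e]
  refine (wsq_add_le _ _ _).trans ?_
  rw [wsq_smul]
  refine (add_le_add (mul_le_mul_right hAu 2)
    (mul_le_mul_right (mul_le_mul' hcN (hK a)) 2)).trans ?_
  set w := wt (k + 3 / 2) a with hw
  calc _ = w * ((2 * A * (2 + 2 * D + 2 * N * (W + D * W + D * S + W')) + 2 * N * K) * X
          + 2 * A * (2 * D) * Y + 2 * A * 2 * Z) := by ring
    _ ≤ w * (Q * X + Q * Y + Q * Z) := by
        refine mul_le_mul_right (add_le_add (add_le_add le_rfl (mul_le_mul_left ?_ _))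
          (mul_le_mul_left ?_ _)) _
        · rw [hQ]
          refine le_trans (mul_le_mul_right ?_ _) le_self_add
          rw [add_comm 2, add_assoc]; exact le_self_add
        · rw [hQ]
          refine le_trans (mul_le_mul_right ?_ _) le_self_add
          rw [add_assoc]; exact le_self_add
    _ = Q * w * (X + Y + Z) := by ring

/-! ### Fourier series in the periodic variable -/

/-- The `η`-th Fourier coefficient in `y` of a function on the cylinder, as a function of `x`. -/
def ymode (f : L2Cyl) (η : ℤ) : L2R := 𝓕⁻ (fourierCyl f η)

lemma fourier_ymode (f : L2Cyl) (η : ℤ) : 𝓕 (ymode f η) = fourierCyl f η :=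
  fourier_fourierInv_eq _

/-- Taking modes is adjoint to embedding a mode. This links the abstract Hilbert sum, where
multipliers are diagonal, to integrals over slices, where weights in x are visible. -/
lemma inner_mode_eq (η : ℤ) (g : L2R) (f : L2Cyl) : ⟪mode η g, f⟫_ℂ = ⟪g, ymode f η⟫_ℂ := by
  have h1 : mode η g = fourierCyl.symm (lp.single 2 η (𝓕 g : L2R)) := by
    rw [fourierCyl, isHilbertSum_synthesis.linearIsometryEquiv_symm_apply_single]
    change _ = mode η ((Lp.fourierTransformₗᵢ ℝ ℂ).symm ((Lp.fourierTransformₗᵢ ℝ ℂ) g))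
    rw [LinearIsometryEquiv.symm_apply_apply]
  rw [h1, ← fourierCyl.inner_map_map, LinearIsometryEquiv.apply_symm_apply, lp.inner_single_left,
    ← fourier_ymode, Lp.inner_fourier_eq]

lemma memLp_prod (f : L2Cyl) : MemLp f 2 ((volume : Measure ℝ).prod
    (volume : Measure (AddCircle (2 * Real.pi)))) := Lp.memLp f

lemma lintegral_prod_sq_lt_top (f : L2Cyl) :
    ∫⁻ p : Cyl, ‖f p‖ₑ ^ 2 ∂((volume : Measure ℝ).prod volume) < ∞ := by
  have := lintegral_rpow_enorm_lt_top_of_eLpNorm_lt_top (by simp) (by simp) (memLp_prod f).2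
  simpa using this

lemma ae_memLp_slice (f : L2Cyl) : ∀ᵐ x : ℝ, MemLp (fun y => f (x, y)) 2 volume := by
  have hf := memLp_prod f
  have h1 : ∀ᵐ x : ℝ, AEStronglyMeasurable (fun y => f (x, y)) volume := hf.1.prodMk_left
  have h2 := lintegral_prod_sq_lt_top f
  rw [lintegral_prod _ (hf.1.enorm.pow_const 2)] at h2
  have h3 := ae_lt_top' (hf.1.enorm.pow_const 2).lintegral_prod_right' h2.ne
  filter_upwards [h1, h3] with x hx1 hx3
  refine ⟨hx1, ?_⟩
  rw [eLpNorm_lt_top_iff_lintegral_rpow_enorm_lt_top (by simp) (by simp)]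
  simpa using hx3

lemma continuous_conj_fourier (n : ℤ) :
    Continuous fun p : Cyl => starRingEnd ℂ (fourier n p.2 : ℂ) :=
  Complex.continuous_conj.comp ((fourier n).continuous.comp continuous_snd)

/-- The `η`-th mode is given by the Fourier coefficients of the slices. -/
lemma ymode_ae_eq (f : L2Cyl) (η : ℤ) : ymode f η =ᵐ[volume] fun x =>
    (((Real.sqrt (2 * Real.pi))⁻¹ : ℝ) : ℂ) * ∫ y, starRingEnd ℂ (fourier η y) * f (x, y) := by
  have hint : ∀ s : Set ℝ, MeasurableSet s → volume s < ∞ →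
      Integrable (fun p : Cyl => starRingEnd ℂ (fourier η p.2) * f p)
        ((volume.restrict s).prod volume) := by
    intro s hs hsf
    have : IsFiniteMeasure (volume.restrict s) := ⟨by simpa using hsf⟩
    have hle : (volume.restrict s).prod (volume : Measure (AddCircle (2 * Real.pi)))
        ≤ (volume : Measure ℝ).prod volume := by
      rw [show (volume.restrict s).prod (volume : Measure (AddCircle (2 * Real.pi)))
        = ((volume : Measure ℝ).prod volume).restrict (s ×ˢ Set.univ) by
          rw [← Measure.prod_restrict, Measure.restrict_univ]]
      exact Measure.restrict_le_self
    have hfi := ((memLp_prod f).mono_measure hle).integrable (by norm_num)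
    refine hfi.bdd_mul (c := 1) (continuous_conj_fourier η).aestronglyMeasurable
      (Eventually.of_forall fun p => ?_)
    rw [RCLike.norm_conj, norm_fourier_apply]
  refine ae_eq_of_forall_setIntegral_eq_of_sigmaFinite ?_ ?_ ?_
  · intro s hs hsf
    have : IsFiniteMeasure (volume.restrict s) := ⟨by simpa using hsf⟩
    exact ((Lp.memLp (ymode f η)).mono_measure Measure.restrict_le_self).integrable (by norm_num)
  · intro s hs hsf
    exact (hint s hs hsf).integral_prod_left.const_mul _
  · intro s hs hsf
    -- Integrating the mode over s is pairing it with an indicator, which the adjoint relation moves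
    -- to the cylinder.
    rw [← L2.inner_indicatorConstLp_one (𝕜 := ℂ) hs hsf.ne, ← inner_mode_eq, inner_mode,
      integral_const_mul, ← integral_const_mul, ← integral_indicator hs]
    apply integral_congr_ae
    filter_upwards [indicatorConstLp_coeFn (p := 2) (hs := hs) (hμs := hsf.ne) (c := (1 : ℂ))]
      with x hx
    simp only [modeFun, hx]
    by_cases hxs : x ∈ s
    · simp only [hxs, Set.indicator_of_mem, mul_one, map_mul, Complex.conj_ofReal]
      rw [← integral_const_mul]
      congr 1; ext y; ring
    · simp [hxs]

/-- Parseval's identity on the circle of length `2π`. -/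
lemma circle_parseval {u : AddCircle (2 * Real.pi) → ℂ} (hu : MemLp u 2 volume) :
    ∫⁻ y, ‖u y‖ₑ ^ 2 = ∑' η : ℤ, ‖(((Real.sqrt (2 * Real.pi))⁻¹ : ℝ) : ℂ) *
      ∫ y, starRingEnd ℂ (fourier η y) * u y‖ₑ ^ 2 := by
  have hu' : MemLp u 2 AddCircle.haarAddCircle := memLp_haarAddCircle_iff.2 hu
  have hs := hasSum_sq_fourierCoeff (hu'.toLp u)
  have e : (∫ t, ‖hu'.toLp u t‖ ^ 2 ∂AddCircle.haarAddCircle)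
      = ∫ t, ‖u t‖ ^ 2 ∂AddCircle.haarAddCircle := by
    apply integral_congr_ae
    filter_upwards [MemLp.coeFn_toLp hu'] with t ht
    rw [ht]
  rw [e] at hs
  have hi : Integrable (fun t => ‖u t‖ ^ 2) (AddCircle.haarAddCircle (T := 2 * Real.pi)) :=
    hu'.integrable_norm_pow (by norm_num)
  have h1 : ∫⁻ y, ‖u y‖ₑ ^ 2 ∂AddCircle.haarAddCircle
      = ∑' η : ℤ, ‖fourierCoeff (hu'.toLp u) η‖ₑ ^ 2 := by
    have h2 := congrArg ENNReal.ofReal hs.tsum_eq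
    rw [ENNReal.ofReal_tsum_of_nonneg (fun _ => by positivity) hs.summable,
      ofReal_integral_eq_lintegral_ofReal hi (Eventually.of_forall fun _ => by positivity)] at h2
    simp only [ENNReal.ofReal_pow (norm_nonneg _), ofReal_norm] at h2
    exact h2.symm
  rw [AddCircle.volume_eq_smul_haarAddCircle, lintegral_smul_measure, h1, smul_eq_mul,
    ← ENNReal.tsum_mul_left]
  congr 1; ext η
  have hc : fourierCoeff (hu'.toLp u) η
      = ∫ y, starRingEnd ℂ (fourier η y) * u y ∂AddCircle.haarAddCircle := by
    rw [fourierCoeff_congr_ae (MemLp.coeFn_toLp hu'), fourierCoeff]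
    congr 1; ext y; rw [fourier_neg, smul_eq_mul]
  rw [hc, integral_smul_measure, ENNReal.toReal_ofReal Real.two_pi_pos.le]
  -- The measure is 2π times Haar measure, so each coefficient carries 2π(2π)^{-1/2}, whose square
  -- is the factor 2π on the left.
  rw [Complex.real_smul, ← mul_assoc, enorm_mul, mul_pow]
  congr 1
  rw [← Complex.ofReal_mul, ← ofReal_norm, Complex.norm_real, Real.norm_of_nonneg (by positivity),
    ← ENNReal.ofReal_pow (by positivity)]
  congr 1
  rw [mul_pow, inv_pow, Real.sq_sqrt (by positivity)]
  field_simp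

lemma lintegral_slice_sq (f : L2Cyl) :
    ∀ᵐ x : ℝ, ∫⁻ y : AddCircle (2 * Real.pi), ‖f (x, y)‖ₑ ^ 2 = ∑' η : ℤ, ‖ymode f η x‖ₑ ^ 2 := by
  filter_upwards [ae_memLp_slice f, ae_all_iff.2 fun η => ymode_ae_eq f η] with x h1 h2
  rw [circle_parseval h1]
  simp only [h2]

lemma wsq_eq_lintegral_sq (θ : ℝ) (h : ℝ → ℂ) :
    wsq θ h = ∫⁻ x : ℝ, (ENNReal.ofReal (bracket x ^ θ) * ‖h x‖ₑ) ^ 2 := by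
  rw [wsq]
  congr 1; ext x
  rw [mul_pow, wt, ← ENNReal.ofReal_pow (Real.rpow_nonneg (bracket_pos x).le _),
    ← Real.rpow_mul_natCast (bracket_pos x).le, mul_comm 2 θ]
  norm_num

lemma weightedNorm_sq_eq_lintegral (θ : ℝ) (f : L2Cyl) :
    weightedNorm θ f ^ 2 = ∫⁻ p : Cyl, wt θ p.1 * ‖f p‖ₑ ^ 2 := by
  rw [weightedNorm, eLpNorm_eq_lintegral_rpow_enorm_toReal (by simp) (by simp)]
  simp only [ENNReal.toReal_ofNat, ENNReal.rpow_ofNat]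
  rw [← ENNReal.rpow_ofNat, ← ENNReal.rpow_mul]
  norm_num
  congr 1; ext p
  rw [mul_pow, wt, ← ofReal_norm (((bracket p.1 ^ θ : ℝ) : ℂ)), Complex.norm_real,
    Real.norm_of_nonneg (Real.rpow_nonneg (bracket_pos _).le _), ← ENNReal.ofReal_pow
    (Real.rpow_nonneg (bracket_pos _).le _), ← Real.rpow_mul_natCast (bracket_pos _).le,
    mul_comm 2 θ]
  norm_num

/-- The weighted norm on the cylinder as a sum over the modes. -/
theorem weightedNorm_sq (θ : ℝ) (f : L2Cyl) :
    weightedNorm θ f ^ 2 = ∑' η : ℤ, wsq θ (ymode f η) := by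
  have hm : AEMeasurable (fun p : Cyl => wt θ p.1 * ‖f p‖ₑ ^ 2)
      ((volume : Measure ℝ).prod volume) :=
    ((measurable_wt θ).comp measurable_fst).aemeasurable.mul ((memLp_prod f).1.enorm.pow_const 2)
  rw [weightedNorm_sq_eq_lintegral]
  refine (lintegral_prod _ hm).trans ?_
  have h1 : ∀ η : ℤ, AEMeasurable (fun x : ℝ => wt θ x * ‖ymode f η x‖ₑ ^ 2) volume := fun η =>
    ((measurable_wt θ).mul ((measurable_coe _).enorm.pow_const 2)).aemeasurable
  simp only [wsq]
  rw [← lintegral_tsum h1]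
  refine lintegral_congr_ae ?_
  filter_upwards [lintegral_slice_sq f, ae_memLp_slice f] with x hx hx'
  rw [lintegral_const_mul'' _ (hx'.1.enorm.pow_const 2), hx, ENNReal.tsum_mul_left]

lemma wsq_ymode_le (θ : ℝ) (f : L2Cyl) (η : ℤ) : wsq θ (ymode f η) ≤ weightedNorm θ f ^ 2 := by
  rw [weightedNorm_sq]; exact ENNReal.le_tsum η

lemma bracket_mono {a b : ℝ} (h : |a| ≤ |b|) : bracket a ≤ bracket b := by
  have := sq_le_sq.2 h
  unfold bracket
  gcongr

/-- The weight ⟨v⟩ is at most ⟨2πv⟩ = ⟨ξ⟩, and the y part of the Sobolev norm is dropped. -/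
lemma tsum_wsq_fourier_le {θ : ℝ} (hθ : 0 ≤ θ) (f : L2Cyl) :
    ∑' η : ℤ, wsq θ (𝓕 (ymode f η) : L2R) ≤ sobolevNorm θ 0 f ^ 2 := by
  set R := ∑' η : ℤ, ∫⁻ v : ℝ,
    (ENNReal.ofReal (bracket (2 * Real.pi * v) ^ θ) * ‖fourierCyl f η v‖ₑ) ^ 2 with hR
  have h1 : ∑' η : ℤ, wsq θ (𝓕 (ymode f η) : L2R) ≤ R := by
    refine ENNReal.tsum_le_tsum fun η => ?_
    rw [fourier_ymode, wsq_eq_lintegral_sq]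
    refine lintegral_mono fun v => ?_
    have h2 : bracket v ≤ bracket (2 * Real.pi * v) := by
      apply bracket_mono
      rw [abs_mul, abs_of_pos Real.two_pi_pos]
      have := Real.pi_gt_three
      nlinarith [abs_nonneg v]
    have := (bracket_pos v).le
    dsimp only
    gcongr
  refine h1.trans ?_
  have h3 : R = (R ^ (1 / 2 : ℝ)) ^ 2 := by
    rw [← ENNReal.rpow_ofNat, ← ENNReal.rpow_mul]; norm_num
  rw [h3]
  exact pow_le_pow_left' le_self_add 2

lemma weightedNorm_lt_top {θ : ℝ} (hθ : 0 ≤ θ) {f : L2Cyl} (hf : InWeightedL2 θ f) :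
    weightedNorm θ f < ∞ := by
  have h1 : weightedNorm θ f ^ 2 < ∞ := by
    rw [weightedNorm_sq_eq_lintegral]
    have hb : ∀ p : Cyl, wt θ p.1 * ‖f p‖ₑ ^ 2 ≤ ENNReal.ofReal (2 ^ θ) *
        (‖f p‖ₑ ^ 2 + ENNReal.ofReal (|p.1| ^ (2 * θ)) * ‖f p‖ₑ ^ 2) := by
      intro p
      have h2 : (1 + p.1 ^ 2) ^ θ ≤ 2 ^ θ * (1 + |p.1| ^ (2 * θ)) := by
        have e : |p.1| ^ (2 * θ) = (p.1 ^ 2) ^ θ := by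
          rw [Real.rpow_mul (abs_nonneg _)]; norm_num
        rw [e]
        rcases le_total (p.1 ^ 2) 1 with h | h
        · calc (1 + p.1 ^ 2) ^ θ ≤ 2 ^ θ := by gcongr; linarith
            _ ≤ _ := le_mul_of_one_le_right (by positivity)
              (le_add_of_nonneg_right (by positivity))
        · calc (1 + p.1 ^ 2) ^ θ ≤ (2 * p.1 ^ 2) ^ θ := by gcongr; linarith
            _ = 2 ^ θ * (p.1 ^ 2) ^ θ := Real.mul_rpow (by norm_num) (by positivity)
            _ ≤ _ := by gcongr; linarith
      have h3 : wt θ p.1 ≤ ENNReal.ofReal (2 ^ θ) * (1 + ENNReal.ofReal (|p.1| ^ (2 * θ))) := by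
        rw [wt_eq, ← ENNReal.ofReal_one, ← ENNReal.ofReal_add zero_le_one (by positivity),
          ← ENNReal.ofReal_mul (by positivity)]
        exact ENNReal.ofReal_le_ofReal h2
      calc _ ≤ ENNReal.ofReal (2 ^ θ) * (1 + ENNReal.ofReal (|p.1| ^ (2 * θ))) * ‖f p‖ₑ ^ 2 :=
            mul_le_mul_left h3 _
        _ = _ := by ring
    have hm : AEMeasurable (fun p : Cyl => ‖f p‖ₑ ^ 2) volume :=
      (Lp.aestronglyMeasurable f).enorm.pow_const 2
    refine (lintegral_mono hb).trans_lt ?_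
    rw [lintegral_const_mul' _ _ ENNReal.ofReal_ne_top, lintegral_add_left' hm]
    exact ENNReal.mul_lt_top ENNReal.ofReal_lt_top
      (ENNReal.add_lt_top.2 ⟨lintegral_prod_sq_lt_top f, hf⟩)
  by_contra h
  rw [not_lt_top_iff.1 h] at h1
  simp at h1

/-- The moments of a function on the cylinder are the moments of its modes. -/
lemma moment_eq {θ : ℝ} {l : ℕ} (hl : l + 1 / 2 < θ) {f : L2Cyl} (hf : weightedNorm θ f < ∞)
    (η : ℤ) : moment l η f = (Real.sqrt (2 * Real.pi) : ℂ) *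
      ∫ x : ℝ, (x : ℂ) ^ l * ymode f η x := by
  have hθf : MemLp (fun p : Cyl => ((bracket p.1 ^ θ : ℝ) : ℂ) * f p) 2
      ((volume : Measure ℝ).prod volume) := by
    refine ⟨AEStronglyMeasurable.mul ?_ (memLp_prod f).1, hf⟩
    exact (Complex.measurable_ofReal.comp
      ((measurable_bracket.comp measurable_fst).pow_const θ)).aestronglyMeasurable
  -- Fubini needs absolute integrability, obtained by pairing ⟨x⟩^θ f with x^l⟨x⟩^{-θ}; the latter
  -- is square integrable because l + 1/2 < θ.
  have hw : MemLp (fun p : Cyl => starRingEnd ℂ (fourier η p.2 : ℂ) *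
      ((p.1 : ℂ) ^ l * ((bracket p.1 ^ (-θ) : ℝ) : ℂ))) 2 ((volume : Measure ℝ).prod volume) := by
    have hm : Measurable fun p : Cyl => starRingEnd ℂ (fourier η p.2 : ℂ) *
        ((p.1 : ℂ) ^ l * ((bracket p.1 ^ (-θ) : ℝ) : ℂ)) :=
      (continuous_conj_fourier η).measurable.mul
        (((Complex.measurable_ofReal.comp measurable_fst).pow_const l).mul
        (Complex.measurable_ofReal.comp ((measurable_bracket.comp measurable_fst).pow_const (-θ))))
    refine ⟨hm.aestronglyMeasurable, ?_⟩
    rw [eLpNorm_lt_top_iff_lintegral_rpow_enorm_lt_top (by simp) (by simp)]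
    simp only [ENNReal.toReal_ofNat, ENNReal.rpow_ofNat]
    have hb : ∀ p : Cyl, ‖starRingEnd ℂ (fourier η p.2 : ℂ) *
        ((p.1 : ℂ) ^ l * ((bracket p.1 ^ (-θ) : ℝ) : ℂ))‖ₑ ^ 2 ≤ wt (l - θ) p.1 := by
      intro p
      have h1 : ‖starRingEnd ℂ (fourier η p.2 : ℂ)‖ₑ = 1 := by
        rw [← ofReal_norm, RCLike.norm_conj, norm_fourier_apply, ENNReal.ofReal_one]
      have h2 : ‖((bracket p.1 ^ (-θ) : ℝ) : ℂ)‖ₑ ^ 2 = wt (-θ) p.1 := by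
        rw [wt, ← ofReal_norm, Complex.norm_real, Real.norm_of_nonneg
          (Real.rpow_nonneg (bracket_pos _).le _), ← ENNReal.ofReal_pow
          (Real.rpow_nonneg (bracket_pos _).le _), ← Real.rpow_mul_natCast (bracket_pos _).le,
          mul_comm 2 (-θ)]
        norm_num
      rw [enorm_mul, h1, one_mul, enorm_mul, mul_pow, h2, sub_eq_add_neg, wt_add]
      exact mul_le_mul_left (enorm_pow_sq_le_wt l p.1) _
    refine (lintegral_mono hb).trans_lt ?_
    rw [lintegral_prod (fun p : Cyl => wt (l - θ) p.1)
      ((measurable_wt _).comp measurable_fst).aemeasurable]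
    simp only [lintegral_const]
    rw [lintegral_mul_const _ (measurable_wt _)]
    exact ENNReal.mul_lt_top (lintegral_wt_lt_top (by linarith)) (measure_lt_top _ _)
  have hi : Integrable (fun p : Cyl => fourier (-η) p.2 * (p.1 : ℂ) ^ l * f p)
      ((volume : Measure ℝ).prod volume) := by
    refine (hw.integrable_mul hθf).congr (Eventually.of_forall fun p => ?_)
    have h3 : ((bracket p.1 ^ (-θ) : ℝ) : ℂ) * ((bracket p.1 ^ θ : ℝ) : ℂ) = 1 := by
      rw [← Complex.ofReal_mul, ← Real.rpow_add (bracket_pos _), neg_add_cancel, Real.rpow_zero,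
        Complex.ofReal_one]
    simp only [Pi.mul_apply]
    rw [_root_.fourier_neg]
    linear_combination (starRingEnd ℂ (fourier η p.2 : ℂ) * (p.1 : ℂ) ^ l * f p) * h3
  rw [moment, ← integral_const_mul]
  refine (integral_prod _ hi).trans ?_
  refine integral_congr_ae ?_
  filter_upwards [ymode_ae_eq f η] with x hx
  have hs : (Real.sqrt (2 * Real.pi) : ℂ) * (((Real.sqrt (2 * Real.pi))⁻¹ : ℝ) : ℂ) = 1 := by
    rw [← Complex.ofReal_mul, mul_inv_cancel₀ (by positivity), Complex.ofReal_one]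
  have h4 : ∫ y : AddCircle (2 * Real.pi), fourier (-η) y * (x : ℂ) ^ l * f (x, y)
      = (x : ℂ) ^ l * ∫ y, starRingEnd ℂ (fourier η y) * f (x, y) := by
    rw [← integral_const_mul]
    congr 1; ext y
    rw [_root_.fourier_neg]; ring
  rw [hx]
  refine h4.trans ?_
  linear_combination -((x : ℂ) ^ l * ∫ y, starRingEnd ℂ (fourier η y) * f (x, y)) * hs

lemma integral_pow_mul_ymode_eq_zero {θ : ℝ} {l : ℕ} (hl : l + 1 / 2 < θ) {f : L2Cyl}
    (hf : weightedNorm θ f < ∞) {η : ℤ} (hz : moment l η f = 0) :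
    ∫ x : ℝ, (x : ℂ) ^ l * ymode f η x = 0 := by
  rw [moment_eq hl hf] at hz
  refine (mul_eq_zero.1 hz).resolve_left ?_
  have : 0 < Real.sqrt (2 * Real.pi) := by positivity
  exact_mod_cast this.ne'

/-! ### Fourier multipliers on the modes -/

lemma fourier_ymode_multiplier {m : ℝ → ℤ → ℂ} (hm : IsSymbol m) (f : L2Cyl) (η : ℤ) :
    (𝓕 (ymode (multiplier hm f) η) : L2R) =ᵐ[volume]
      fun v => m (2 * Real.pi * v) η * (𝓕 (ymode f η) : L2R) v := by
  rw [fourier_ymode, fourier_ymode, multiplier, LinearIsometryEquiv.apply_symm_apply]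
  exact (hm.memLp (fourierCyl f η) η).coeFn_toLp

lemma sign_two_pi_mul (v : ℝ) : Real.sign (2 * Real.pi * v) = Real.sign v := by
  rcases lt_trichotomy v 0 with h | rfl | h
  · rw [Real.sign_of_neg h, Real.sign_of_neg (mul_neg_of_pos_of_neg Real.two_pi_pos h)]
  · simp
  · rw [Real.sign_of_pos h, Real.sign_of_pos (mul_pos Real.two_pi_pos h)]

/-- With ξ = 2πv the quadratic coefficient is 4π²t, common to all modes; η enters only through the
constant tη². -/
lemma ymode_U (t : ℝ) (f : L2Cyl) (η : ℤ) :
    ymode (U t f) η = FM (psym (4 * Real.pi ^ 2 * t) (t * (η : ℝ) ^ 2)) (ymode f η) := by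
  apply eq_of_fourier_ae_eq
  filter_upwards [fourier_ymode_multiplier (isSymbol_group t) f η,
    (bddMeas_psym (4 * Real.pi ^ 2 * t) (t * (η : ℝ) ^ 2)).coeFn_fourier_FM (ymode f η)]
    with v h1 h2
  rw [h2]
  refine h1.trans ?_
  rw [psym, dispersion, sign_two_pi_mul]
  have e : t * (Real.sign v * (2 * Real.pi * v) ^ 2 + Real.sign v * (η : ℝ) ^ 2)
      = Real.sign v * (4 * Real.pi ^ 2 * t * v ^ 2 + t * (η : ℝ) ^ 2) := by ring
  rw [e]

lemma ymode_hilbertX (f : L2Cyl) (η : ℤ) :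
    ymode (hilbertX f) η = (-Complex.I) • FM sg (ymode f η) := by
  apply eq_of_fourier_ae_eq
  rw [coe_fourier_smul]
  filter_upwards [fourier_ymode_multiplier isSymbol_hilbert f η,
    bddMeas_sg.coeFn_fourier_FM (ymode f η),
    Lp.coeFn_smul (-Complex.I) (𝓕 (FM sg (ymode f η)) : L2R)] with v h1 h2 h3
  rw [h3, Pi.smul_apply, h2]
  refine h1.trans ?_
  rw [sign_two_pi_mul, smul_eq_mul, sg]; ring

lemma weightedNorm_hilbertX_sq (θ : ℝ) (f : L2Cyl) :
    weightedNorm θ (hilbertX f) ^ 2 = ∑' η : ℤ, wsq θ (FM sg (ymode f η)) := by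
  rw [weightedNorm_sq]
  congr 1; ext η
  rw [ymode_hilbertX, wsq_smul]
  simp [← ofReal_norm]

/-- The factor x^k leaves the slice integrals. Since g is in L², its modes supply the square
integrability without which `mulL` would default to zero. -/
lemma ymode_pow_mul {f g : L2Cyl} {k : ℕ} (h : ∀ᵐ p : Cyl, g p = (p.1 : ℂ) ^ k * f p) (η : ℤ) :
    ymode g η = mulL (fun x : ℝ => (x : ℂ) ^ k) (ymode f η) := by
  have h' : ∀ᵐ x : ℝ, ∀ᵐ y : AddCircle (2 * Real.pi), g (x, y) = (x : ℂ) ^ k * f (x, y) :=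
    Measure.ae_ae_of_ae_prod h
  have e : ymode g η =ᵐ[volume] fun x : ℝ => (x : ℂ) ^ k * ymode f η x := by
    filter_upwards [ymode_ae_eq f η, ymode_ae_eq g η, h'] with x h1 h2 h3
    have h4 : ∫ y : AddCircle (2 * Real.pi), starRingEnd ℂ (fourier η y) * g (x, y)
        = (x : ℂ) ^ k * ∫ y, starRingEnd ℂ (fourier η y) * f (x, y) := by
      rw [← integral_const_mul]
      apply integral_congr_ae
      filter_upwards [h3] with y hy
      rw [hy]; ring
    rw [h2, h1, h4]; ring
  have hm : MemLp (fun x : ℝ => (x : ℂ) ^ k * ymode f η x) 2 volume :=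
    (memLp_congr_ae e).1 (Lp.memLp _)
  exact Lp.ext (e.trans (coeFn_mulL hm).symm)

/-! ### From the modes to the cylinder -/

lemma bracket_mul_le {c : ℝ} (hc : 1 ≤ c) (t : ℝ) : bracket (c * t) ≤ c * bracket t := by
  have hb := (bracket_pos t).le
  rw [bracket, Real.sqrt_le_left (by positivity), bracket, mul_pow c (Real.sqrt _),
    Real.sq_sqrt (by positivity)]
  nlinarith

lemma one_le_four_mul_pi_sq : 1 ≤ 4 * Real.pi ^ 2 := by
  nlinarith [Real.pi_gt_three]

lemma wt_four_mul_pi_sq_le {θ : ℝ} (hθ : 0 ≤ θ) (t : ℝ) :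
    wt θ (4 * Real.pi ^ 2 * t) ≤ ENNReal.ofReal ((4 * Real.pi ^ 2) ^ θ * bracket t ^ θ) ^ 2 := by
  have hb := (bracket_pos t).le
  rw [wt, ← ENNReal.ofReal_pow (by positivity)]
  refine ENNReal.ofReal_le_ofReal ?_
  have h1 := Real.rpow_le_rpow (bracket_pos _).le (bracket_mul_le one_le_four_mul_pi_sq t)
    (show 0 ≤ 2 * θ by linarith)
  refine h1.trans (le_of_eq ?_)
  rw [← Real.mul_rpow (by positivity) hb, ← Real.rpow_mul_natCast (by positivity), mul_comm θ]
  norm_num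

/-- Uniform estimates on the modes sum up to an estimate on the cylinder. -/
lemma exists_weightedNorm_U_le {θ : ℝ} (hθ : 0 ≤ θ) (C : ℝ≥0) : ∃ K : ℝ, 0 < K ∧
    ∀ (f : L2Cyl) (t : ℝ) (A : ℤ → ℝ≥0∞) (B : ℝ≥0∞), ∑' η, A η ≤ B ^ 2 →
      (∀ η : ℤ, wsq θ (FM (psym (4 * Real.pi ^ 2 * t) (t * (η : ℝ) ^ 2)) (ymode f η)) ≤
        C * wt θ (4 * Real.pi ^ 2 * t) *
          (wsq θ (ymode f η) + A η + wsq θ (𝓕 (ymode f η) : L2R))) →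
      weightedNorm θ (U t f) ≤ ENNReal.ofReal (K * bracket t ^ θ) *
        (weightedNorm θ f + B + sobolevNorm θ 0 f) := by
  -- The square root because mode estimates are for squared norms; C + 1 keeps the constant positive
  -- when C = 0.
  refine ⟨Real.sqrt (C + 1) * (4 * Real.pi ^ 2) ^ θ, by positivity, fun f t A B hA h => ?_⟩
  have hb : 0 ≤ bracket t ^ θ := Real.rpow_nonneg (bracket_pos t).le _
  refine (ENNReal.pow_le_pow_left_iff two_ne_zero).1 ?_
  have hC : (C : ℝ≥0∞) ≤ ENNReal.ofReal (Real.sqrt (C + 1)) ^ 2 := by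
    rw [← ENNReal.ofReal_pow (by positivity), Real.sq_sqrt (by positivity),
      ← ENNReal.ofReal_coe_nnreal]
    exact ENNReal.ofReal_le_ofReal (by linarith)
  set X := weightedNorm θ f with hX
  set Z := sobolevNorm θ 0 f with hZ
  have hsum : ∑' η : ℤ, (wsq θ (ymode f η) + A η + wsq θ (𝓕 (ymode f η) : L2R)) ≤
      (X + B + Z) ^ 2 := by
    rw [ENNReal.tsum_add, ENNReal.tsum_add, ← weightedNorm_sq]
    refine (add_le_add (add_le_add le_rfl hA) (tsum_wsq_fourier_le hθ f)).trans ?_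
    have e : (X + B + Z) ^ 2 = X ^ 2 + B ^ 2 + Z ^ 2 + (2 * X * B + 2 * X * Z + 2 * B * Z) := by
      ring
    rw [e]; exact le_self_add
  calc weightedNorm θ (U t f) ^ 2
      = ∑' η : ℤ, wsq θ (FM (psym (4 * Real.pi ^ 2 * t) (t * (η : ℝ) ^ 2)) (ymode f η)) := by
        rw [weightedNorm_sq]; simp only [ymode_U]
    _ ≤ C * wt θ (4 * Real.pi ^ 2 * t) *
        ∑' η : ℤ, (wsq θ (ymode f η) + A η + wsq θ (𝓕 (ymode f η) : L2R)) := by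
        rw [← ENNReal.tsum_mul_left]; exact ENNReal.tsum_le_tsum h
    _ ≤ (ENNReal.ofReal (Real.sqrt (C + 1)) ^ 2 *
        ENNReal.ofReal ((4 * Real.pi ^ 2) ^ θ * bracket t ^ θ) ^ 2) * (X + B + Z) ^ 2 :=
        mul_le_mul' (mul_le_mul' hC (wt_four_mul_pi_sq_le hθ t)) hsum
    _ = (ENNReal.ofReal (Real.sqrt (C + 1) * (4 * Real.pi ^ 2) ^ θ * bracket t ^ θ) *
        (X + B + Z)) ^ 2 := by
        rw [mul_assoc (Real.sqrt _), ENNReal.ofReal_mul (Real.sqrt_nonneg _)]; ring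

lemma wsq_fourier_ymode_lt_top {θ : ℝ} (hθ : 0 ≤ θ) {f : L2Cyl} (hf : InSobolev θ 0 f) (η : ℤ) :
    wsq θ (𝓕 (ymode f η) : L2R) < ∞ :=
  ((ENNReal.le_tsum η).trans (tsum_wsq_fourier_le hθ f)).trans_lt (ENNReal.pow_lt_top hf)

lemma wsq_ymode_lt_top {θ : ℝ} {f : L2Cyl} (hf : weightedNorm θ f < ∞) (η : ℤ) :
    wsq θ (ymode f η) < ∞ :=
  (wsq_ymode_le θ f η).trans_lt (ENNReal.pow_lt_top hf)

/-- Away from the critical exponents, for functions with vanishing moments. -/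
lemma exists_wsq_psym_le_of_moments {θ : ℝ} (hθ : 0 ≤ θ) (hc : ∀ l : ℕ, θ ≠ l + 1 / 2) :
    ∃ C : ℝ≥0, ∀ (a b : ℝ) (h : L2R), wsq θ h < ∞ →
      (∀ l : ℕ, l + 1 / 2 < θ → ∫ x : ℝ, (x : ℂ) ^ l * h x = 0) →
      wsq θ (FM (psym a b) h) ≤ C * wt θ a * (wsq θ h + wsq θ (𝓕 h : L2R)) := by
  obtain ⟨A, hA⟩ := exists_wsq_psym_le hθ
  obtain ⟨D, hD⟩ := exists_wsq_sign_le hθ hc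
  refine ⟨A * (1 + D), fun a b h hw hm => (hA a b h).trans ?_⟩
  calc _ ≤ A * wt θ a * (wsq θ h + D * wsq θ h + wsq θ (𝓕 h : L2R)) :=
        mul_le_mul_right (add_le_add (add_le_add le_rfl (hD h hw hm)) le_rfl) _
    _ ≤ A * wt θ a * (wsq θ h + D * wsq θ h + wsq θ (𝓕 h : L2R)) +
        A * wt θ a * (D * wsq θ (𝓕 h : L2R)) := le_self_add
    _ = _ := by push_cast; ring

lemma ne_add_half {k : ℕ} {θ : ℝ} (h1 : k + 1 / 2 < θ) (h2 : θ < k + 3 / 2) (l : ℕ) :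
    θ ≠ l + 1 / 2 := by
  intro hl
  have h3 : (k : ℝ) < l := by linarith
  have h4 : (l : ℝ) < k + 1 := by linarith
  have h5 : k < l := by exact_mod_cast h3
  have h6 : l < k + 1 := by exact_mod_cast h4
  omega

/-! ### The estimates on the cylinder, by range of the exponent -/

theorem exists_weightedNorm_U_le_of_lt_half {θ : ℝ} (h0 : 0 < θ) (h1 : θ < 1 / 2) :
    ∃ C : ℝ, 0 < C ∧ ∀ f : L2Cyl, InSobolev θ 0 f → InWeightedL2 θ f →
      ∀ t : ℝ, weightedNorm θ (U t f) ≤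
        ENNReal.ofReal (C * bracket t ^ θ) * (weightedNorm θ f + sobolevNorm θ 0 f) := by
  obtain ⟨D, hD⟩ := exists_wsq_psym_le_of_moments h0.le fun l hl => by
    have : (0 : ℝ) ≤ l := l.cast_nonneg
    linarith
  obtain ⟨K, hK, h⟩ := exists_weightedNorm_U_le h0.le D
  refine ⟨K, hK, fun f _ hf t => ?_⟩
  have hw := weightedNorm_lt_top h0.le hf
  have h2 := h f t 0 0 (by simp) fun η => by
    rw [Pi.zero_apply, add_zero]
    refine hD _ _ _ (wsq_ymode_lt_top hw η) fun l hl => ?_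
    have : (0 : ℝ) ≤ l := l.cast_nonneg
    linarith
  rwa [add_zero] at h2

/-- The critical case of order zero: the general mode bound is summed directly, the Hilbert
transform having, mode by mode, the same modulus as S. -/
theorem exists_weightedNorm_U_le_half :
    ∃ C : ℝ, 0 < C ∧ ∀ (f : L2Cyl) (t : ℝ), weightedNorm (1 / 2) (U t f) ≤
      ENNReal.ofReal (C * bracket t ^ (1 / 2 : ℝ)) *
        (weightedNorm (1 / 2) f + weightedNorm (1 / 2) (hilbertX f) +
          sobolevNorm (1 / 2) 0 f) := by
  obtain ⟨D, hD⟩ := exists_wsq_psym_le (θ := 1 / 2) (by norm_num)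
  obtain ⟨K, hK, h⟩ := exists_weightedNorm_U_le (θ := 1 / 2) (by norm_num) D
  exact ⟨K, hK, fun f t => h f t _ _ (weightedNorm_hilbertX_sq _ f).ge fun η => hD _ _ _⟩

/-- Nonzero modes use all moments up to k, the zero mode only those up to k - 2; the two constants
are added to serve every mode. -/
theorem exists_weightedNorm_U_le_of_moments {k : ℕ} {θ : ℝ} (h1 : k + 1 / 2 < θ)
    (h2 : θ < k + 3 / 2) :
    ∃ C : ℝ, 0 < C ∧ ∀ f : L2Cyl, InSobolev θ 0 f → InWeightedL2 θ f →
      (∀ l : ℕ, l ≤ k → ∀ η : ℤ, η ≠ 0 → moment l η f = 0) →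
      (∀ l : ℕ, l + 2 ≤ k → moment l 0 f = 0) →
      ∀ t : ℝ, weightedNorm θ (U t f) ≤
        ENNReal.ofReal (C * bracket t ^ θ) * (weightedNorm θ f + sobolevNorm θ 0 f) := by
  have hk : (0 : ℝ) ≤ k := k.cast_nonneg
  have hθ : 0 ≤ θ := by linarith
  obtain ⟨D, hD⟩ := exists_wsq_psym_le_of_moments hθ (ne_add_half h1 h2)
  obtain ⟨E, hE⟩ := exists_wsq_psym_zero_le h1 h2
  obtain ⟨K, hK, h⟩ := exists_weightedNorm_U_le hθ (D + E)
  refine ⟨K, hK, fun f hs hf hm hm0 t => ?_⟩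
  have hw := weightedNorm_lt_top hθ hf
  have hlt : ∀ l : ℕ, l ≤ k → (l : ℝ) + 1 / 2 < θ := by
    intro l hl
    have : (l : ℝ) ≤ k := by exact_mod_cast hl
    linarith
  have h3 := h f t 0 0 (by simp) fun η => by
    rw [Pi.zero_apply, add_zero]
    push_cast
    by_cases hη : η = 0
    · subst hη
      have e : t * ((0 : ℤ) : ℝ) ^ 2 = 0 := by simp
      rw [e]
      refine (hE _ _ (wsq_ymode_lt_top hw 0) (wsq_fourier_ymode_lt_top hθ hs 0) fun l hl =>
        integral_pow_mul_ymode_eq_zero (hlt l (by omega)) hw (hm0 l hl)).trans ?_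
      gcongr
      exact le_add_self
    · refine (hD _ _ _ (wsq_ymode_lt_top hw η) fun l hl =>
        integral_pow_mul_ymode_eq_zero hl hw (hm l ?_ η hη)).trans ?_
      · have h4 : (l : ℝ) < k + 1 := by linarith
        have h6 : l < k + 1 := by exact_mod_cast h4
        omega
      · gcongr
        exact le_self_add
  rwa [add_zero] at h3

/-- The index is shifted by one so that the range l < k of zero-mode moments needs no subtraction.
Nonzero modes rely on the critical sign estimate directly, the zero mode on the moment correction.
-/
theorem exists_weightedNorm_U_le_critical (k : ℕ) :
    ∃ C : ℝ, 0 < C ∧ ∀ f g : L2Cyl, InWeightedL2 (k + 3 / 2) f →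
      (∀ l : ℕ, l < k + 1 → ∀ η : ℤ, η ≠ 0 → moment l η f = 0) →
      (∀ l : ℕ, l < k → moment l 0 f = 0) →
      (∀ᵐ p : Cyl, g p = (p.1 : ℂ) ^ (k + 1) * f p) →
      ∀ t : ℝ, weightedNorm (k + 3 / 2) (U t f) ≤
        ENNReal.ofReal (C * bracket t ^ ((k : ℝ) + 3 / 2)) *
          (weightedNorm (k + 3 / 2) f + weightedNorm (1 / 2) (hilbertX g) +
            sobolevNorm (k + 3 / 2) 0 f) := by
  have hk : (0 : ℝ) ≤ k := k.cast_nonneg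
  have hθ : 0 ≤ (k : ℝ) + 3 / 2 := by linarith
  obtain ⟨A, hA⟩ := exists_wsq_psym_le hθ
  obtain ⟨D, hD⟩ := exists_wsq_sign_le_critical (k + 1)
  rw [show ((k + 1 : ℕ) : ℝ) + 1 / 2 = k + 3 / 2 by push_cast; ring] at hD
  obtain ⟨E, hE⟩ := exists_wsq_psym_zero_le_critical k
  obtain ⟨K, hK, h⟩ := exists_weightedNorm_U_le hθ (A * (1 + D) + E)
  refine ⟨K, hK, fun f g hf hm hm0 hg t => ?_⟩
  have hw := weightedNorm_lt_top hθ hf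
  have hlt : ∀ l : ℕ, l < k + 1 → (l : ℝ) + 1 / 2 < k + 3 / 2 := by
    intro l hl
    have : (l : ℝ) < k + 1 := by exact_mod_cast hl
    linarith
  refine h f t _ _ (weightedNorm_hilbertX_sq (1 / 2) g).ge fun η => ?_
  rw [ymode_pow_mul hg]
  push_cast
  by_cases hη : η = 0
  · subst hη
    have e : t * ((0 : ℤ) : ℝ) ^ 2 = 0 := by simp
    rw [e]
    refine (hE _ _ (wsq_ymode_lt_top hw 0) fun l hl =>
      integral_pow_mul_ymode_eq_zero (hlt l (by omega)) hw (hm0 l hl)).trans ?_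
    gcongr
    exact le_add_self
  · refine (hA _ _ _).trans ?_
    have h3 := hD _ (wsq_ymode_lt_top hw η) fun l hl =>
      integral_pow_mul_ymode_eq_zero (hlt l hl) hw (hm l hl η hη)
    set X := wsq (k + 3 / 2) (ymode f η)
    set Y := wsq (1 / 2) (FM sg (mulL (fun x : ℝ => (x : ℂ) ^ (k + 1)) (ymode f η)))
    set Z := wsq (k + 3 / 2) (𝓕 (ymode f η) : L2R)
    set w := wt (k + 3 / 2) (4 * Real.pi ^ 2 * t)
    calc _ ≤ A * w * (X + D * (X + Y) + Z) :=
          mul_le_mul_right (add_le_add (add_le_add le_rfl h3) le_rfl) _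
      _ ≤ A * w * (X + D * (X + Y) + Z) + (A * w * Y + A * w * (D * Z) + E * w * (X + Y + Z)) :=
          le_self_add
      _ = _ := by ring

end Cylinder

end

/-! ### The theorem -/

open Cylinder

theorem theorem1p1 :
    -- (i)
    (∀ θ : ℝ, 0 < θ → θ < 1 / 2 →
      ∃ C : ℝ, 0 < C ∧ ∀ f : L2Cyl, InSobolev θ 0 f → InWeightedL2 θ f →
        ∀ t : ℝ, weightedNorm θ (U t f) ≤
          ENNReal.ofReal (C * bracket t ^ θ) * (weightedNorm θ f + sobolevNorm θ 0 f)) ∧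
    -- (ii)
    (∃ C : ℝ, 0 < C ∧ ∀ f : L2Cyl, InSobolev (1 / 2) 0 f → InWeightedL2 (1 / 2) f →
        InWeightedL2 (1 / 2) (hilbertX f) →
        ∀ t : ℝ, weightedNorm (1 / 2) (U t f) ≤
          ENNReal.ofReal (C * bracket t ^ (1 / 2 : ℝ)) *
            (weightedNorm (1 / 2) f + weightedNorm (1 / 2) (hilbertX f) +
              sobolevNorm (1 / 2) 0 f)) ∧
    -- (iii)
    (∀ θ : ℝ, 1 / 2 < θ → θ < 3 / 2 →
      ∃ C : ℝ, 0 < C ∧ ∀ f : L2Cyl, InSobolev θ 0 f → InWeightedL2 θ f →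
        (∀ η : ℤ, η ≠ 0 → moment 0 η f = 0) →
        ∀ t : ℝ, weightedNorm θ (U t f) ≤
          ENNReal.ofReal (C * bracket t ^ θ) * (weightedNorm θ f + sobolevNorm θ 0 f)) ∧
    -- (iv), endpoint `θ = k + 1/2`; here `g` is the function `x^k f`
    (∀ k : ℕ, 1 ≤ k → ∀ θ : ℝ, θ = k + 1 / 2 →
      ∃ C : ℝ, 0 < C ∧ ∀ f g : L2Cyl, InSobolev θ 0 f → InWeightedL2 θ f →
        (∀ l : ℕ, l < k → ∀ η : ℤ, η ≠ 0 → moment l η f = 0) →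
        (∀ l : ℕ, l + 2 ≤ k → moment l 0 f = 0) →
        (∀ᵐ p : Cyl, g p = (p.1 : ℂ) ^ k * f p) →
        InWeightedL2 (1 / 2) (hilbertX g) →
        ∀ t : ℝ, weightedNorm θ (U t f) ≤
          ENNReal.ofReal (C * bracket t ^ θ) *
            (weightedNorm θ f + weightedNorm (1 / 2) (hilbertX g) + sobolevNorm θ 0 f)) ∧
    -- (iv), `k + 1/2 < θ < k + 3/2`
    (∀ k : ℕ, 1 ≤ k → ∀ θ : ℝ, k + 1 / 2 < θ → θ < k + 3 / 2 →
      ∃ C : ℝ, 0 < C ∧ ∀ f : L2Cyl, InSobolev θ 0 f → InWeightedL2 θ f →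
        (∀ l : ℕ, l ≤ k → ∀ η : ℤ, η ≠ 0 → moment l η f = 0) →
        (∀ l : ℕ, l + 2 ≤ k → moment l 0 f = 0) →
        ∀ t : ℝ, weightedNorm θ (U t f) ≤
          ENNReal.ofReal (C * bracket t ^ θ) * (weightedNorm θ f + sobolevNorm θ 0 f)) := by
  refine ⟨fun θ h0 h1 => exists_weightedNorm_U_le_of_lt_half h0 h1, ?_, ?_, ?_, ?_⟩
  · obtain ⟨C, hC, h⟩ := exists_weightedNorm_U_le_half
    exact ⟨C, hC, fun f _ _ _ t => h f t⟩
  · intro θ h1 h2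
    -- For k = 0 only the mean of the nonzero modes is constrained; the zero mode is free.
    obtain ⟨C, hC, h⟩ := exists_weightedNorm_U_le_of_moments (k := 0) (θ := θ) (by simpa using h1)
      (by simpa using h2)
    exact ⟨C, hC, fun f hs hf hm => h f hs hf
      (fun l hl η hη => by rw [Nat.le_zero.1 hl]; exact hm η hη) fun l hl => by omega⟩
  · intro k hk θ hθ
    obtain ⟨k, rfl⟩ := Nat.exists_eq_add_of_le' hk
    have e : θ = k + 3 / 2 := by rw [hθ]; push_cast; ring
    subst e
    obtain ⟨C, hC, h⟩ := exists_weightedNorm_U_le_critical k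
    exact ⟨C, hC, fun f g _ hf hm hm0 hg _ => h f g hf hm (fun l hl => hm0 l (by omega)) hg⟩
  · exact fun k _ θ h1 h2 => exists_weightedNorm_U_le_of_moments h1 h2
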